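/- **Setting.** A ($\mathbb Z_{\ge 0}$-graded) *vertex Lie algebra* is a complex vector space $\mathscr L=\bigoplus_{n\ge 0}\mathscr L_{(n)}$ with a linear map $\mathcal D:\mathscr L\to\mathscr L$ of degree $1$, a vector $\mathsf c\in\mathscr L_{(0)}$ with $\ker\mathcal D=\mathbb C\mathsf c$ and $\mathsf c\notin\operatorname{Im}\mathcal D$, and bilinear products $(a,b)\mapsto a_{(n)}b$, $n\ge 0$, where $a_{(n)}b$ has degree $\deg a+\deg b-n-1$ (and is zero if this number is negative), such that $a_{(n)}b=0$ for $n$ large (depending on $a,b$), and for $m,n\geq 0$ $$(\mathcal Da)_{(n)}b=-n\,a_{(n-1)}b,\qquad a_{(n)}b=-\sum_{k\ge 0}\tfrac{(-1)^{n+k}}{k!}\mathcal D^k\big(b_{(n+k)}a\big),\qquad a_{(m)}(b_{(n)}c)-b_{(n)}(a_{(m)}c)=\sum_{k=0}^{m}\tbinom mk (a_{(k)}b)_{(m+n-k)}c .$$ For a commutative associative algebra $\mathcal A$ over $\mathbb C$ (not necessarily unital) with a derivation $\partial$, let $\mathrm{Lie}_{\mathcal A}\mathscr L:=(\mathscr L\otimes\mathcal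 A)/\operatorname{Im}(\mathcal D\otimes 1+1\otimes\partial)$, with quotient map $\rho$; it is a Lie algebra with bracket $[\rho(a\otimes f),\rho(b\otimes g)]=\sum_{n\ge 0}\frac1{n!}\rho\big(a_{(n)}b\otimes(\partial^nf)g\big)$. Let $\mathsf L(\mathscr L):=\mathrm{Lie}_{\mathbb C((t))}\mathscr L$ with $\partial=\partial_t$, and $\mathsf c(-1):=\rho(\mathsf c\otimes t^{-1})$. Let $\Gamma\subset\mathbb C^\times$ be the group of $T$-th roots of unity, $T\ge 1$, generated by a primitive root $\omega$, and let $\sigma$ be an automorphism of $\mathscr L$ (it commutes with $\mathcal D$, preserves all products and degrees, and fixes $\mathsf c$) with $\sigma^T=\mathrm{id}$. For $\alpha=\omega^k\in\Gamma$ put $R_\alpha:=\alpha^{L(0)}\sigma^k$, where $\alpha^{L(0)}$ is multiplication by $\alpha^n$ on $\mathscr L_{(n)}$. The group $\Gamma$ acts on $\mathsf L(\mathscr L)$, and on $\mathrm{Lie}_{\mathcal A}\mathscr L$ for each algebra $\mathcal A$ of rational functions used below, by $\alpha.\rho(a\otimes f(t))=\rho(\alpha^{-1}R_\alpha a\otimes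 f(\alpha^{-1}t))$. Let $\mathsf L(\mathscr L)^\Gamma$ be the Lie subalgebra of invariants. Fix a graded subspace $\mathscr L^o\subset\mathscr L$ with $\mathscr L=\mathscr L^o\oplus\mathbb C\mathsf c\oplus\operatorname{Im}\mathcal D$ and $\sigma(\mathscr L^o)\subset\mathscr L^o\oplus\operatorname{Im}\mathcal D$. For a finite family $\bm z=(z_1,\dots,z_N)$ of nonzero points with pairwise disjoint $\Gamma$-orbits let $\mathcal A_{\bm z}$ (respectively $\mathcal A_{\bm z,0}$) be the algebra of rational functions vanishing at infinity with poles at most in $\Gamma\bm z$ (respectively $\Gamma\bm z\cup\{0\}$), with $\partial=\partial_t$, and put $$I_{\bm z}:=\mathrm{span}\Big\{\rho\Big(\sum_{\alpha\in\Gamma}\tfrac{\mathsf c}{t-\alpha z_i}-\sum_{\alpha\in\Gamma}\tfrac{\mathsf c}{t-\alpha z_j}\Big)\Big\}_{i,j}\subset\mathrm{Lie}_{\mathcal A_{\bm z}}\mathscr L,\qquad I_{\bm z,0}:=\mathrm{span}\Big\{\rho\Big(\sum_{\alpha\in\Gamma}\tfrac{\mathsf c}{t-\alpha z_i}-\tfrac{T\mathsf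 c}{t}\Big)\Big\}_{i}\subset\mathrm{Lie}_{\mathcal A_{\bm z,0}}\mathscr L .$$ Let $\mathsf L^\Gamma_{\bm z}(\mathscr L)$ (respectively $\mathsf L^\Gamma_{\bm z,0}(\mathscr L)$) be the space of $\Gamma$-invariants in the image of $\rho(\mathscr L^o\otimes\mathcal A_{\bm z})$ in $(\mathrm{Lie}_{\mathcal A_{\bm z}}\mathscr L)/I_{\bm z}$ (respectively of $\rho(\mathscr L^o\otimes\mathcal A_{\bm z,0})$ in $(\mathrm{Lie}_{\mathcal A_{\bm z,0}}\mathscr L)/I_{\bm z,0}$). Let $M_{z_i}$ be an $\mathsf L(\mathscr L)$-module of level $1$ (that is, $\mathsf c(-1)$ acts as the identity), assigned to the point $z_i$: a class $\rho(a\otimes f)$, with $f$ a rational function, acts on it through the Laurent expansion of $f$ in the local coordinate $t-z_i$. Let $M_0$ be an $\mathsf L(\mathscr L)^\Gamma$-module of level $1/T$ ($\mathsf c(-1)$ acts as $\frac1T$), assigned to the origin: invariant elements act on it through their Laurent expansion in $t$. Then $\mathsf L^\Gamma_{\bm z}(\mathscr L)$ acts on $\bigotimes_iM_{z_i}$ and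 $\mathsf L^\Gamma_{\bm z,0}(\mathscr L)$ acts on $\bigotimes_iM_{z_i}\otimes M_0$, by the sum of the actions on the tensor factors. For such an action of $K$ on $W$, the space of coinvariants $W/K$ is the quotient of $W$ by the span of all $x\cdot w$, $x\in K$, $w\in W$. Let $\mathbb V(\mathscr L)$ be the vacuum Verma module: the $\mathsf L(\mathscr L)$-module generated by a vector $|0\rangle$ subject to $\mathsf c(-1)|0\rangle=|0\rangle$ and $\rho(a\otimes f)|0\rangle=0$ for all $a\in\mathscr L$, $f\in\mathbb C[[t]]$. **Proposition.** Let $u\in\mathbb C^\times\setminus\Gamma\bm z$ and assign $\mathbb V(\mathscr L)$ to the point $u$. There is a linear isomorphism $$\mathbb V(\mathscr L)\otimes\bigotimes_{i=1}^NM_{z_i}\Big/\mathsf L^\Gamma_{u,\bm z}(\mathscr L)\;\xrightarrow{\ \sim\ }\;\bigotimes_{i=1}^NM_{z_i}\Big/\mathsf L^\Gamma_{\bm z}(\mathscr L)$$ which sends the class of $|0\rangle\otimes m$ to the class of $m$ for every $m\in\bigotimes_iM_{z_i}$. Likewise, for every $M_0$ as above there is a linear isomorphism $$\mathbb V(\mathscr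 L)\otimes\bigotimes_{i=1}^NM_{z_i}\otimes M_0\Big/\mathsf L^\Gamma_{u,\bm z,0}(\mathscr L)\;\xrightarrow{\ \sim\ }\;\bigotimes_{i=1}^NM_{z_i}\otimes M_0\Big/\mathsf L^\Gamma_{\bm z,0}(\mathscr L)$$ which sends the class of $|0\rangle\otimes m$ to the class of $m$ for every $m\in\bigotimes_iM_{z_i}\otimes M_0$. (Here $\mathsf L^\Gamma_{u,\bm z}$ and $\mathsf L^\Gamma_{u,\bm z,0}$ are the spaces above for the family $(u,z_1,\dots,z_N)$.) -/

import Mathlib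

universe u v w

open scoped TensorProduct

/-! ## Vertex Lie algebras -/

/-- A `ℤ≥0`-graded vertex Lie algebra over `ℂ`, in the convention in which the kernel of the
translation operator `D` is one-dimensional, spanned by a vector `cent` outside the image of `D`.
`nprod n a b` is the `n`-th product `a_(n) b`. -/
class VertexLieAlgebra (𝓛 : Type*) [AddCommGroup 𝓛] [Module ℂ 𝓛] where
  /-- the translation operator -/
  D : 𝓛 →ₗ[ℂ] 𝓛
  /-- the central vector spanning `ker D` -/
  cent : 𝓛
  ker_D : LinearMap.ker D = Submodule.span ℂ {cent}
  cent_notMem : cent ∉ LinearMap.range D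
  /-- the `n`-th products -/
  nprod : ℕ → 𝓛 →ₗ[ℂ] 𝓛 →ₗ[ℂ] 𝓛
  locality : ∀ a b : 𝓛, ∃ N : ℕ, ∀ n, N ≤ n → nprod n a b = 0
  translation : ∀ (n : ℕ) (a b : 𝓛), nprod n (D a) b = -((n : ℂ) • nprod (n - 1) a b)
  skew : ∀ (n : ℕ) (a b : 𝓛), nprod n a b =
    -∑ᶠ k : ℕ, ((-1 : ℂ) ^ (n + k) / (k.factorial : ℂ)) • (D ^ k) (nprod (n + k) b a)
  commutator : ∀ (m n : ℕ) (a b c : 𝓛),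
    nprod m a (nprod n b c) - nprod n b (nprod m a c) =
      ∑ k ∈ Finset.range (m + 1), (m.choose k : ℂ) • nprod (m + n - k) (nprod k a b) c
  /-- the homogeneous components -/
  gr : ℕ → Submodule ℂ 𝓛
  gr_internal : DirectSum.IsInternal gr
  D_mem : ∀ (n : ℕ) (a : 𝓛), a ∈ gr n → D a ∈ gr (n + 1)
  nprod_mem : ∀ (p q n m : ℕ) (a b : 𝓛), a ∈ gr p → b ∈ gr q → m + n + 1 = p + q →
    nprod n a b ∈ gr m
  /-- components of negative degree vanish -/
  nprod_eq_zero : ∀ (p q n : ℕ) (a b : 𝓛), a ∈ gr p → b ∈ gr q → p + q < n + 1 →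
    nprod n a b = 0
  cent_mem : cent ∈ gr 0

/-- A commutative associative (not necessarily unital) algebra with a derivation `δ`. -/
class DerivationAlgebra (A : Type*) [NonUnitalCommRing A] [Module ℂ A] where
  /-- the derivation -/
  δ : A →ₗ[ℂ] A
  leibniz : ∀ f g : A, δ (f * g) = δ f * g + f * δ g

noncomputable section

namespace VertexLieAlgebra

open DerivationAlgebra

section LieOf

variable (𝓛 : Type*) [AddCommGroup 𝓛] [Module ℂ 𝓛] [VertexLieAlgebra 𝓛]
variable (A : Type*) [NonUnitalCommRing A] [Module ℂ A] [DerivationAlgebra A]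

/-- The operator `∂ = D ⊗ 1 + 1 ⊗ δ` on `𝓛 ⊗ A`. -/
def del : 𝓛 ⊗[ℂ] A →ₗ[ℂ] 𝓛 ⊗[ℂ] A :=
  TensorProduct.map D LinearMap.id + TensorProduct.map LinearMap.id δ

/-- The Lie algebra `Lie_A 𝓛 = (𝓛 ⊗ A) / Im ∂`. -/
def LieOf : Type _ := (𝓛 ⊗[ℂ] A) ⧸ LinearMap.range (del 𝓛 A)

instance : AddCommGroup (LieOf 𝓛 A) :=
  inferInstanceAs (AddCommGroup ((𝓛 ⊗[ℂ] A) ⧸ LinearMap.range (del 𝓛 A)))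

instance : Module ℂ (LieOf 𝓛 A) :=
  inferInstanceAs (Module ℂ ((𝓛 ⊗[ℂ] A) ⧸ LinearMap.range (del 𝓛 A)))

/-- The quotient map `ρ : 𝓛 ⊗ A → Lie_A 𝓛`. -/
def rho : 𝓛 ⊗[ℂ] A →ₗ[ℂ] LieOf 𝓛 A := (LinearMap.range (del 𝓛 A)).mkQ

variable {𝓛 A}

lemma rho_surjective : Function.Surjective (rho 𝓛 A) := Submodule.mkQ_surjective _

lemma rho_del (x : 𝓛 ⊗[ℂ] A) : rho 𝓛 A (del 𝓛 A x) = 0 :=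
  (Submodule.Quotient.mk_eq_zero _).2 ⟨x, rfl⟩

lemma del_tmul (a : 𝓛) (f : A) : del 𝓛 A (a ⊗ₜ f) = D a ⊗ₜ f + a ⊗ₜ δ f := by
  simp [del]

/-- All `n`-th products of two elements, as a finitely supported sequence. -/
def prods : 𝓛 →ₗ[ℂ] 𝓛 →ₗ[ℂ] (ℕ →₀ 𝓛) :=
  LinearMap.mk₂ ℂ
    (fun a b => Finsupp.ofSupportFinite (fun n => nprod n a b) (by
      obtain ⟨N, hN⟩ := locality a b
      refine (Set.finite_lt_nat N).subset fun n hn => ?_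
      by_contra h
      exact hn (hN n (not_lt.1 h))))
    (fun _ _ _ => by ext n; simp [Finsupp.ofSupportFinite]; rfl)
    (fun _ _ _ => by ext n; simp [Finsupp.ofSupportFinite]; rfl)
    (fun _ _ _ => by ext n; simp [Finsupp.ofSupportFinite]; rfl)
    (fun _ _ _ => by ext n; simp [Finsupp.ofSupportFinite]; rfl)

lemma prods_apply (a b : 𝓛) (n : ℕ) : prods a b n = nprod n a b := rfl

/-- The divided power `δ ^ n / n!` of the derivation. -/
def divPow (n : ℕ) : A →ₗ[ℂ] A := ((n.factorial : ℂ)⁻¹) • ((δ : A →ₗ[ℂ] A) ^ n)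

lemma divPow_zero (f : A) : divPow 0 f = f := by simp [divPow]

lemma divPow_succ (n : ℕ) (f : A) :
    ((n + 1 : ℕ) : ℂ) • divPow (n + 1) f = divPow n (δ f) := by
  have h : ((n + 1 : ℕ) : ℂ) ≠ 0 := by exact_mod_cast Nat.succ_ne_zero n
  have h2 : (n.factorial : ℂ) ≠ 0 := by exact_mod_cast n.factorial_ne_zero
  simp only [divPow, LinearMap.smul_apply, smul_smul, pow_succ, Nat.factorial_succ, Nat.cast_mul,
    Module.End.mul_apply]
  congr 1
  field_simp

lemma divPow_succ' (n : ℕ) (f : A) :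
    ((n + 1 : ℕ) : ℂ) • divPow (n + 1) f = δ (divPow n f) := by
  rw [divPow_succ]
  simp only [divPow, LinearMap.smul_apply, map_smul]
  congr 1
  rw [← Module.End.mul_apply, ← Module.End.mul_apply, ← pow_succ, ← pow_succ']

lemma divPow_comp (m n : ℕ) (f : A) :
    divPow m (divPow n f) = ((m + n).choose m : ℂ) • divPow (m + n) f := by
  have h1 : (m.factorial : ℂ) ≠ 0 := by exact_mod_cast m.factorial_ne_zero
  have h2 : (n.factorial : ℂ) ≠ 0 := by exact_mod_cast n.factorial_ne_zero
  have h3 : ((m + n).factorial : ℂ) ≠ 0 := by exact_mod_cast (m + n).factorial_ne_zero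
  have h4 : ((m + n).choose m : ℂ) * m.factorial * n.factorial = (m + n).factorial := by
    have := Nat.choose_mul_factorial_mul_factorial (Nat.le_add_right m n)
    rw [Nat.add_sub_cancel_left] at this
    exact_mod_cast this
  simp only [divPow, LinearMap.smul_apply, map_smul, smul_smul, pow_add, Module.End.mul_apply]
  congr 1
  field_simp
  linear_combination -h4

variable [IsScalarTower ℂ A A] [SMulCommClass ℂ A A]

lemma divPow_mul (n : ℕ) (f g : A) :
    divPow n (f * g) = ∑ ij ∈ Finset.HasAntidiagonal.antidiagonal n, divPow ij.1 f * divPow ij.2 g := by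
  induction n with
  | zero => simp [divPow_zero]
  | succ n ih =>
    have h : ((n + 1 : ℕ) : ℂ) ≠ 0 := by exact_mod_cast Nat.succ_ne_zero n
    refine smul_right_injective A h ?_
    show ((n + 1 : ℕ) : ℂ) • divPow (n + 1) (f * g) = ((n + 1 : ℕ) : ℂ) • _
    rw [divPow_succ', ih, map_sum]
    simp only [leibniz, ← divPow_succ', Finset.sum_add_distrib]
    have e1 := Finset.Nat.sum_antidiagonal_succ (n := n)
      (f := fun ij => ((ij.1 : ℕ) : ℂ) • (divPow ij.1 f * divPow ij.2 g))
    have e2 := Finset.Nat.sum_antidiagonal_succ' (n := n)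
      (f := fun ij => ((ij.2 : ℕ) : ℂ) • (divPow ij.1 f * divPow ij.2 g))
    simp only [Nat.cast_zero, zero_smul, zero_add] at e1 e2
    simp only [smul_mul_assoc, mul_smul_comm]
    rw [← e1, ← e2, ← Finset.sum_add_distrib, Finset.smul_sum]
    refine Finset.sum_congr rfl fun ij hij => ?_
    rw [← add_smul, ← Nat.cast_add, Finset.HasAntidiagonal.mem_antidiagonal.1 hij]

/-- The sequence `n ↦ (δ ^ n f / n!) g`. -/
def mulSeq : A →ₗ[ℂ] A →ₗ[ℂ] (ℕ → A) :=
  LinearMap.mk₂ ℂ (fun f g n => divPow n f * g)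
    (fun _ _ _ => by ext n; simp [add_mul])
    (fun _ _ _ => by ext n; simp [smul_mul_assoc])
    (fun _ _ _ => by ext n; simp [mul_add])
    (fun _ _ _ => by ext n; simp [mul_smul_comm])

/-- The contraction `(x_n) ⊗ (h_n) ↦ ∑ x_n ⊗ h_n`. -/
def contr : (ℕ →₀ 𝓛) ⊗[ℂ] (ℕ → A) →ₗ[ℂ] 𝓛 ⊗[ℂ] A :=
  TensorProduct.lift (Finsupp.lsum ℂ fun n =>
    (TensorProduct.mk ℂ 𝓛 A).compl₂ (LinearMap.proj n))

/-- The bilinear operation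
`(a ⊗ f, b ⊗ g) ↦ ∑ₙ (1 / n!) a_(n) b ⊗ (δ ^ n f) g` on `𝓛 ⊗ A`. -/
def preBracket : 𝓛 ⊗[ℂ] A →ₗ[ℂ] 𝓛 ⊗[ℂ] A →ₗ[ℂ] 𝓛 ⊗[ℂ] A :=
  (TensorProduct.map₂ prods mulSeq).compr₂ contr

lemma preBracket_tmul (a b : 𝓛) (f g : A) (N : ℕ) (hN : ∀ n, N ≤ n → nprod n a b = 0) :
    preBracket (a ⊗ₜ f) (b ⊗ₜ g) =
      ∑ n ∈ Finset.range N, nprod n a b ⊗ₜ[ℂ] (divPow n f * g) := by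
  simp only [preBracket, LinearMap.compr₂_apply, TensorProduct.map₂_apply_tmul, contr,
    TensorProduct.map_tmul, TensorProduct.lift.tmul]
  rw [Finsupp.lsum_apply]
  rw [Finsupp.sum_of_support_subset (s := Finset.range N)]
  · simp [LinearMap.sum_apply, prods_apply, mulSeq]
  · intro n hn
    rw [Finset.mem_range]
    by_contra h
    exact (Finsupp.mem_support_iff.1 hn) (hN n (not_lt.1 h))
  · simp

lemma exists_bound (a b : 𝓛) : ∀ᶠ N in Filter.atTop, ∀ n, N ≤ n → nprod n a b = 0 := by
  obtain ⟨N, hN⟩ := locality a b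
  exact Filter.eventually_atTop.2 ⟨N, fun M hM n hn => hN n (hM.trans hn)⟩

lemma exists_bound₂ (K : ℕ) (x y : ℕ → 𝓛) :
    ∀ᶠ N in Filter.atTop, ∀ k ∈ Finset.range K, ∀ n, N ≤ n → nprod n (x k) (y k) = 0 :=
  (Filter.eventually_all_finset _).2 fun _ _ => exists_bound _ _

lemma preBracket_del_left (x y : 𝓛 ⊗[ℂ] A) : preBracket (del 𝓛 A x) y = 0 := by
  induction x with
  | zero => simp
  | add x x' hx hx' => simp [hx, hx']
  | tmul a f =>
    induction y with
    | zero => simp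
    | add y y' hy hy' => simp [hy, hy']
    | tmul b g =>
      obtain ⟨N, h1, h2⟩ := ((exists_bound (D a) b).and (exists_bound a b)).exists
      rw [del_tmul, map_add, LinearMap.add_apply, preBracket_tmul _ _ _ _ (N + 1)
        (fun n hn => h1 n (by omega)), preBracket_tmul _ _ _ _ N h2, Finset.sum_range_succ']
      have h0 : nprod 0 (D a) b = 0 := by rw [translation]; simp
      rw [h0, TensorProduct.zero_tmul, add_zero, ← Finset.sum_add_distrib]
      refine Finset.sum_eq_zero fun n _ => ?_
      rw [translation, ← divPow_succ, TensorProduct.neg_tmul, TensorProduct.smul_tmul,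
        smul_mul_assoc, Nat.add_sub_cancel, neg_add_cancel]

lemma rho_D_pow (k : ℕ) (a : 𝓛) (h : A) :
    rho 𝓛 A ((D ^ k : 𝓛 →ₗ[ℂ] 𝓛) a ⊗ₜ h) =
      ((-1 : ℂ) ^ k * (k.factorial : ℂ)) • rho 𝓛 A (a ⊗ₜ divPow k h) := by
  induction k generalizing h with
  | zero => simp [divPow_zero]
  | succ k ih =>
    have e := rho_del ((D ^ k : 𝓛 →ₗ[ℂ] 𝓛) a ⊗ₜ[ℂ] h)
    rw [del_tmul, map_add] at e
    rw [pow_succ', Module.End.mul_apply, eq_neg_of_add_eq_zero_left e, ih, ← divPow_succ,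
      TensorProduct.tmul_smul, map_smul, smul_smul, ← neg_smul, Nat.factorial_succ]
    congr 1
    push_cast
    ring

lemma rho_preBracket_skew (x y : 𝓛 ⊗[ℂ] A) :
    rho 𝓛 A (preBracket x y) = -rho 𝓛 A (preBracket y x) := by
  induction x with
  | zero => simp
  | add x x' hx hx' => simp only [map_add, LinearMap.add_apply, hx, hx']; abel
  | tmul a f =>
    induction y with
    | zero => simp
    | add y y' hy hy' => simp only [map_add, LinearMap.add_apply, hy, hy']; abel
    | tmul b g =>
      obtain ⟨N, h1, h2⟩ := ((exists_bound a b).and (exists_bound b a)).exists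
      rw [preBracket_tmul _ _ _ _ N h1, preBracket_tmul _ _ _ _ N h2, map_sum, map_sum]
      -- the common summand
      let K : ℕ × ℕ × ℕ → LieOf 𝓛 A := fun t =>
        ((-1 : ℂ) ^ t.1 * ((t.2.1 + t.1).choose t.1 : ℂ)) •
          rho 𝓛 A (nprod (t.1 + t.2.1 + t.2.2) b a ⊗ₜ
            (divPow (t.2.1 + t.1) f * divPow t.2.2 g))
      have hK : ∀ t, N ≤ t.1 + t.2.1 + t.2.2 → K t = 0 := fun t ht => by
        simp [K, h2 _ ht]
      let C : Finset (ℕ × ℕ × ℕ) := Finset.range N ×ˢ Finset.range N ×ˢ Finset.range N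
      have hL : ∑ n ∈ Finset.range N, rho 𝓛 A (nprod n a b ⊗ₜ (divPow n f * g)) =
          -∑ t ∈ C, K t := by
        have e : ∀ n ∈ Finset.range N, rho 𝓛 A (nprod n a b ⊗ₜ (divPow n f * g)) =
            -∑ k ∈ Finset.range (2 * N), ∑ ij ∈ Finset.HasAntidiagonal.antidiagonal k,
              K (n, ij.1, ij.2) := by
          intro n _
          rw [skew, finsum_eq_sum_of_support_subset (s := Finset.range (2 * N))]
          · rw [TensorProduct.neg_tmul, map_neg, TensorProduct.sum_tmul, map_sum]
            congr 1
            refine Finset.sum_congr rfl fun k _ => ?_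
            rw [← TensorProduct.smul_tmul', map_smul, rho_D_pow, smul_smul, divPow_mul,
              TensorProduct.tmul_sum, map_sum, Finset.smul_sum]
            refine Finset.sum_congr rfl fun ij hij => ?_
            have hk := Finset.HasAntidiagonal.mem_antidiagonal.1 hij
            have hf : (k.factorial : ℂ) ≠ 0 := by exact_mod_cast k.factorial_ne_zero
            rw [divPow_comp, smul_mul_assoc, TensorProduct.tmul_smul, map_smul, smul_smul]
            simp only [K]
            rw [← hk, add_assoc n, Nat.choose_symm_add]
            congr 1
            rw [hk]
            have : ((-1 : ℂ) ^ k) * (-1) ^ k = 1 := by rw [← mul_pow]; simp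
            rw [pow_add]
            field_simp
            linear_combination ((ij.1 + n).choose n : ℂ) * this
          · intro k hk
            rw [Finset.coe_range, Set.mem_Iio]
            by_contra hlt
            refine hk ?_
            simp only [h2 (n + k) (by omega), map_zero, smul_zero]
        rw [Finset.sum_congr rfl e, Finset.sum_neg_distrib]
        congr 1
        rw [Finset.sum_sigma', Finset.sum_sigma']
        symm
        refine Finset.sum_of_injOn (fun t => ⟨⟨t.1, t.2.1 + t.2.2⟩, (t.2.1, t.2.2)⟩) ?_ ?_ ?_ ?_
        · rintro ⟨n, i, j⟩ _ ⟨n', i', j'⟩ _ h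
          simp at h
          simp [h]
        · rintro ⟨n, i, j⟩ h
          simp [C] at h ⊢
          omega
        · rintro ⟨⟨n, k⟩, ⟨i, j⟩⟩ h hn
          simp at h
          refine hK _ ?_
          by_contra hlt
          refine hn ⟨(n, i, j), ?_, ?_⟩
          · simp [C] at hlt ⊢; omega
          · simp [h.2]
        · rintro ⟨n, i, j⟩ _
          rfl
      have hR : ∑ n ∈ Finset.range N, rho 𝓛 A (nprod n b a ⊗ₜ (divPow n g * f)) =
          ∑ t ∈ C, K t := by
        have e : ∀ j ∈ Finset.range N, rho 𝓛 A (nprod j b a ⊗ₜ (divPow j g * f)) =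
            ∑ p ∈ Finset.range (2 * N), ∑ n ∈ Finset.range (p + 1), K (n, p - n, j) := by
          intro j hj
          have hz : ∀ p, ∑ n ∈ Finset.range (p + 1), K (n, p - n, j) =
              if p = 0 then rho 𝓛 A (nprod j b a ⊗ₜ (divPow j g * f)) else 0 := by
            intro p
            have : ∀ n ∈ Finset.range (p + 1), K (n, p - n, j) =
                (((-1 : ℤ) ^ n * (p.choose n : ℤ) : ℤ) : ℂ) • rho 𝓛 A (nprod (p + j) b a ⊗ₜ
                  (divPow p f * divPow j g)) := by
              intro n hn
              have hn' : n ≤ p := by simp at hn; omega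
              simp only [K, Nat.sub_add_cancel hn', Nat.add_sub_cancel' hn']
              push_cast
              rfl
            rw [Finset.sum_congr rfl this, ← Finset.sum_smul, ← Int.cast_sum,
              Int.alternating_sum_range_choose]
            split_ifs with h
            · subst h
              simp [divPow_zero, mul_comm]
            · simp
          simp only [hz]
          rw [Finset.sum_ite_eq' (Finset.range (2 * N)) 0, if_pos]
          simp at hj ⊢; omega
        rw [Finset.sum_congr rfl e, Finset.sum_sigma', Finset.sum_sigma']
        symm
        refine Finset.sum_of_injOn (fun t => ⟨⟨t.2.2, t.1 + t.2.1⟩, t.1⟩) ?_ ?_ ?_ ?_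
        · rintro ⟨n, i, j⟩ _ ⟨n', i', j'⟩ _ h
          simp at h
          simp
          omega
        · rintro ⟨n, i, j⟩ h
          simp [C] at h ⊢
          omega
        · rintro ⟨⟨j, p⟩, n⟩ h hn
          simp at h
          refine hK _ ?_
          by_contra hlt
          refine hn ⟨(n, p - n, j), ?_, ?_⟩
          · simp [C] at hlt ⊢; omega
          · simp; omega
        · rintro ⟨n, i, j⟩ _
          simp [K]
      rw [hL, hR]

lemma preBracket_leibniz (x y z : 𝓛 ⊗[ℂ] A) :
    preBracket x (preBracket y z) =
      preBracket (preBracket x y) z + preBracket y (preBracket x z) := by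
  induction x with
  | zero => simp
  | add x x' hx hx' => simp only [map_add, LinearMap.add_apply, hx, hx']; abel
  | tmul a f =>
  induction y with
  | zero => simp
  | add y y' hy hy' => simp only [map_add, LinearMap.add_apply, hy, hy']; abel
  | tmul b g =>
  induction z with
  | zero => simp
  | add z z' hz hz' => simp only [map_add, hz, hz']; abel
  | tmul c h =>
    obtain ⟨M₀, h1, h2, h3⟩ :=
      ((exists_bound a b).and ((exists_bound b c).and (exists_bound a c))).exists
    obtain ⟨M, hM, h4, h5, h6⟩ := ((Filter.eventually_ge_atTop M₀).and
      ((exists_bound₂ M₀ (fun k => nprod k a b) (fun _ => c)).and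
      ((exists_bound₂ M₀ (fun _ => a) (fun k => nprod k b c)).and
      (exists_bound₂ M₀ (fun _ => b) (fun k => nprod k a c))))).exists
    have h4' : ∀ k n, M ≤ k ∨ M ≤ n → nprod n (nprod k a b) c = 0 := by
      rintro k n hkn
      by_cases hk : k < M₀
      · exact h4 k (by simpa using hk) n (by omega)
      · rw [h1 k (by omega)]; simp
    have h5' : ∀ k n, M ≤ k ∨ M ≤ n → nprod n a (nprod k b c) = 0 := by
      rintro k n hkn
      by_cases hk : k < M₀
      · exact h5 k (by simpa using hk) n (by omega)
      · rw [h2 k (by omega)]; simp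
    have h6' : ∀ k n, M ≤ k ∨ M ≤ n → nprod n b (nprod k a c) = 0 := by
      rintro k n hkn
      by_cases hk : k < M₀
      · exact h6 k (by simpa using hk) n (by omega)
      · rw [h3 k (by omega)]; simp
    have e1 : preBracket (a ⊗ₜ f) (preBracket (b ⊗ₜ g) (c ⊗ₜ[ℂ] h)) =
        ∑ n ∈ Finset.range (2 * M), ∑ m ∈ Finset.range (2 * M),
          nprod m a (nprod n b c) ⊗ₜ[ℂ] (divPow m f * (divPow n g * h)) := by
      rw [preBracket_tmul b c g h (2 * M) (fun n hn => h2 n (by omega)), map_sum]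
      exact Finset.sum_congr rfl fun n _ =>
        preBracket_tmul _ _ _ _ _ fun m hm => h5' n m (by omega)
    have e2 : preBracket (b ⊗ₜ g) (preBracket (a ⊗ₜ f) (c ⊗ₜ[ℂ] h)) =
        ∑ n ∈ Finset.range (2 * M), ∑ m ∈ Finset.range (2 * M),
          nprod n b (nprod m a c) ⊗ₜ[ℂ] (divPow m f * (divPow n g * h)) := by
      rw [preBracket_tmul a c f h (2 * M) (fun n hn => h3 n (by omega)), map_sum,
        Finset.sum_comm]
      refine Finset.sum_congr rfl fun m _ => ?_
      rw [preBracket_tmul _ _ _ _ (2 * M) fun n hn => h6' m n (by omega)]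
      exact Finset.sum_congr rfl fun n _ => by rw [mul_left_comm]
    let H : ℕ × ℕ × ℕ → 𝓛 ⊗[ℂ] A := fun t =>
      ((t.2.1 + t.1).choose t.1 : ℂ) • (nprod (t.2.1 + t.2.2) (nprod t.1 a b) c ⊗ₜ[ℂ]
        (divPow (t.2.1 + t.1) f * (divPow t.2.2 g * h)))
    have hH : ∀ t, M ≤ t.1 ∨ M ≤ t.2.1 + t.2.2 → H t = 0 := fun t ht => by
      simp [H, h4' _ _ ht]
    let C : Finset (ℕ × ℕ × ℕ) := Finset.range M ×ˢ Finset.range M ×ˢ Finset.range M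
    have e3 : preBracket (preBracket (a ⊗ₜ f) (b ⊗ₜ g)) (c ⊗ₜ[ℂ] h) = ∑ t ∈ C, H t := by
      have e : preBracket (preBracket (a ⊗ₜ f) (b ⊗ₜ g)) (c ⊗ₜ[ℂ] h) =
          ∑ k ∈ Finset.range (2 * M), ∑ p ∈ Finset.range (2 * M),
            ∑ ij ∈ Finset.HasAntidiagonal.antidiagonal p, H (k, ij.1, ij.2) := by
        rw [preBracket_tmul a b f g (2 * M) (fun n hn => h1 n (by omega)), map_sum,
          LinearMap.sum_apply]
        refine Finset.sum_congr rfl fun k _ => ?_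
        rw [preBracket_tmul _ _ _ _ (2 * M) fun n hn => h4' k n (by omega)]
        refine Finset.sum_congr rfl fun p _ => ?_
        rw [divPow_mul, Finset.sum_mul, TensorProduct.tmul_sum]
        refine Finset.sum_congr rfl fun ij hij => ?_
        simp only [H]
        rw [Finset.HasAntidiagonal.mem_antidiagonal.1 hij, divPow_comp, Nat.choose_symm_add,
          smul_mul_assoc, smul_mul_assoc, TensorProduct.tmul_smul, mul_assoc]
      rw [e, Finset.sum_sigma', Finset.sum_sigma']
      symm
      refine Finset.sum_of_injOn (fun t => ⟨⟨t.1, t.2.1 + t.2.2⟩, (t.2.1, t.2.2)⟩) ?_ ?_ ?_ ?_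
      · rintro ⟨n, i, j⟩ _ ⟨n', i', j'⟩ _ h
        simp at h
        simp [h]
      · rintro ⟨n, i, j⟩ h
        simp [C] at h ⊢
        omega
      · rintro ⟨⟨n, k⟩, ⟨i, j⟩⟩ h hn
        simp at h
        refine hH _ ?_
        by_contra hlt
        refine hn ⟨(n, i, j), ?_, ?_⟩
        · simp [C] at hlt ⊢; omega
        · simp [h.2]
      · rintro ⟨n, i, j⟩ _
        rfl
    rw [← sub_eq_iff_eq_add, e1, e2, e3, ← Finset.sum_sub_distrib]
    have e : ∀ n ∈ Finset.range (2 * M),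
        (∑ m ∈ Finset.range (2 * M),
            nprod m a (nprod n b c) ⊗ₜ[ℂ] (divPow m f * (divPow n g * h)) -
          ∑ m ∈ Finset.range (2 * M),
            nprod n b (nprod m a c) ⊗ₜ[ℂ] (divPow m f * (divPow n g * h))) =
          ∑ m ∈ Finset.range (2 * M), ∑ k ∈ Finset.range (m + 1), H (k, m - k, n) := by
      intro n _
      rw [← Finset.sum_sub_distrib]
      refine Finset.sum_congr rfl fun m _ => ?_
      rw [← TensorProduct.sub_tmul, commutator, TensorProduct.sum_tmul]
      refine Finset.sum_congr rfl fun k hk => ?_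
      have hk' : k ≤ m := by simp at hk; omega
      simp only [H, Nat.sub_add_cancel hk', TensorProduct.smul_tmul']
      rw [show m + n - k = m - k + n by omega]
    rw [Finset.sum_congr rfl e, Finset.sum_sigma', Finset.sum_sigma']
    symm
    refine Finset.sum_of_injOn (fun t => ⟨⟨t.2.2, t.1 + t.2.1⟩, t.1⟩) ?_ ?_ ?_ ?_
    · rintro ⟨n, i, j⟩ _ ⟨n', i', j'⟩ _ h
      simp at h
      simp
      omega
    · rintro ⟨n, i, j⟩ h
      simp [C] at h ⊢
      omega
    · rintro ⟨⟨j, p⟩, n⟩ h hn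
      simp at h
      refine hH _ ?_
      by_contra hlt
      refine hn ⟨(n, p - n, j), ?_, ?_⟩
      · simp [C] at hlt ⊢; omega
      · simp; omega
    · rintro ⟨n, i, j⟩ _
      simp [H]

lemma rho_preBracket_del_right (x y : 𝓛 ⊗[ℂ] A) :
    rho 𝓛 A (preBracket x (del 𝓛 A y)) = 0 := by
  rw [rho_preBracket_skew, preBracket_del_left, map_zero, neg_zero]

/-- The bracket of `Lie_A 𝓛`, as a bilinear map. -/
def bracketMap : LieOf 𝓛 A →ₗ[ℂ] LieOf 𝓛 A →ₗ[ℂ] LieOf 𝓛 A :=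
  (LinearMap.range (del 𝓛 A)).liftQ
    (((LinearMap.range (del 𝓛 A)).liftQ
      ((preBracket (𝓛 := 𝓛) (A := A)).compr₂ (rho 𝓛 A)).flip (by
        rintro _ ⟨y, rfl⟩
        exact LinearMap.ext fun x => rho_preBracket_del_right x y)).flip) (by
    rintro _ ⟨x, rfl⟩
    refine LinearMap.ext fun y => ?_
    obtain ⟨y, rfl⟩ := rho_surjective y
    exact (congrArg (rho 𝓛 A) (preBracket_del_left x y)).trans (map_zero _))

lemma bracketMap_rho (x y : 𝓛 ⊗[ℂ] A) :
    bracketMap (rho 𝓛 A x) (rho 𝓛 A y) = rho 𝓛 A (preBracket x y) := rfl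

instance : LieRing (LieOf 𝓛 A) where
  bracket x y := bracketMap x y
  add_lie x y z := by simp
  lie_add x y z := by simp
  lie_self x := by
    obtain ⟨x, rfl⟩ := rho_surjective x
    show rho 𝓛 A (preBracket x x) = 0
    have h := rho_preBracket_skew x x
    have h2 : (2 : ℂ) • rho 𝓛 A (preBracket x x) = 0 := by
      rw [two_smul]
      nth_rewrite 1 [h]
      exact neg_add_cancel _
    exact (smul_eq_zero.1 h2).resolve_left two_ne_zero
  leibniz_lie x y z := by
    obtain ⟨x, rfl⟩ := rho_surjective x
    obtain ⟨y, rfl⟩ := rho_surjective y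
    obtain ⟨z, rfl⟩ := rho_surjective z
    show rho 𝓛 A _ = rho 𝓛 A _ + rho 𝓛 A _
    rw [← map_add, ← preBracket_leibniz]

instance : LieAlgebra ℂ (LieOf 𝓛 A) where
  lie_smul c x y := by simp [Bracket.bracket]

lemma lie_rho (x y : 𝓛 ⊗[ℂ] A) : ⁅rho 𝓛 A x, rho 𝓛 A y⁆ = rho 𝓛 A (preBracket x y) := rfl

end LieOf

section Functoriality

variable {𝓛 : Type*} [AddCommGroup 𝓛] [Module ℂ 𝓛] [VertexLieAlgebra 𝓛]
variable {A : Type*} [NonUnitalCommRing A] [Module ℂ A] [DerivationAlgebra A]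
variable {B : Type*} [NonUnitalCommRing B] [Module ℂ B] [DerivationAlgebra B]

/-- The linear map `ρ (a ⊗ f) ↦ ρ (φ a ⊗ s f)`, for `φ D = c D φ` and `s δ = c δ s`. -/
def mapLinear (φ : 𝓛 →ₗ[ℂ] 𝓛) (s : A →ₗ[ℂ] B) (c : ℂ)
    (hφ : ∀ a, φ (D a) = c • D (φ a)) (hs : ∀ f, s (δ f) = c • δ (s f)) :
    LieOf 𝓛 A →ₗ[ℂ] LieOf 𝓛 B :=
  (LinearMap.range (del 𝓛 A)).liftQ (rho 𝓛 B ∘ₗ TensorProduct.map φ s) (by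
    rintro _ ⟨x, rfl⟩
    have h : ∀ x, TensorProduct.map φ s (del 𝓛 A x) =
        c • del 𝓛 B (TensorProduct.map φ s x) := by
      intro x
      induction x with
      | zero => simp
      | add x y hx hy => simp [hx, hy]
      | tmul a f => simp [del_tmul, hφ, hs, TensorProduct.smul_tmul']
    rw [LinearMap.mem_ker, LinearMap.comp_apply, h, map_smul, rho_del, smul_zero])

lemma mapLinear_rho (φ : 𝓛 →ₗ[ℂ] 𝓛) (s : A →ₗ[ℂ] B) (c : ℂ)
    (hφ : ∀ a, φ (D a) = c • D (φ a)) (hs : ∀ f, s (δ f) = c • δ (s f)) (a : 𝓛) (f : A) :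
    mapLinear φ s c hφ hs (rho 𝓛 A (a ⊗ₜ f)) = rho 𝓛 B (φ a ⊗ₜ s f) := rfl

lemma lieOf_induction {p : LieOf 𝓛 A → Prop} (x : LieOf 𝓛 A)
    (tmul : ∀ (a : 𝓛) (f : A), p (rho 𝓛 A (a ⊗ₜ f)))
    (add : ∀ x y, p x → p y → p (x + y)) : p x := by
  obtain ⟨x, rfl⟩ := rho_surjective x
  induction x with
  | zero => simpa using tmul 0 0
  | add x y hx hy => rw [map_add]; exact add _ _ hx hy
  | tmul a f => exact tmul a f

variable [IsScalarTower ℂ A A] [SMulCommClass ℂ A A]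
variable [IsScalarTower ℂ B B] [SMulCommClass ℂ B B]

lemma map_divPow (s : A →ₗ[ℂ] B) (c : ℂ) (hs : ∀ f, s (δ f) = c • δ (s f)) (n : ℕ) (f : A) :
    s (divPow n f) = c ^ n • divPow n (s f) := by
  induction n generalizing f with
  | zero => simp [divPow_zero]
  | succ n ih =>
    have h : ((n + 1 : ℕ) : ℂ) ≠ 0 := by exact_mod_cast Nat.succ_ne_zero n
    refine smul_right_injective B h ?_
    show ((n + 1 : ℕ) : ℂ) • _ = ((n + 1 : ℕ) : ℂ) • _
    rw [← map_smul, divPow_succ, ih, hs, map_smul, ← divPow_succ, smul_smul, smul_smul,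
      smul_smul]
    congr 1
    ring

lemma mapLinear_lie (φ : 𝓛 →ₗ[ℂ] 𝓛) (s : A →ₗ[ℂ] B) (c : ℂ) (hc : c ≠ 0)
    (hφ : ∀ a, φ (D a) = c • D (φ a)) (hs : ∀ f, s (δ f) = c • δ (s f))
    (hprod : ∀ n a b, φ (nprod n a b) = (c ^ n)⁻¹ • nprod n (φ a) (φ b))
    (hmul : ∀ f g, s (f * g) = s f * s g) (x y : LieOf 𝓛 A) :
    mapLinear φ s c hφ hs ⁅x, y⁆ = ⁅mapLinear φ s c hφ hs x, mapLinear φ s c hφ hs y⁆ := by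
  induction x using lieOf_induction with
  | add x x' hx hx' => simp only [add_lie, map_add, hx, hx']
  | tmul a f =>
    induction y using lieOf_induction with
    | add y y' hy hy' => simp only [lie_add, map_add, hy, hy']
    | tmul b g =>
      obtain ⟨N, h1, h2⟩ := ((exists_bound a b).and (exists_bound (φ a) (φ b))).exists
      rw [mapLinear_rho, mapLinear_rho, lie_rho, lie_rho, preBracket_tmul _ _ _ _ N h1,
        preBracket_tmul _ _ _ _ N h2, map_sum, map_sum, map_sum]
      refine Finset.sum_congr rfl fun n _ => ?_
      rw [mapLinear_rho, hprod, hmul, map_divPow s c hs, TensorProduct.smul_tmul,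
        smul_mul_assoc, smul_smul, inv_mul_cancel₀ (pow_ne_zero n hc), one_smul]

end Functoriality

/-! ## Laurent series and the local Lie algebra -/

section Laurent

open scoped LaurentSeries
open HahnSeries

lemma laurent_isPWO (f : ℂ⸨X⸩) : f.support.IsPWO := f.isPWO_support

/-- The operator `t d/dt` on Laurent series. -/
def euler (f : ℂ⸨X⸩) : ℂ⸨X⸩ :=
  ⟨fun n => (n : ℂ) * f.coeff n, f.isPWO_support.mono (fun n hn => by
    intro h; exact hn (by simp [h]))⟩

lemma euler_support (f : ℂ⸨X⸩) : (euler f).support ⊆ f.support := fun n hn h =>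
  hn (by simp [euler, h])

lemma euler_mul (f g : ℂ⸨X⸩) : euler (f * g) = euler f * g + f * euler g := by
  ext n
  rw [coeff_add, coeff_mul_left' f.isPWO_support (euler_support f),
    coeff_mul_right' g.isPWO_support (euler_support g), ← Finset.sum_add_distrib]
  show (n : ℂ) * (f * g).coeff n = _
  rw [coeff_mul, Finset.mul_sum]
  refine Finset.sum_congr rfl fun ij hij => ?_
  have h : ij.1 + ij.2 = n := by simp at hij; exact hij.2.2
  simp only [euler]
  rw [← h]
  push_cast
  ring

lemma derivative_eq (f : ℂ⸨X⸩) : LaurentSeries.derivative ℂ f = single (-1) 1 * euler f := by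
  ext n
  rw [coeff_single_mul]
  simp [euler]

/-- `ℂ((t))` with the derivation `∂_t`. -/
instance : DerivationAlgebra ℂ⸨X⸩ where
  δ := LaurentSeries.derivative ℂ
  leibniz f g := by
    rw [derivative_eq, derivative_eq, derivative_eq, euler_mul]
    ring

/-- The substitution `f (t) ↦ f (c t)` on Laurent series. -/
def scaleLaurent (c : ℂ) : ℂ⸨X⸩ →ₗ[ℂ] ℂ⸨X⸩ where
  toFun f := ⟨fun n => c ^ n * f.coeff n, f.isPWO_support.mono (fun n hn => by
    intro h; exact hn (by simp [h]))⟩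
  map_add' f g := by ext n; simp [mul_add]
  map_smul' r f := by ext n; simp; ring

lemma scaleLaurent_coeff (c : ℂ) (f : ℂ⸨X⸩) (n : ℤ) :
    (scaleLaurent c f).coeff n = c ^ n * f.coeff n := rfl

lemma scaleLaurent_mul (c : ℂ) (hc : c ≠ 0) (f g : ℂ⸨X⸩) :
    scaleLaurent c (f * g) = scaleLaurent c f * scaleLaurent c g := by
  ext n
  have hs : ∀ (f : ℂ⸨X⸩) (m : ℤ), (scaleLaurent c f).coeff m = 0 ↔ f.coeff m = 0 := fun f m => by
    rw [scaleLaurent_coeff, mul_eq_zero, or_iff_right (zpow_ne_zero m hc)]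
  rw [scaleLaurent_coeff, coeff_mul, coeff_mul, Finset.mul_sum]
  refine Finset.sum_congr (by ext ij; simp [hs]) fun ij hij => ?_
  have h : ij.1 + ij.2 = n := by simp at hij; exact hij.2.2
  rw [scaleLaurent_coeff, scaleLaurent_coeff, ← h, zpow_add₀ hc]
  ring

lemma scaleLaurent_single (c : ℂ) (n : ℤ) (r : ℂ) :
    scaleLaurent c (single n r) = single n (c ^ n * r) := by
  ext m
  rw [scaleLaurent_coeff]
  by_cases h : m = n
  · subst h; simp
  · simp [h]

lemma scaleLaurent_δ (c : ℂ) (hc : c ≠ 0) (f : ℂ⸨X⸩) :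
    scaleLaurent c (δ f) = c⁻¹ • δ (scaleLaurent c f) := by
  show scaleLaurent c (LaurentSeries.derivative ℂ f) =
    c⁻¹ • LaurentSeries.derivative ℂ (scaleLaurent c f)
  ext n
  simp only [scaleLaurent_coeff, LaurentSeries.derivative_apply, LaurentSeries.hasseDeriv_coeff,
    HahnSeries.coeff_smul]
  simp only [Nat.cast_one, Ring.choose_one_right, zsmul_eq_mul, smul_eq_mul]
  rw [zpow_add₀ hc, zpow_one]
  field_simp

end Laurent

/-! ## Rational functions -/

section Rational

open Polynomial
open scoped RatFunc LaurentSeries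

local notation "ι₀" => algebraMap ℂ[X] (RatFunc ℂ)

lemma algebraMap_ne {q : ℂ[X]} (hq : q ≠ 0) : ι₀ q ≠ 0 := by
  simpa using hq

lemma cross_mul {n d p q : ℂ[X]} (hd : d ≠ 0) (hq : q ≠ 0) (h : ι₀ n / ι₀ d = ι₀ p / ι₀ q) :
    n * q = p * d := by
  rw [div_eq_div_iff (algebraMap_ne hd) (algebraMap_ne hq), ← map_mul, ← map_mul] at h
  exact RatFunc.algebraMap_injective ℂ h

/-- The derivative of a rational function. -/
def derivRatFun (f : RatFunc ℂ) : RatFunc ℂ :=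
  (ι₀ (derivative f.num) * ι₀ f.denom - ι₀ f.num * ι₀ (derivative f.denom)) / ι₀ f.denom ^ 2

lemma quotient_rule_congr {n d p q : ℂ[X]} (hd : d ≠ 0) (hq : q ≠ 0) (e : n * q = p * d) :
    (ι₀ (derivative n) * ι₀ d - ι₀ n * ι₀ (derivative d)) / ι₀ d ^ 2 =
      (ι₀ (derivative p) * ι₀ q - ι₀ p * ι₀ (derivative q)) / ι₀ q ^ 2 := by
  have h2 := algebraMap_ne hd
  have h1 := algebraMap_ne hq
  have e' := congrArg derivative e
  simp only [derivative_mul] at e'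
  have E := congrArg ι₀ e
  have E' := congrArg ι₀ e'
  simp only [map_mul, map_add] at E E'
  rw [div_eq_div_iff (pow_ne_zero 2 h2) (pow_ne_zero 2 h1)]
  generalize ι₀ n = a at *
  generalize ι₀ d = b at *
  generalize ι₀ p = r at *
  generalize ι₀ q = s at *
  generalize ι₀ (derivative n) = a' at *
  generalize ι₀ (derivative d) = b' at *
  generalize ι₀ (derivative p) = r' at *
  generalize ι₀ (derivative q) = s' at *
  linear_combination s * b * E' - (s' * b + s * b') * E

lemma derivRatFun_div (p q : ℂ[X]) (hq : q ≠ 0) :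
    derivRatFun (ι₀ p / ι₀ q) =
      (ι₀ (derivative p) * ι₀ q - ι₀ p * ι₀ (derivative q)) / ι₀ q ^ 2 :=
  quotient_rule_congr (RatFunc.denom_ne_zero _) hq
    (cross_mul (RatFunc.denom_ne_zero _) hq (RatFunc.num_div_denom _))

lemma exists_div (f : RatFunc ℂ) : ∃ p q : ℂ[X], q ≠ 0 ∧ f = ι₀ p / ι₀ q :=
  ⟨f.num, f.denom, f.denom_ne_zero, (RatFunc.num_div_denom f).symm⟩

lemma derivRatFun_add (f g : RatFunc ℂ) :
    derivRatFun (f + g) = derivRatFun f + derivRatFun g := by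
  obtain ⟨p, q, hq, rfl⟩ := exists_div f
  obtain ⟨r, s, hs, rfl⟩ := exists_div g
  have h1 := algebraMap_ne hq
  have h2 := algebraMap_ne hs
  rw [div_add_div _ _ h1 h2]
  simp only [← map_mul, ← map_add]
  rw [derivRatFun_div _ _ (mul_ne_zero hq hs), derivRatFun_div _ _ hq, derivRatFun_div _ _ hs]
  simp only [derivative_mul, map_add, map_mul]
  field_simp
  ring

lemma derivRatFun_mul (f g : RatFunc ℂ) :
    derivRatFun (f * g) = derivRatFun f * g + f * derivRatFun g := by
  obtain ⟨p, q, hq, rfl⟩ := exists_div f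
  obtain ⟨r, s, hs, rfl⟩ := exists_div g
  have h1 := algebraMap_ne hq
  have h2 := algebraMap_ne hs
  rw [div_mul_div_comm]
  simp only [← map_mul]
  rw [derivRatFun_div _ _ (mul_ne_zero hq hs), derivRatFun_div _ _ hq, derivRatFun_div _ _ hs]
  simp only [derivative_mul, map_add, map_mul]
  field_simp
  ring

lemma derivRatFun_algebraMap (p : ℂ[X]) : derivRatFun (ι₀ p) = ι₀ (derivative p) := by
  have := derivRatFun_div p 1 one_ne_zero
  simpa using this

/-- The derivative of rational functions as a linear map. -/
def derivRat : RatFunc ℂ →ₗ[ℂ] RatFunc ℂ where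
  toFun := derivRatFun
  map_add' := derivRatFun_add
  map_smul' c f := by
    rw [RatFunc.smul_eq_C_mul, derivRatFun_mul, ← RatFunc.algebraMap_C, derivRatFun_algebraMap]
    simp [RatFunc.smul_eq_C_mul]

lemma derivRat_div (p q : ℂ[X]) (hq : q ≠ 0) :
    derivRat (ι₀ p / ι₀ q) =
      (ι₀ (derivative p) * ι₀ q - ι₀ p * ι₀ (derivative q)) / ι₀ q ^ 2 :=
  derivRatFun_div p q hq

/-- The rational functions vanishing at infinity whose poles all lie in `S`. -/
def ratVanishingCarrier (S : Set ℂ) : Set (RatFunc ℂ) :=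
  {f | (∀ x ∉ S, f.denom.eval x ≠ 0) ∧ f.num.degree < f.denom.degree}

lemma mem_ratVanishingCarrier {S : Set ℂ} {p q : ℂ[X]} (hq : q ≠ 0)
    (hS : ∀ x ∉ S, q.eval x ≠ 0) (hdeg : p.degree < q.degree) :
    ι₀ p / ι₀ q ∈ ratVanishingCarrier S := by
  have e : (ι₀ p / ι₀ q).num * q = p * (ι₀ p / ι₀ q).denom :=
    cross_mul (RatFunc.denom_ne_zero _) hq (RatFunc.num_div_denom _)
  have hd := RatFunc.denom_ne_zero (ι₀ p / ι₀ q)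
  have hdvd := RatFunc.denom_div_dvd p q
  generalize hf : ι₀ p / ι₀ q = f at *
  refine ⟨fun x hx h0 => hS x hx ?_, ?_⟩
  · obtain ⟨r, hr⟩ := hdvd
    rw [hr, eval_mul, h0, zero_mul]
  · by_contra hlt
    rw [not_lt] at hlt
    have e2 := congrArg degree e
    rw [degree_mul, degree_mul] at e2
    have h1 : p.degree + f.denom.degree < q.degree + f.denom.degree :=
      WithBot.add_lt_add_right (degree_ne_bot.2 hd) hdeg
    have h2 : f.denom.degree + q.degree ≤ f.num.degree + q.degree := by gcongr
    rw [e2, add_comm] at h2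
    exact absurd h1 (not_lt.2 h2)

lemma exists_of_mem {S : Set ℂ} {f : RatFunc ℂ} (hf : f ∈ ratVanishingCarrier S) :
    ∃ p q : ℂ[X], q ≠ 0 ∧ (∀ x ∉ S, q.eval x ≠ 0) ∧ p.degree < q.degree ∧ f = ι₀ p / ι₀ q :=
  ⟨f.num, f.denom, f.denom_ne_zero, hf.1, hf.2, (RatFunc.num_div_denom f).symm⟩

lemma degree_mul_lt {p q r s : ℂ[X]} (hq : q ≠ 0) (h1 : p.degree ≤ q.degree)
    (h2 : r.degree < s.degree) : (p * r).degree < (q * s).degree := by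
  rw [degree_mul, degree_mul]
  calc p.degree + r.degree ≤ q.degree + r.degree := by gcongr
    _ < q.degree + s.degree := WithBot.add_lt_add_left (degree_ne_bot.2 hq) h2

/-- The algebra `ℂ_S^∞ (t)` of rational functions vanishing at infinity with poles in `S`. -/
def ratVanishing (S : Set ℂ) : NonUnitalSubalgebra ℂ (RatFunc ℂ) where
  carrier := ratVanishingCarrier S
  zero_mem' := by
    have := mem_ratVanishingCarrier (S := S) (p := 0) (q := 1) one_ne_zero (by simp) (by simp)
    simpa using this
  add_mem' := by
    intro f g hf hg
    obtain ⟨p, q, hq, hqS, hpq, rfl⟩ := exists_of_mem hf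
    obtain ⟨r, s, hs, hsS, hrs, rfl⟩ := exists_of_mem hg
    rw [div_add_div _ _ (algebraMap_ne hq) (algebraMap_ne hs)]
    simp only [← map_mul, ← map_add]
    refine mem_ratVanishingCarrier (mul_ne_zero hq hs) (fun x hx => ?_) ?_
    · rw [eval_mul]; exact mul_ne_zero (hqS x hx) (hsS x hx)
    · refine (degree_add_le _ _).trans_lt (max_lt ?_ (degree_mul_lt hq le_rfl hrs))
      rw [mul_comm, mul_comm q]
      exact degree_mul_lt hs le_rfl hpq
  mul_mem' := by
    intro f g hf hg
    obtain ⟨p, q, hq, hqS, hpq, rfl⟩ := exists_of_mem hf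
    obtain ⟨r, s, hs, hsS, hrs, rfl⟩ := exists_of_mem hg
    rw [div_mul_div_comm]
    simp only [← map_mul]
    refine mem_ratVanishingCarrier (mul_ne_zero hq hs) (fun x hx => ?_)
      (degree_mul_lt hq hpq.le hrs)
    rw [eval_mul]; exact mul_ne_zero (hqS x hx) (hsS x hx)
  smul_mem' := by
    intro c f hf
    obtain ⟨p, q, hq, hqS, hpq, rfl⟩ := exists_of_mem hf
    rw [RatFunc.smul_eq_C_mul, ← RatFunc.algebraMap_C, ← mul_div_assoc, ← map_mul]
    refine mem_ratVanishingCarrier hq hqS (lt_of_le_of_lt ?_ hpq)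
    rw [← smul_eq_C_mul]
    exact degree_smul_le c p

lemma derivRat_mem {S : Set ℂ} {f : RatFunc ℂ} (hf : f ∈ ratVanishing S) :
    derivRat f ∈ ratVanishing S := by
  obtain ⟨p, q, hq, hqS, hpq, rfl⟩ := exists_of_mem hf
  rw [derivRat_div _ _ hq]
  simp only [← map_mul, ← map_sub, ← map_pow]
  refine mem_ratVanishingCarrier (pow_ne_zero 2 hq) (fun x hx => ?_) ?_
  · rw [eval_pow]; exact pow_ne_zero 2 (hqS x hx)
  · rw [pow_two]
    refine (degree_sub_le _ _).trans_lt (max_lt ?_ ?_)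
    · rw [mul_comm]
      exact degree_mul_lt hq le_rfl (degree_derivative_le.trans_lt hpq)
    · rw [mul_comm]
      exact degree_mul_lt hq degree_derivative_le hpq

instance (S : Set ℂ) : DerivationAlgebra (ratVanishing S) where
  δ := (derivRat.comp (ratVanishing S).toSubmodule.subtype).codRestrict
    (ratVanishing S).toSubmodule (fun f => derivRat_mem f.2)
  leibniz f g := Subtype.ext (derivRatFun_mul f.1 g.1)

lemma coe_δ {S : Set ℂ} (f : ratVanishing S) : ((δ f : ratVanishing S) : RatFunc ℂ) =
    derivRat f := rfl

/-- The rational function `1 / (t - x)`, for `x ∈ S`. -/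
def simplePole {S : Set ℂ} (x : ℂ) (hx : x ∈ S) : ratVanishing S :=
  ⟨1 / (RatFunc.X - RatFunc.C x), by
    have := mem_ratVanishingCarrier (S := S) (p := 1) (q := Polynomial.X - C x)
      (X_sub_C_ne_zero x) (fun y hy h => hy (by
        have : y = x := by simpa [sub_eq_zero] using h
        rwa [this])) (by rw [degree_X_sub_C, degree_one]; exact zero_lt_one)
    rwa [map_one, map_sub, RatFunc.algebraMap_X, RatFunc.algebraMap_C] at this⟩

lemma scale_comap (c : ℂ) (hc : c ≠ 0) :
    nonZeroDivisors ℂ[X] ≤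
      (nonZeroDivisors ℂ[X]).comap (aeval (C c * Polynomial.X) : ℂ[X] →ₐ[ℂ] ℂ[X]) := by
  intro p hp
  rw [Submonoid.mem_comap, mem_nonZeroDivisors_iff_ne_zero]
  rw [mem_nonZeroDivisors_iff_ne_zero] at hp
  rw [← comp_eq_aeval]
  intro h
  have h2 := congrArg (fun r : ℂ[X] => r.comp (C c⁻¹ * Polynomial.X)) h
  simp only [comp_assoc, zero_comp] at h2
  apply hp
  have h3 : (C c * Polynomial.X).comp (C c⁻¹ * Polynomial.X) = (Polynomial.X : ℂ[X]) := by
    rw [mul_comp, C_comp, X_comp, ← mul_assoc, ← C_mul, mul_inv_cancel₀ hc, C_1, one_mul]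
  rwa [h3, comp_X] at h2

/-- The substitution `f (t) ↦ f (c t)` on rational functions. -/
def scaleRat (c : ℂ) (hc : c ≠ 0) : RatFunc ℂ →ₐ[ℂ] RatFunc ℂ :=
  RatFunc.mapAlgHom (aeval (C c * Polynomial.X)) (scale_comap c hc)

lemma scaleRat_div (c : ℂ) (hc : c ≠ 0) (p q : ℂ[X]) :
    scaleRat c hc (ι₀ p / ι₀ q) =
      ι₀ (p.comp (C c * Polynomial.X)) / ι₀ (q.comp (C c * Polynomial.X)) := by
  rw [comp_eq_aeval, comp_eq_aeval]
  exact RatFunc.map_apply_div _ (scale_comap c hc) p q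

lemma scaleRat_smul (c : ℂ) (hc : c ≠ 0) (r : ℂ) (f : RatFunc ℂ) :
    scaleRat c hc (r • f) = r • scaleRat c hc f := by
  have h : scaleRat c hc (RatFunc.C r) = RatFunc.C r := by
    have := scaleRat_div c hc (C r) 1
    rwa [C_comp, one_comp, map_one, div_one, RatFunc.algebraMap_C] at this
  rw [RatFunc.smul_eq_C_mul, RatFunc.smul_eq_C_mul, map_mul, h]

lemma scaleRat_mem {S : Set ℂ} (c : ℂ) (hc : c ≠ 0) (hS : ∀ x, c * x ∈ S → x ∈ S)
    {f : RatFunc ℂ} (hf : f ∈ ratVanishing S) : scaleRat c hc f ∈ ratVanishing S := by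
  obtain ⟨p, q, hq, hqS, hpq, rfl⟩ := exists_of_mem hf
  have hX : (C c * Polynomial.X : ℂ[X]).natDegree = 1 := by
    rw [natDegree_C_mul hc, natDegree_X]
  have hd : ∀ p : ℂ[X], p ≠ 0 → p.comp (C c * Polynomial.X) ≠ 0 := fun p hp h => by
    have := scale_comap c hc (mem_nonZeroDivisors_iff_ne_zero.2 hp)
    rw [Submonoid.mem_comap, ← comp_eq_aeval, h] at this
    exact absurd rfl (mem_nonZeroDivisors_iff_ne_zero.1 this)
  rw [scaleRat_div]
  refine mem_ratVanishingCarrier (hd q hq) (fun x hx => ?_) ?_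
  · rw [eval_comp, eval_mul, eval_C, eval_X]
    exact hqS _ fun h => hx (hS x h)
  · by_cases hp : p = 0
    · subst hp
      rw [zero_comp, degree_zero]
      exact bot_lt_iff_ne_bot.2 (degree_ne_bot.2 (hd q hq))
    · rw [degree_eq_natDegree (hd p hp), degree_eq_natDegree (hd q hq), natDegree_comp,
        natDegree_comp, hX, mul_one, mul_one, ← degree_eq_natDegree hp, ← degree_eq_natDegree hq]
      exact hpq

lemma scaleRat_derivRat (c : ℂ) (hc : c ≠ 0) (f : RatFunc ℂ) :
    scaleRat c hc (derivRat f) = c⁻¹ • derivRat (scaleRat c hc f) := by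
  obtain ⟨p, q, hq, rfl⟩ := exists_div f
  have hd : q.comp (C c * Polynomial.X) ≠ 0 := fun h => by
    have := scale_comap c hc (mem_nonZeroDivisors_iff_ne_zero.2 hq)
    rw [Submonoid.mem_comap, ← comp_eq_aeval, h] at this
    exact absurd rfl (mem_nonZeroDivisors_iff_ne_zero.1 this)
  have hcc : RatFunc.C c ≠ 0 := by simpa using hc
  have hqq := algebraMap_ne hd
  rw [scaleRat_div, derivRat_div _ _ hd, derivRat_div _ _ hq]
  simp only [← map_mul, ← map_sub, ← map_pow]
  rw [scaleRat_div]
  simp only [derivative_comp, derivative_mul, derivative_C, derivative_X, mul_one, zero_mul,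
    zero_add, sub_comp, mul_comp, pow_comp, map_mul, map_sub, map_pow, RatFunc.algebraMap_C]
  rw [RatFunc.smul_eq_C_mul, map_inv₀]
  field_simp

/-- The Laurent expansion `ι_{t - z}` of a rational function at `z`, as a Laurent series in the
local coordinate `t - z`. -/
def laurentExp (z : ℂ) : RatFunc ℂ →+* ℂ⸨X⸩ :=
  (algebraMap (RatFunc ℂ) ℂ⸨X⸩).comp
    (RatFunc.laurent z : RatFunc ℂ →ₐ[ℂ] RatFunc ℂ).toRingHom

lemma laurentExp_C (z a : ℂ) : laurentExp z (RatFunc.C a) = HahnSeries.C a := by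
  show algebraMap (RatFunc ℂ) ℂ⸨X⸩ (RatFunc.laurent z (RatFunc.C a)) = _
  rw [RatFunc.laurent_C]
  simp [← RatFunc.algebraMap_C, ← IsScalarTower.algebraMap_apply ℂ[X] (RatFunc ℂ) ℂ⸨X⸩]

lemma laurentExp_X (z : ℂ) :
    laurentExp z RatFunc.X = HahnSeries.single 1 1 + HahnSeries.C z := by
  show algebraMap (RatFunc ℂ) ℂ⸨X⸩ (RatFunc.laurent z RatFunc.X) = _
  rw [RatFunc.laurent_X, map_add, RatFunc.coe_X]
  congr 1
  have := laurentExp_C 0 z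
  rw [← this]
  show _ = algebraMap (RatFunc ℂ) ℂ⸨X⸩ (RatFunc.laurent 0 (RatFunc.C z))
  rw [RatFunc.laurent_C]

lemma laurentExp_smul (z c : ℂ) (f : RatFunc ℂ) :
    laurentExp z (c • f) = c • laurentExp z f := by
  rw [RatFunc.smul_eq_C_mul, map_mul, laurentExp_C, HahnSeries.C_mul_eq_smul]

lemma δ_C (a : ℂ) : δ (HahnSeries.C a : ℂ⸨X⸩) = 0 := by
  show LaurentSeries.derivative ℂ (HahnSeries.C a : ℂ⸨X⸩) = 0
  simp [HahnSeries.C_apply]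

lemma δ_single_one : δ (HahnSeries.single 1 1 : ℂ⸨X⸩) = 1 := by
  show LaurentSeries.derivative ℂ (HahnSeries.single 1 1 : ℂ⸨X⸩) = 1
  simp

lemma laurentExp_poly (z : ℂ) (p : ℂ[X]) :
    δ (laurentExp z (ι₀ p)) = laurentExp z (ι₀ (derivative p)) := by
  induction p using Polynomial.induction_on with
  | C a => rw [RatFunc.algebraMap_C, laurentExp_C, δ_C, derivative_C, map_zero, map_zero]
  | add p q hp hq => simp only [map_add, hp, hq]
  | monomial n a ih =>
    rw [pow_succ, ← mul_assoc]
    generalize C a * Polynomial.X ^ n = p at *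
    rw [map_mul, map_mul, leibniz, ih, RatFunc.algebraMap_X, laurentExp_X,
      map_add, δ_single_one, δ_C, derivative_mul, map_add, map_add, derivative_X, mul_one, add_zero,
      mul_one, map_mul, map_mul, RatFunc.algebraMap_X, laurentExp_X]

lemma laurentExp_derivRat (z : ℂ) (f : RatFunc ℂ) :
    laurentExp z (derivRat f) = δ (laurentExp z f) := by
  obtain ⟨p, q, hq, rfl⟩ := exists_div f
  have h0 : laurentExp z (ι₀ q) ≠ 0 := by
    rw [Ne, map_eq_zero]
    exact algebraMap_ne hq
  have e : laurentExp z (ι₀ p / ι₀ q) * laurentExp z (ι₀ q) = laurentExp z (ι₀ p) := by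
    rw [← map_mul, div_mul_cancel₀ _ (algebraMap_ne hq)]
  have e' := congrArg δ e
  rw [leibniz, laurentExp_poly, laurentExp_poly] at e'
  rw [derivRat_div _ _ hq, map_div₀, map_pow, map_sub, map_mul, map_mul,
    div_eq_iff (pow_ne_zero 2 h0)]
  linear_combination -(laurentExp z (ι₀ q)) * e' + laurentExp z (ι₀ (derivative q)) * e

lemma laurentExp_scaleRat (c : ℂ) (hc : c ≠ 0) (f : RatFunc ℂ) :
    laurentExp 0 (scaleRat c hc f) = scaleLaurent c (laurentExp 0 f) := by
  have hpoly : ∀ p : ℂ[X], laurentExp 0 (ι₀ (p.comp (C c * Polynomial.X))) =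
      scaleLaurent c (laurentExp 0 (ι₀ p)) := by
    intro p
    induction p using Polynomial.induction_on with
    | C a =>
      rw [C_comp, RatFunc.algebraMap_C, laurentExp_C, HahnSeries.C_apply, scaleLaurent_single]
      simp
    | add p q hp hq => simp only [add_comp, map_add, hp, hq]
    | monomial n a ih =>
      rw [pow_succ, ← mul_assoc]
      generalize C a * Polynomial.X ^ n = p at *
      rw [mul_comp, map_mul, map_mul, ih, map_mul, map_mul, scaleLaurent_mul c hc, X_comp,
        map_mul, map_mul, RatFunc.algebraMap_C, RatFunc.algebraMap_X, laurentExp_C, laurentExp_X,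
        map_zero, add_zero, scaleLaurent_single]
      congr 1
      rw [HahnSeries.C_apply, HahnSeries.single_mul_single]
      simp
  obtain ⟨p, q, hq, rfl⟩ := exists_div f
  have h0 : laurentExp 0 (ι₀ q) ≠ 0 := by
    rw [Ne, map_eq_zero]
    exact algebraMap_ne hq
  have hd : q.comp (C c * Polynomial.X) ≠ 0 := fun h => by
    have := scale_comap c hc (mem_nonZeroDivisors_iff_ne_zero.2 hq)
    rw [Submonoid.mem_comap, ← comp_eq_aeval, h] at this
    exact absurd rfl (mem_nonZeroDivisors_iff_ne_zero.1 this)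
  have h1 : laurentExp 0 (ι₀ (q.comp (C c * Polynomial.X))) ≠ 0 := by
    rw [Ne, map_eq_zero]
    exact algebraMap_ne hd
  rw [scaleRat_div, map_div₀, div_eq_iff h1, hpoly, hpoly, ← scaleLaurent_mul c hc, ← map_mul,
    div_mul_cancel₀ _ (algebraMap_ne hq)]

end Rational

/-! ## The action of the cyclic group -/

section Gamma

variable (𝓛 : Type*) [AddCommGroup 𝓛] [Module ℂ 𝓛] [VertexLieAlgebra 𝓛]

/-- The operator `α ^ L(0)`, acting on `gr n` as multiplication by `α ^ n`. -/
def degPow (α : ℂ) : 𝓛 →ₗ[ℂ] 𝓛 :=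
  (DirectSum.toModule ℂ ℕ 𝓛 fun n => α ^ n • (gr (𝓛 := 𝓛) n).subtype) ∘ₗ
    (LinearEquiv.ofBijective (DirectSum.coeLinearMap (gr (𝓛 := 𝓛)))
      gr_internal).symm.toLinearMap

variable {𝓛}

lemma degPow_of_mem (α : ℂ) (n : ℕ) (a : 𝓛) (ha : a ∈ gr n) : degPow 𝓛 α a = α ^ n • a := by
  have h : (LinearEquiv.ofBijective (DirectSum.coeLinearMap (gr (𝓛 := 𝓛)))
      gr_internal).symm a = DirectSum.lof ℂ ℕ (fun n => gr (𝓛 := 𝓛) n) n ⟨a, ha⟩ := by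
    rw [LinearEquiv.symm_apply_eq]
    exact (DirectSum.coeLinearMap_lof (gr (𝓛 := 𝓛)) n ⟨a, ha⟩).symm
  rw [degPow, LinearMap.comp_apply, LinearEquiv.coe_coe, h, DirectSum.toModule_lof]
  rfl

lemma gr_induction {p : 𝓛 → Prop} (a : 𝓛) (mem : ∀ n, ∀ a ∈ gr (𝓛 := 𝓛) n, p a)
    (add : ∀ a b, p a → p b → p (a + b)) : p a := by
  have h : a ∈ ⨆ n, gr (𝓛 := 𝓛) n := by
    rw [gr_internal.submodule_iSup_eq_top]; trivial
  exact Submodule.iSup_induction _ (motive := p) h mem (mem 0 0 (Submodule.zero_mem _)) add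

lemma degPow_D (α : ℂ) (a : 𝓛) : degPow 𝓛 α (D a) = α • D (degPow 𝓛 α a) := by
  induction a using gr_induction with
  | mem n a ha =>
    rw [degPow_of_mem α n a ha, degPow_of_mem α (n + 1) _ (D_mem n a ha), map_smul, smul_smul,
      pow_succ']
  | add a b ha hb => simp only [map_add, ha, hb, smul_add]

lemma degPow_cent (α : ℂ) : degPow 𝓛 α cent = cent := by
  rw [degPow_of_mem α 0 _ cent_mem, pow_zero, one_smul]

lemma degPow_nprod (α : ℂ) (n : ℕ) (a b : 𝓛) :
    α ^ (n + 1) • degPow 𝓛 α (nprod n a b) = nprod n (degPow 𝓛 α a) (degPow 𝓛 α b) := by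
  induction a using gr_induction with
  | add a a' ha hb => simp only [map_add, LinearMap.add_apply, smul_add, ha, hb]
  | mem p a ha =>
    induction b using gr_induction with
    | add b b' hb hb' => simp only [map_add, smul_add, hb, hb']
    | mem q b hb =>
      rw [degPow_of_mem α p a ha, degPow_of_mem α q b hb]
      simp only [map_smul, LinearMap.smul_apply, smul_smul]
      by_cases h : p + q < n + 1
      · rw [nprod_eq_zero p q n a b ha hb h]; simp
      · rw [degPow_of_mem α (p + q - (n + 1)) _
          (nprod_mem p q n _ a b ha hb (by omega)), smul_smul, ← pow_add, ← pow_add]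
        congr 2
        omega

/-- Automorphisms of a graded vertex Lie algebra: invertible linear maps commuting with `D` and
with all products, of degree zero, and fixing the central vector. -/
structure IsAut (σ : 𝓛 ≃ₗ[ℂ] 𝓛) : Prop where
  map_D : ∀ a, σ (D a) = D (σ a)
  map_nprod : ∀ n a b, σ (nprod n a b) = nprod n (σ a) (σ b)
  map_gr : ∀ n, ∀ a ∈ gr (𝓛 := 𝓛) n, σ a ∈ gr (𝓛 := 𝓛) n
  map_cent : σ cent = cent

lemma IsAut.pow {σ : 𝓛 ≃ₗ[ℂ] 𝓛} (h : IsAut σ) (k : ℕ) : IsAut (σ ^ k) := by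
  induction k with
  | zero => exact ⟨fun _ => rfl, fun _ _ _ => rfl, fun _ _ ha => ha, rfl⟩
  | succ k ih =>
    refine ⟨fun a => ?_, fun n a b => ?_, fun n a ha => ?_, ?_⟩ <;>
      rw [pow_succ'] <;> simp only [LinearEquiv.mul_apply]
    · rw [ih.map_D, h.map_D]
    · rw [ih.map_nprod, h.map_nprod]
    · exact h.map_gr n _ (ih.map_gr n a ha)
    · rw [ih.map_cent, h.map_cent]

end Gamma

end VertexLieAlgebra

open VertexLieAlgebra DerivationAlgebra
open scoped LaurentSeries

/-- The data defining a `Γ`-action: a primitive `T`-th root of unity `ω`, generating the group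
`Γ = {ω ^ k}` of `T`-th roots of unity in `ℂ`, and an automorphism `σ` of `𝓛` with `σ ^ T = 1`,
through which `ω` acts. -/
structure CyclotomicDatum (𝓛 : Type*) [AddCommGroup 𝓛] [Module ℂ 𝓛] [VertexLieAlgebra 𝓛]
    (T : ℕ) where
  T_pos : 0 < T
  /-- the generator of `Γ` -/
  ω : ℂ
  primitive : IsPrimitiveRoot ω T
  /-- the automorphism by which `ω` acts -/
  σ : 𝓛 ≃ₗ[ℂ] 𝓛
  isAut : IsAut σ
  pow_eq_one : σ ^ T = 1

/-- A set of possible poles, stable under multiplication by `Γ`. -/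
structure GammaSet {𝓛 : Type*} [AddCommGroup 𝓛] [Module ℂ 𝓛] [VertexLieAlgebra 𝓛] {T : ℕ}
    (G : CyclotomicDatum 𝓛 T) where
  /-- the underlying set -/
  carrier : Set ℂ
  smul_mem : ∀ (k : ℕ), ∀ x ∈ carrier, G.ω ^ k * x ∈ carrier

namespace CyclotomicDatum

variable {𝓛 : Type*} [AddCommGroup 𝓛] [Module ℂ 𝓛] [VertexLieAlgebra 𝓛] {T : ℕ}
variable (G : CyclotomicDatum 𝓛 T)

lemma ω_pow_ne_zero (k : ℕ) : G.ω ^ k ≠ 0 :=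
  pow_ne_zero k (G.primitive.ne_zero G.T_pos.ne')

/-- `R_α = α ^ L(0) σ ^ k` for `α = ω ^ k`. -/
def R (k : ℕ) : 𝓛 →ₗ[ℂ] 𝓛 := degPow 𝓛 (G.ω ^ k) ∘ₗ ((G.σ ^ k : 𝓛 ≃ₗ[ℂ] 𝓛) : 𝓛 →ₗ[ℂ] 𝓛)

/-- `α⁻¹ R_α` for `α = ω ^ k`. -/
def twist (k : ℕ) : 𝓛 →ₗ[ℂ] 𝓛 := (G.ω ^ k)⁻¹ • G.R k

lemma twist_D (k : ℕ) (a : 𝓛) : G.twist k (D a) = G.ω ^ k • D (G.twist k a) := by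
  simp only [twist, R, LinearMap.smul_apply, LinearMap.comp_apply, LinearEquiv.coe_coe,
    (G.isAut.pow k).map_D, degPow_D, map_smul]
  rw [smul_comm]

lemma twist_nprod (k n : ℕ) (a b : 𝓛) : G.twist k (nprod n a b) =
    ((G.ω ^ k) ^ n)⁻¹ • nprod n (G.twist k a) (G.twist k b) := by
  have h := G.ω_pow_ne_zero k
  simp only [twist, R, LinearMap.smul_apply, LinearMap.comp_apply, LinearEquiv.coe_coe,
    (G.isAut.pow k).map_nprod, map_smul, ← degPow_nprod, smul_smul]
  congr 1
  rw [pow_succ (G.ω ^ k)]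
  field_simp

lemma twist_cent (k : ℕ) : G.twist k cent = (G.ω ^ k)⁻¹ • cent := by
  simp only [twist, R, LinearMap.smul_apply, LinearMap.comp_apply, LinearEquiv.coe_coe,
    (G.isAut.pow k).map_cent, degPow_cent]

end CyclotomicDatum

/-! ## Local Lie algebras and their modules -/

section Local

variable (𝓛 : Type*) [AddCommGroup 𝓛] [Module ℂ 𝓛] [VertexLieAlgebra 𝓛]

instance : IsScalarTower ℂ ℂ⸨X⸩ ℂ⸨X⸩ :=
  ⟨fun c f g => by
    show (c • f) * g = c • (f * g)
    rw [← HahnSeries.C_mul_eq_smul, ← HahnSeries.C_mul_eq_smul, mul_assoc]⟩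

instance : SMulCommClass ℂ ℂ⸨X⸩ ℂ⸨X⸩ :=
  ⟨fun c f g => by
    show c • (f * g) = f * (c • g)
    rw [← HahnSeries.C_mul_eq_smul, ← HahnSeries.C_mul_eq_smul, mul_left_comm]⟩

/-- The Lie algebra `L(𝓛) = Lie_{ℂ((t))} 𝓛`. The local Lie algebra at `z` is identified with it
through the local coordinate `t - z`. -/
abbrev LocalLie : Type _ := LieOf 𝓛 ℂ⸨X⸩

/-- The central element `cent(-1)`, the class of `cent ⊗ t⁻¹`. -/
def centMode : LocalLie 𝓛 := rho 𝓛 ℂ⸨X⸩ (cent ⊗ₜ HahnSeries.single (-1) 1)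

/-- The left ideal of `U (L(𝓛))` generated by `x - χ x`, for `x ∈ L⁺(𝓛)`, where `χ` is the
character of `L⁺(𝓛)` that gives the module `ℂ|0⟩`: it vanishes on the classes of `𝓛 ⊗ ℂ[[t]]` and
is `1` on `cent(-1)`. -/
def vacuumIdeal : Submodule (UniversalEnvelopingAlgebra ℂ (LocalLie 𝓛))
    (UniversalEnvelopingAlgebra ℂ (LocalLie 𝓛)) :=
  Submodule.span _
    ({y | ∃ (a : 𝓛) (f : PowerSeries ℂ), y = UniversalEnvelopingAlgebra.ι ℂ
        (rho 𝓛 ℂ⸨X⸩ (a ⊗ₜ HahnSeries.ofPowerSeries ℤ ℂ f))} ∪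
      {UniversalEnvelopingAlgebra.ι ℂ (centMode 𝓛) - 1})

/-- The vacuum Verma module, the `L(𝓛)`-module `U (L(𝓛)) ⊗_{U (L⁺(𝓛))} ℂ|0⟩` induced from the
one-dimensional `L⁺(𝓛)`-module `ℂ|0⟩`, realized as the quotient of `U (L(𝓛))` by the left ideal
generated by the elements `x - χ x`. -/
def VacuumModule : Type _ :=
  UniversalEnvelopingAlgebra ℂ (LocalLie 𝓛) ⧸ vacuumIdeal 𝓛

instance : AddCommGroup (VacuumModule 𝓛) :=
  inferInstanceAs (AddCommGroup (UniversalEnvelopingAlgebra ℂ (LocalLie 𝓛) ⧸ vacuumIdeal 𝓛))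

instance : Module (UniversalEnvelopingAlgebra ℂ (LocalLie 𝓛)) (VacuumModule 𝓛) :=
  inferInstanceAs (Module (UniversalEnvelopingAlgebra ℂ (LocalLie 𝓛))
    (UniversalEnvelopingAlgebra ℂ (LocalLie 𝓛) ⧸ vacuumIdeal 𝓛))

instance : Module ℂ (VacuumModule 𝓛) :=
  inferInstanceAs (Module ℂ (UniversalEnvelopingAlgebra ℂ (LocalLie 𝓛) ⧸ vacuumIdeal 𝓛))

instance : IsScalarTower ℂ (UniversalEnvelopingAlgebra ℂ (LocalLie 𝓛)) (VacuumModule 𝓛) :=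
  inferInstanceAs (IsScalarTower ℂ (UniversalEnvelopingAlgebra ℂ (LocalLie 𝓛))
    (UniversalEnvelopingAlgebra ℂ (LocalLie 𝓛) ⧸ vacuumIdeal 𝓛))

instance : LieRingModule (LocalLie 𝓛) (VacuumModule 𝓛) where
  bracket x v := UniversalEnvelopingAlgebra.ι ℂ x • v
  add_lie x y v := by
    show UniversalEnvelopingAlgebra.ι ℂ (x + y) • v = _
    rw [map_add, add_smul]
  lie_add x v w := smul_add _ v w
  leibniz_lie x y v := by
    show UniversalEnvelopingAlgebra.ι ℂ x • UniversalEnvelopingAlgebra.ι ℂ y • v =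
      UniversalEnvelopingAlgebra.ι ℂ ⁅x, y⁆ • v +
        UniversalEnvelopingAlgebra.ι ℂ y • UniversalEnvelopingAlgebra.ι ℂ x • v
    have h : UniversalEnvelopingAlgebra.ι ℂ ⁅x, y⁆ =
        UniversalEnvelopingAlgebra.ι ℂ x * UniversalEnvelopingAlgebra.ι ℂ y -
          UniversalEnvelopingAlgebra.ι ℂ y * UniversalEnvelopingAlgebra.ι ℂ x := by
      let _ := LieRing.ofAssociativeRing (A := UniversalEnvelopingAlgebra ℂ (LocalLie 𝓛))
      exact LieHom.map_lie (UniversalEnvelopingAlgebra.ι ℂ) x y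
    rw [h, sub_smul, mul_smul, mul_smul, sub_add_cancel]

instance : LieModule ℂ (LocalLie 𝓛) (VacuumModule 𝓛) where
  smul_lie c x v := by
    show UniversalEnvelopingAlgebra.ι ℂ (c • x) • v = c • UniversalEnvelopingAlgebra.ι ℂ x • v
    rw [map_smul, smul_assoc]
  lie_smul c x v := by
    show UniversalEnvelopingAlgebra.ι ℂ x • c • v = c • UniversalEnvelopingAlgebra.ι ℂ x • v
    rw [← algebraMap_smul (UniversalEnvelopingAlgebra ℂ (LocalLie 𝓛)) c v, smul_smul,
      ← Algebra.commutes, ← smul_smul, algebraMap_smul]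

/-- The vacuum vector `|0⟩`. -/
def vacuum : VacuumModule 𝓛 :=
  (vacuumIdeal 𝓛).mkQ (1 : UniversalEnvelopingAlgebra ℂ (LocalLie 𝓛))

end Local

namespace CyclotomicDatum

variable {𝓛 : Type*} [AddCommGroup 𝓛] [Module ℂ 𝓛] [VertexLieAlgebra 𝓛] {T : ℕ}
variable (G : CyclotomicDatum 𝓛 T)

/-- The action of `α = ω ^ k ∈ Γ` on `L(𝓛)`: `a ⊗ f(t) ↦ α⁻¹ R_α a ⊗ f(α⁻¹ t)`. -/
def localAct (k : ℕ) : LocalLie 𝓛 →ₗ[ℂ] LocalLie 𝓛 :=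
  mapLinear (G.twist k) (scaleLaurent (G.ω ^ k)⁻¹) (G.ω ^ k) (G.twist_D k)
    (fun f => by rw [scaleLaurent_δ _ (inv_ne_zero (G.ω_pow_ne_zero k)), inv_inv])

lemma localAct_lie (k : ℕ) (x y : LocalLie 𝓛) :
    G.localAct k ⁅x, y⁆ = ⁅G.localAct k x, G.localAct k y⁆ :=
  mapLinear_lie _ _ _ (G.ω_pow_ne_zero k) _ _ (G.twist_nprod k)
    (scaleLaurent_mul _ (inv_ne_zero (G.ω_pow_ne_zero k))) x y

/-- The subalgebra `L(𝓛)^Γ` of `Γ`-invariants, the local Lie algebra at the origin. -/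
def localInvariants : LieSubalgebra ℂ (LocalLie 𝓛) where
  carrier := {x | ∀ k, G.localAct k x = x}
  add_mem' hx hy k := by rw [map_add, hx k, hy k]
  zero_mem' k := map_zero _
  smul_mem' c x hx k := by rw [map_smul, hx k]
  lie_mem' hx hy k := by rw [localAct_lie, hx k, hy k]

lemma centMode_mem : centMode 𝓛 ∈ G.localInvariants := by
  intro k
  have h := G.ω_pow_ne_zero k
  rw [localAct, centMode, mapLinear_rho, twist_cent, scaleLaurent_single,
    TensorProduct.smul_tmul]
  congr 2
  ext n
  by_cases hn : n = -1
  · subst hn; simp [h]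
  · simp [hn]

/-! ## Cyclotomic global Lie algebras -/

variable {G} (S : GammaSet G)

/-- The Lie algebra `Lie_A 𝓛` for the algebra `A` of rational functions vanishing at infinity with
poles in `S`. -/
abbrev _root_.GammaSet.GlobalLie : Type _ := LieOf 𝓛 (ratVanishing S.carrier)

/-- The substitution `f(t) ↦ f(α⁻¹ t)`, for `α = ω ^ k`, on rational functions with poles
in `S`. -/
def _root_.GammaSet.scale (k : ℕ) : ratVanishing S.carrier →ₗ[ℂ] ratVanishing S.carrier where
  toFun f := ⟨scaleRat (G.ω ^ k)⁻¹ (inv_ne_zero (G.ω_pow_ne_zero k)) f.1,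
    scaleRat_mem _ _ (fun x hx => by
      have := S.smul_mem k _ hx
      rwa [mul_inv_cancel_left₀ (G.ω_pow_ne_zero k)] at this) f.2⟩
  map_add' f g := Subtype.ext (map_add (scaleRat _ _) f.1 g.1)
  map_smul' c f := Subtype.ext (scaleRat_smul _ _ c f.1)

lemma _root_.GammaSet.scale_δ (k : ℕ) (f : ratVanishing S.carrier) :
    S.scale k (δ f) = G.ω ^ k • δ (S.scale k f) := by
  apply Subtype.ext
  have h := scaleRat_derivRat (G.ω ^ k)⁻¹ (inv_ne_zero (G.ω_pow_ne_zero k)) f.1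
  rw [inv_inv] at h
  exact h

/-- The action of `α = ω ^ k ∈ Γ`: `a ⊗ f(t) ↦ α⁻¹ R_α a ⊗ f(α⁻¹ t)`. -/
def _root_.GammaSet.act (k : ℕ) : S.GlobalLie →ₗ[ℂ] S.GlobalLie :=
  mapLinear (G.twist k) (S.scale k) (G.ω ^ k) (G.twist_D k) (S.scale_δ k)

/-- The `Γ`-invariant elements of `Lie_A 𝓛`. -/
def _root_.GammaSet.fixed : Submodule ℂ S.GlobalLie where
  carrier := {x | ∀ k, S.act k x = x}
  add_mem' hx hy k := by rw [map_add, hx k, hy k]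
  zero_mem' k := map_zero _
  smul_mem' c x hx k := by rw [map_smul, hx k]

/-- Laurent expansion at `z` of rational functions with poles in `S`. -/
def _root_.GammaSet.laurent (z : ℂ) : ratVanishing S.carrier →ₗ[ℂ] ℂ⸨X⸩ where
  toFun f := laurentExp z f.1
  map_add' f g := map_add (laurentExp z) f.1 g.1
  map_smul' c f := laurentExp_smul z c f.1

lemma _root_.GammaSet.laurent_δ (z : ℂ) (f : ratVanishing S.carrier) :
    S.laurent z (δ f) = (1 : ℂ) • δ (S.laurent z f) := by
  rw [one_smul]
  exact laurentExp_derivRat z f.1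

/-- Laurent expansion at `z`, from the global to the local Lie algebra. -/
def _root_.GammaSet.expand (z : ℂ) : S.GlobalLie →ₗ[ℂ] LocalLie 𝓛 :=
  mapLinear LinearMap.id (S.laurent z) 1 (fun _ => (one_smul ℂ _).symm) (S.laurent_δ z)

lemma _root_.GammaSet.expand_lie (z : ℂ) (x y : S.GlobalLie) :
    S.expand z ⁅x, y⁆ = ⁅S.expand z x, S.expand z y⁆ :=
  mapLinear_lie (LinearMap.id : 𝓛 →ₗ[ℂ] 𝓛) (S.laurent z) 1 one_ne_zero _ _
    (fun n a b => by simp) (fun f g => map_mul (laurentExp z) f.1 g.1) x y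

lemma _root_.GammaSet.laurent_scale (k : ℕ) (f : ratVanishing S.carrier) :
    S.laurent 0 (S.scale k f) = scaleLaurent (G.ω ^ k)⁻¹ (S.laurent 0 f) :=
  laurentExp_scaleRat _ _ f.1

lemma _root_.GammaSet.expand_zero_act (k : ℕ) (x : S.GlobalLie) :
    S.expand 0 (S.act k x) = G.localAct k (S.expand 0 x) := by
  induction x using lieOf_induction with
  | add x y hx hy => simp only [map_add, hx, hy]
  | tmul a f =>
    rw [GammaSet.act, GammaSet.expand, localAct, mapLinear_rho, mapLinear_rho, mapLinear_rho,
      mapLinear_rho, S.laurent_scale]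
    rfl

/-- Laurent expansion at the origin, from invariants to invariants. -/
def _root_.GammaSet.expandZero : S.fixed →ₗ[ℂ] G.localInvariants :=
  ((S.expand 0).comp S.fixed.subtype).codRestrict G.localInvariants.toSubmodule
    (fun x k => by
      rw [LinearMap.comp_apply, ← S.expand_zero_act]
      exact congrArg _ (x.2 k))

end CyclotomicDatum

section CentralModes

variable {𝓛 : Type*} [AddCommGroup 𝓛] [Module ℂ 𝓛] [VertexLieAlgebra 𝓛] {T : ℕ}

lemma D_cent : D (cent : 𝓛) = 0 := by
  have : (cent : 𝓛) ∈ LinearMap.ker (D (𝓛 := 𝓛)) := by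
    rw [ker_D]; exact Submodule.mem_span_singleton_self _
  exact this

lemma rho_cent_powerSeries (g : PowerSeries ℂ) :
    rho 𝓛 ℂ⸨X⸩ (cent ⊗ₜ HahnSeries.ofPowerSeries ℤ ℂ g) = 0 := by
  have h : δ (HahnSeries.ofPowerSeries ℤ ℂ
      (PowerSeries.mk fun n => (n : ℂ)⁻¹ * PowerSeries.coeff (n - 1) g)) =
      HahnSeries.ofPowerSeries ℤ ℂ g := by
    show LaurentSeries.derivative ℂ _ = _
    ext n
    rw [LaurentSeries.derivative_apply, LaurentSeries.hasseDeriv_coeff]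
    simp only [Nat.cast_one, Ring.choose_one_right, zsmul_eq_mul]
    rw [PowerSeries.coeff_coe, PowerSeries.coeff_coe]
    rcases lt_trichotomy n (-1) with h | h | h
    · rw [if_pos (by omega), if_pos (by omega), mul_zero]
    · subst h; simp
    · rw [if_neg (by omega), if_neg (by omega), PowerSeries.coeff_mk]
      obtain ⟨m, rfl⟩ := Int.eq_ofNat_of_zero_le (show 0 ≤ n by omega)
      have e1 : ((m : ℤ) + 1).natAbs = m + 1 := by omega
      have e2 : ((m : ℤ)).natAbs = m := by omega
      rw [e1, e2, Nat.add_sub_cancel, ← mul_assoc]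
      have e3 : ((m + 1 : ℕ) : ℂ) ≠ 0 := by exact_mod_cast Nat.succ_ne_zero m
      push_cast at e3 ⊢
      rw [mul_inv_cancel₀ e3, one_mul]
  have e := rho_del (𝓛 := 𝓛) (A := ℂ⸨X⸩) (cent ⊗ₜ (HahnSeries.ofPowerSeries ℤ ℂ
      (PowerSeries.mk fun n => (n : ℂ)⁻¹ * PowerSeries.coeff (n - 1) g)))
  rwa [del_tmul, D_cent, TensorProduct.zero_tmul, zero_add, h] at e

variable {G : CyclotomicDatum 𝓛 T} (S : GammaSet G)

/-- The class of `cent / (t - x)`. -/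
def GammaSet.centPole (x : ℂ) (hx : x ∈ S.carrier) : S.GlobalLie :=
  rho 𝓛 _ (cent ⊗ₜ simplePole x hx)

lemma GammaSet.expand_centPole_self (x : ℂ) (hx : x ∈ S.carrier) :
    S.expand x (S.centPole x hx) = centMode 𝓛 := by
  rw [GammaSet.expand, GammaSet.centPole, mapLinear_rho, centMode]
  congr 2
  show laurentExp x (1 / (RatFunc.X - RatFunc.C x)) = _
  rw [map_div₀, map_sub, map_one, laurentExp_X, laurentExp_C, add_sub_cancel_right, one_div,
    HahnSeries.inv_single, inv_one]

lemma GammaSet.expand_centPole_ne (z x : ℂ) (hx : x ∈ S.carrier) (hzx : z ≠ x) :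
    S.expand z (S.centPole x hx) = 0 := by
  rw [GammaSet.expand, GammaSet.centPole, mapLinear_rho]
  have h : laurentExp z (1 / (RatFunc.X - RatFunc.C x)) = HahnSeries.ofPowerSeries ℤ ℂ
      (PowerSeries.X + PowerSeries.C (z - x))⁻¹ := by
    have h0 : PowerSeries.constantCoeff (PowerSeries.X + PowerSeries.C (z - x)) ≠ 0 := by
      simpa [sub_eq_zero] using hzx
    have h1 := congrArg (HahnSeries.ofPowerSeries ℤ ℂ) (PowerSeries.mul_inv_cancel _ h0)
    rw [map_mul, map_one, map_add, HahnSeries.ofPowerSeries_X, HahnSeries.ofPowerSeries_C] at h1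
    rw [map_div₀, map_sub, map_one, laurentExp_X, laurentExp_C, add_sub_assoc, ← map_sub]
    exact (eq_one_div_of_mul_eq_one_right h1).symm
  show rho 𝓛 ℂ⸨X⸩ (cent ⊗ₜ laurentExp z (1 / (RatFunc.X - RatFunc.C x))) = 0
  rw [h, rho_cent_powerSeries]

lemma GammaSet.act_centPole (k : ℕ) (x : ℂ) (hx : x ∈ S.carrier) :
    S.act k (S.centPole x hx) = S.centPole (G.ω ^ k * x) (S.smul_mem k x hx) := by
  have h := G.ω_pow_ne_zero k
  rw [GammaSet.act, GammaSet.centPole, mapLinear_rho, G.twist_cent, TensorProduct.smul_tmul,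
    GammaSet.centPole]
  congr 2
  apply Subtype.ext
  show (G.ω ^ k)⁻¹ • scaleRat (G.ω ^ k)⁻¹ _ (1 / (RatFunc.X - RatFunc.C x)) =
    1 / (RatFunc.X - RatFunc.C (G.ω ^ k * x))
  have e := scaleRat_div (G.ω ^ k)⁻¹ (inv_ne_zero h) 1 (Polynomial.X - Polynomial.C x)
  simp only [map_one, map_sub, RatFunc.algebraMap_X, RatFunc.algebraMap_C, Polynomial.one_comp,
    Polynomial.sub_comp, Polynomial.X_comp, Polynomial.C_comp, map_mul] at e
  have hC : RatFunc.C (G.ω ^ k) ≠ (0 : RatFunc ℂ) := by simpa using h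
  rw [e, RatFunc.smul_eq_C_mul, map_mul, map_inv₀, mul_one_div, ← one_div, div_div]
  congr 1
  rw [mul_sub, ← mul_assoc, mul_one_div, div_self hC, one_mul]

/-- `∑_{α ∈ Γ} cent / (t - α x)`. -/
def GammaSet.orbitSum (x : ℂ) (hx : x ∈ S.carrier) : S.GlobalLie :=
  ∑ k ∈ Finset.range T, S.centPole (G.ω ^ k * x) (S.smul_mem k x hx)

lemma GammaSet.centPole_congr {x y : ℂ} (h : x = y) (hx : x ∈ S.carrier) :
    S.centPole x hx = S.centPole y (h ▸ hx) := by
  subst h; rfl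

lemma GammaSet.act_orbitSum (k : ℕ) (x : ℂ) (hx : x ∈ S.carrier) :
    S.act k (S.orbitSum x hx) = S.orbitSum x hx := by
  have key : ∀ (g : ℕ → S.GlobalLie), (∀ n, g (n + T) = g n) → ∀ k,
      ∑ j ∈ Finset.range T, g (k + j) = ∑ j ∈ Finset.range T, g j := by
    intro g hg k
    induction k with
    | zero => simp
    | succ k ih =>
      rw [← ih]
      have e1 := Finset.sum_range_succ (fun j => g (k + j)) T
      rw [Finset.sum_range_succ'] at e1
      have e2 : g (k + T) = g (k + 0) := by rw [hg]; rfl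
      rw [e2] at e1
      have e3 := add_right_cancel e1
      rw [← e3]
      exact Finset.sum_congr rfl fun j _ => by congr 1; ring
  rw [GammaSet.orbitSum, map_sum]
  refine Eq.trans (Finset.sum_congr rfl fun j _ => ?_)
    (key (fun j => S.centPole (G.ω ^ j * x) (S.smul_mem j x hx)) (fun n => ?_) k)
  · rw [S.act_centPole]
    exact S.centPole_congr (by rw [pow_add, mul_assoc]) _
  · exact S.centPole_congr (by rw [pow_add, G.primitive.pow_eq_one, mul_one]) _

end CentralModes

/-! ## Coinvariants -/

namespace GammaSet

variable {𝓛 : Type*} [AddCommGroup 𝓛] [Module ℂ 𝓛] [VertexLieAlgebra 𝓛] {T : ℕ}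
variable {G : CyclotomicDatum 𝓛 T} (S : GammaSet G)

/-- A subspace of central elements of `Lie_A 𝓛` on which `Γ` acts trivially, to be divided out. -/
structure CentralIdeal where
  /-- the underlying subspace -/
  I : Submodule ℂ S.GlobalLie
  act_eq : ∀ k, ∀ x ∈ I, S.act k x = x

variable {S} (J : S.CentralIdeal) (Lo : Submodule ℂ 𝓛)

/-- The action of `ω ^ k ∈ Γ` on the quotient `Lie_A 𝓛 / I`. -/
def CentralIdeal.quotAct (k : ℕ) : (S.GlobalLie ⧸ J.I) →ₗ[ℂ] (S.GlobalLie ⧸ J.I) :=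
  J.I.mapQ J.I (S.act k) (fun x hx => by
    rw [Submodule.mem_comap, J.act_eq k x hx]; exact hx)

/-- The image of `ρ (Lo ⊗ A)` in the quotient `Lie_A 𝓛 / I`. -/
def CentralIdeal.reduced : Submodule ℂ (S.GlobalLie ⧸ J.I) :=
  Submodule.span ℂ {x | ∃ a ∈ Lo, ∃ f : ratVanishing S.carrier, x = J.I.mkQ (rho 𝓛 _ (a ⊗ₜ f))}

/-- The cyclotomic global Lie algebra: the `Γ`-invariants in the image of `ρ (Lo ⊗ A)` in
`Lie_A 𝓛 / I`. -/
def CentralIdeal.cyclotomicLie : Submodule ℂ (S.GlobalLie ⧸ J.I) where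
  carrier := {x | x ∈ J.reduced Lo ∧ ∀ k, J.quotAct k x = x}
  add_mem' hx hy := ⟨add_mem hx.1 hy.1, fun k => by rw [map_add, hx.2 k, hy.2 k]⟩
  zero_mem' := ⟨zero_mem _, fun k => map_zero _⟩
  smul_mem' c x hx := ⟨Submodule.smul_mem _ c hx.1, fun k => by rw [map_smul, hx.2 k]⟩

end GammaSet

namespace CyclotomicDatum

variable {𝓛 : Type*} [AddCommGroup 𝓛] [Module ℂ 𝓛] [VertexLieAlgebra 𝓛] {T : ℕ}
variable (G : CyclotomicDatum 𝓛 T)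

/-- The union `Γ p` of the `Γ`-orbits of the points `p i`. -/
def orbit {n : ℕ} (p : Fin n → ℂ) : GammaSet G where
  carrier := {x | ∃ i k, x = G.ω ^ k * p i}
  smul_mem := by
    rintro k _ ⟨i, j, rfl⟩
    exact ⟨i, k + j, by rw [pow_add, mul_assoc]⟩

/-- The set `Γ p ∪ {0}`. -/
def orbitZero {n : ℕ} (p : Fin n → ℂ) : GammaSet G where
  carrier := {x | ∃ i k, x = G.ω ^ k * p i} ∪ {0}
  smul_mem := by
    rintro k x (⟨i, j, rfl⟩ | hx)
    · exact Or.inl ⟨i, k + j, by rw [pow_add, mul_assoc]⟩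
    · rw [Set.mem_singleton_iff] at hx
      subst hx
      exact Or.inr (by simp)

variable {G} in
lemma mem_orbit {n : ℕ} (p : Fin n → ℂ) (i : Fin n) : p i ∈ (G.orbit p).carrier :=
  ⟨i, 0, by simp⟩

variable {G} in
lemma mem_orbitZero {n : ℕ} (p : Fin n → ℂ) (i : Fin n) : p i ∈ (G.orbitZero p).carrier :=
  Or.inl ⟨i, 0, by simp⟩

variable {G} in
lemma zero_mem_orbitZero {n : ℕ} (p : Fin n → ℂ) : 0 ∈ (G.orbitZero p).carrier := Or.inr rfl

lemma act_eq_of_span {S : GammaSet G} (s : Set S.GlobalLie) (h : ∀ k, ∀ x ∈ s, S.act k x = x)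
    (k : ℕ) (x : S.GlobalLie) (hx : x ∈ Submodule.span ℂ s) : S.act k x = x := by
  induction hx using Submodule.span_induction with
  | mem x hx => exact h k x hx
  | zero => exact map_zero _
  | add x y _ _ hx hy => rw [map_add, hx, hy]
  | smul c x _ hx => rw [map_smul, hx]

/-- The ideal `I_{Γ p}`, spanned by the differences
`∑_{α ∈ Γ} cent / (t - α p i) - ∑_{α ∈ Γ} cent / (t - α p j)`. -/
def ideal {n : ℕ} (p : Fin n → ℂ) : (G.orbit p).CentralIdeal where
  I := Submodule.span ℂ {x | ∃ i j, x =
    (G.orbit p).orbitSum (p i) (mem_orbit p i) - (G.orbit p).orbitSum (p j) (mem_orbit p j)}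
  act_eq := G.act_eq_of_span _ (by
    rintro k _ ⟨i, j, rfl⟩
    rw [map_sub, GammaSet.act_orbitSum, GammaSet.act_orbitSum])

/-- The ideal `I_{Γ p, 0}`, spanned by the elements
`∑_{α ∈ Γ} cent / (t - α p i) - T cent / t`. -/
def idealZero {n : ℕ} (p : Fin n → ℂ) : (G.orbitZero p).CentralIdeal where
  I := Submodule.span ℂ {x | ∃ i, x =
    (G.orbitZero p).orbitSum (p i) (mem_orbitZero p i) -
      (T : ℂ) • (G.orbitZero p).centPole 0 (zero_mem_orbitZero p)}
  act_eq := G.act_eq_of_span _ (by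
    rintro k _ ⟨i, rfl⟩
    rw [map_sub, map_smul, GammaSet.act_orbitSum, GammaSet.act_centPole]
    congr 2
    exact GammaSet.centPole_congr _ (by simp) _)

/-- The global Lie algebra `L^Γ_p (𝓛)`. -/
def globalLie (Lo : Submodule ℂ 𝓛) {n : ℕ} (p : Fin n → ℂ) :
    Submodule ℂ ((G.orbit p).GlobalLie ⧸ (G.ideal p).I) :=
  (G.ideal p).cyclotomicLie Lo

/-- The global Lie algebra `L^Γ_{p,0} (𝓛)`, with poles at the origin allowed. -/
def globalLieZero (Lo : Submodule ℂ 𝓛) {n : ℕ} (p : Fin n → ℂ) :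
    Submodule ℂ ((G.orbitZero p).GlobalLie ⧸ (G.idealZero p).I) :=
  (G.idealZero p).cyclotomicLie Lo

/-- The requirements on the complement `Lo` (denoted `𝓛ᵒ` in the decomposition
`𝓛 = 𝓛ᵒ ⊕ ℂ cent ⊕ Im D`): it is a graded subspace and `Γ` acts on its image modulo `Im D`. -/
structure IsAdmissible (Lo : Submodule ℂ 𝓛) : Prop where
  isCompl : IsCompl Lo (Submodule.span ℂ {(cent : 𝓛)} ⊔ LinearMap.range (D (𝓛 := 𝓛)))
  graded : Lo ≤ ⨆ n, Lo ⊓ gr (𝓛 := 𝓛) n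
  stable : ∀ a ∈ Lo, G.σ a ∈ Lo ⊔ LinearMap.range (D (𝓛 := 𝓛))

end CyclotomicDatum

namespace GammaSet

variable {𝓛 : Type*} [AddCommGroup 𝓛] [Module ℂ 𝓛] [VertexLieAlgebra 𝓛] {T : ℕ}
variable {G : CyclotomicDatum 𝓛 T} (S : GammaSet G)

/-- The action of invariant global elements on an `L(𝓛)`-module assigned to the point `z`. -/
def actAt (z : ℂ) (M : Type*) [AddCommGroup M] [Module ℂ M] [LieRingModule (LocalLie 𝓛) M]
    [LieModule ℂ (LocalLie 𝓛) M] : S.fixed →ₗ[ℂ] Module.End ℂ M :=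
  (LieModule.toEnd ℂ (LocalLie 𝓛) M : LocalLie 𝓛 →ₗ[ℂ] Module.End ℂ M) ∘ₗ
    S.expand z ∘ₗ S.fixed.subtype

/-- The action of invariant global elements on an `L(𝓛)^Γ`-module assigned to the origin. -/
def actAtZero (M : Type*) [AddCommGroup M] [Module ℂ M] [LieRingModule G.localInvariants M]
    [LieModule ℂ G.localInvariants M] : S.fixed →ₗ[ℂ] Module.End ℂ M :=
  (LieModule.toEnd ℂ G.localInvariants M : G.localInvariants →ₗ[ℂ] Module.End ℂ M) ∘ₗ
    S.expandZero

/-- The action `x ↦ a x ⊗ 1 + 1 ⊗ b x` on a tensor product of two spaces. -/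
def actTensor {P Q : Type*} [AddCommGroup P] [Module ℂ P] [AddCommGroup Q] [Module ℂ Q]
    (a : S.fixed →ₗ[ℂ] Module.End ℂ P) (b : S.fixed →ₗ[ℂ] Module.End ℂ Q) :
    S.fixed →ₗ[ℂ] Module.End ℂ (P ⊗[ℂ] Q) :=
  LinearMap.rTensorHom Q ∘ₗ a + LinearMap.lTensorHom P ∘ₗ b

open scoped TensorProduct in
/-- The action `x ↦ ∑ i, 1 ⊗ ⋯ ⊗ x ⊗ ⋯ ⊗ 1` on `⨂ i, M i`, the factor `M i` being assigned to the
point `z i`. -/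
def actPi {N : ℕ} (z : Fin N → ℂ) (M : Fin N → Type*) [∀ i, AddCommGroup (M i)]
    [∀ i, Module ℂ (M i)] [∀ i, LieRingModule (LocalLie 𝓛) (M i)]
    [∀ i, LieModule ℂ (LocalLie 𝓛) (M i)] : S.fixed →ₗ[ℂ] Module.End ℂ (⨂[ℂ] i, M i) :=
  ∑ i, (PiTensorProduct.mapMultilinear ℂ M M).toLinearMap (fun _ => LinearMap.id) i ∘ₗ
    S.actAt (z i) (M i)

variable {S} in
/-- The subspace `K · W` of a space `W`, spanned by the vectors `x · w` for `x` in a space `K` of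
`Γ`-invariant classes modulo `I`. The action is given on representatives: as `Γ` is finite and fixes
`I` pointwise, every representative of a `Γ`-invariant class is itself `Γ`-invariant, and `I` acts
by zero on the modules considered, by the conditions on their levels. -/
def relations {I : Submodule ℂ S.GlobalLie} (K : Submodule ℂ (S.GlobalLie ⧸ I)) {W : Type*}
    [AddCommGroup W] [Module ℂ W] (act : S.fixed →ₗ[ℂ] Module.End ℂ W) : Submodule ℂ W :=
  Submodule.span ℂ {y | ∃ (x : S.fixed) (w : W), I.mkQ (x : S.GlobalLie) ∈ K ∧ y = act x w}

end GammaSet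

end

/-! ## Coinvariants of induced modules -/

noncomputable section

namespace UniversalEnvelopingAlgebra

variable {K : Type*} [LieRing K] [LieAlgebra ℂ K]

/-! The statement is a form of Frobenius reciprocity. The vacuum module is induced from a character
χ of P = `localPos` + ℂ c(-1), where χ is 0 on `localPos` and 1 on c(-1). Let K be the Lie algebra
of invariant classes whose poles may also lie on Γu, and let φ be expansion at u. If φ K + P is all
of L(𝓛), the vacuum module, restricted to K, is induced from the preimage of P. Hence for every
K-module W the coinvariants of (vacuum) ⊗ W are W modulo the vectors x w + χ(φ x) w with φ x in P
(`UniversalEnvelopingAlgebra.exists_coinvariants_equiv`). The restriction statement is obtained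
without a PBW basis: the module induced to K is given an action of L(𝓛) directly
(`exists_extended_action`).

Two facts then remain. The first is φ K + P = L(𝓛) (`exists_expand_add`). Up to P, a local class is
a sum of principal parts with coefficients in Lo. Such a principal part at u is a rational function,
and averaging it over Γ adds only poles at the other points of Γu, which are regular at u. The
second is that the twisted relations are exactly the relations of the smaller global Lie algebra
(`twistedRelations_eq`). Principal parts with coefficients in Lo, the line ℂ c(-1) and `localPos`
form a direct sum (`eq_zero_of_polarTensor_mem`), because ker D = ℂ c and c is not in Im D. So an
invariant class of ρ(Lo ⊗ A) that expands into P at u has no pole on Γu at all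
(`exists_enlarge_eq`).

The central terms account for the ideals I. A bracket of classes of ρ(Lo ⊗ A) produces terms c ⊗ fg.
Since fg decays like t⁻², its residues add up to zero, and averaging puts the term into I
(`trace_mem_orbitIdeal`). By the level conditions every orbit sum of c/(t - x) acts on (vacuum) ⊗ W
with total scalar one. So an element of I acts on W by minus its scalar on the vacuum
(`exists_scalar`), which cancels the twist. -/

lemma ι_lie (x y : K) : ι ℂ ⁅x, y⁆ = ι ℂ x * ι ℂ y - ι ℂ y * ι ℂ x := by
  let _ := LieRing.ofAssociativeRing (A := UniversalEnvelopingAlgebra ℂ K)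
  exact LieHom.map_lie (ι ℂ) x y

variable (K) in
/-- The map `ι` as a linear map. -/
def ιLinear : K →ₗ[ℂ] UniversalEnvelopingAlgebra ℂ K where
  toFun := ι ℂ
  map_add' := map_add (ι ℂ)
  map_smul' := map_smul (ι ℂ)

/-- The commutator condition is stated inside the associative algebra and the Lie structure on `A`
is introduced only locally, so that uses with endomorphism algebras need no matching of Lie
instances. -/
lemma exists_algHom {A : Type*} [Ring A] [Algebra ℂ A] (f : K →ₗ[ℂ] A)
    (hf : ∀ x y, f ⁅x, y⁆ = f x * f y - f y * f x) :
    ∃ F : UniversalEnvelopingAlgebra ℂ K →ₐ[ℂ] A, ∀ x, F (ι ℂ x) = f x := by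
  let _ := LieRing.ofAssociativeRing (A := A)
  let _ := LieAlgebra.ofAssociativeAlgebra (A := A) (R := ℂ)
  let f' : K →ₗ⁅ℂ⁆ A := { f with map_lie' := fun {x y} => hf x y }
  exact ⟨lift ℂ f', lift_ι_apply ℂ f'⟩

lemma algHom_eq_id (F : UniversalEnvelopingAlgebra ℂ K →ₐ[ℂ] UniversalEnvelopingAlgebra ℂ K)
    (h : ∀ x, F (ι ℂ x) = ι ℂ x) : F = AlgHom.id ℂ _ := by
  let _ := LieRing.ofAssociativeRing (A := UniversalEnvelopingAlgebra ℂ K)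
  apply hom_ext
  apply LieHom.ext
  exact h

/-- The universal property gives a map from the enveloping algebra to the subalgebra generated by
`ι`. Followed by the inclusion it fixes every `ι x`, hence is the identity, and so the subalgebra is
everything. -/
lemma adjoin_range_ι :
    Algebra.adjoin ℂ (Set.range (ι ℂ : K → UniversalEnvelopingAlgebra ℂ K)) = ⊤ := by
  let S := Algebra.adjoin ℂ (Set.range (ι ℂ : K → UniversalEnvelopingAlgebra ℂ K))
  let f : K →ₗ[ℂ] S :=
    { toFun := fun x => ⟨ι ℂ x, Algebra.subset_adjoin ⟨x, rfl⟩⟩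
      map_add' := fun x y => Subtype.ext (map_add (ι ℂ) x y)
      map_smul' := fun c x => Subtype.ext (map_smul (ι ℂ) c x) }
  obtain ⟨F, hF⟩ := exists_algHom f fun x y => Subtype.ext (ι_lie x y)
  have h := algHom_eq_id (S.val.comp F) fun x => congrArg Subtype.val (hF x)
  rw [eq_top_iff]
  intro y _
  have := congrArg (fun g => g y) h
  simp only [AlgHom.comp_apply, AlgHom.id_apply] at this
  rw [← this]
  exact (F y).2

lemma induction_mul {p : UniversalEnvelopingAlgebra ℂ K → Prop} (one : p 1)
    (add : ∀ y z, p y → p z → p (y + z)) (smul : ∀ (c : ℂ) y, p y → p (c • y))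
    (mul : ∀ (x : K) y, p y → p (ι ℂ x * y)) (y : UniversalEnvelopingAlgebra ℂ K) : p y := by
  have h : y ∈ Algebra.adjoin ℂ (Set.range (ι ℂ : K → UniversalEnvelopingAlgebra ℂ K)) := by
    rw [adjoin_range_ι]; trivial
  -- An arbitrary right factor is allowed so that the product case of the induction closes by
  -- associativity.
  suffices ∀ z, p z → p (y * z) by simpa using this 1 one
  induction h using Algebra.adjoin_induction with
  | mem y hy => obtain ⟨x, rfl⟩ := hy; exact mul x
  | algebraMap c => intro z hz; rw [← Algebra.smul_def]; exact smul c z hz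
  | add y y' _ _ h h' => intro z hz; rw [add_mul]; exact add _ _ (h z hz) (h' z hz)
  | mul y y' _ _ h h' => intro z hz; rw [mul_assoc]; exact h _ (h' z hz)

variable (K) in
/-- The left ideal generated by the elements `x - s`, for `(x, s)` in a set of pairs. -/
def indIdeal (R : Set (K × ℂ)) :
    Submodule (UniversalEnvelopingAlgebra ℂ K) (UniversalEnvelopingAlgebra ℂ K) :=
  Submodule.span _ {y | ∃ r ∈ R, y = ι ℂ r.1 - algebraMap ℂ _ r.2}

/-! ### Modules induced from a character, and maps out of them. -/

section Quotient

variable {R : Set (K × ℂ)} {𝔍 : Submodule (UniversalEnvelopingAlgebra ℂ K)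
  (UniversalEnvelopingAlgebra ℂ K)} (h𝔍 : 𝔍 = indIdeal K R)
variable {E : Type*} [AddCommGroup E] [Module ℂ E] (f : K →ₗ[ℂ] Module.End ℂ E)
    (hf : ∀ x y, f ⁅x, y⁆ = f x * f y - f y * f x) (e : E) (he : ∀ r ∈ R, f r.1 e = r.2 • e)

include h𝔍 in
lemma ι_smul_mk_one (r : K × ℂ) (hr : r ∈ R) :
    ι ℂ r.1 • 𝔍.mkQ 1 = r.2 • 𝔍.mkQ 1 := by
  subst h𝔍
  have h : ι ℂ r.1 - algebraMap ℂ (UniversalEnvelopingAlgebra ℂ K) r.2 ∈ indIdeal K R := Submodule.subset_span ⟨r, hr, rfl⟩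
  rw [← sub_eq_zero, ← algebraMap_smul (UniversalEnvelopingAlgebra ℂ K) r.2 ((indIdeal K R).mkQ 1),
    ← sub_smul, ← map_smul, smul_eq_mul, mul_one]
  exact (Submodule.Quotient.mk_eq_zero _).2 h

lemma mkQ_induction {p : (UniversalEnvelopingAlgebra ℂ K ⧸ 𝔍) → Prop} (one : p (𝔍.mkQ 1))
    (add : ∀ y z, p y → p z → p (y + z)) (smul : ∀ (c : ℂ) y, p y → p (c • y))
    (mul : ∀ (x : K) y, p y → p (ι ℂ x • y)) (y : UniversalEnvelopingAlgebra ℂ K ⧸ 𝔍) : p y := by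
  obtain ⟨y, rfl⟩ := 𝔍.mkQ_surjective y
  induction y using induction_mul with
  | one => exact one
  | add y z hy hz => rw [map_add]; exact add _ _ hy hz
  | smul c y hy => exact smul c _ hy
  | mul x y hy => exact mul x _ hy

include h𝔍 hf he in
/-- The universal property of an induced module. -/
lemma exists_lift_quotient : ∃ g : (UniversalEnvelopingAlgebra ℂ K ⧸ 𝔍) →ₗ[ℂ] E,
    g (𝔍.mkQ 1) = e ∧ ∀ x y, g (ι ℂ x • y) = f x (g y) := by
  subst h𝔍
  obtain ⟨F, hF⟩ := exists_algHom f hf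
  let g₀ : UniversalEnvelopingAlgebra ℂ K →ₗ[ℂ] E :=
    (LinearMap.applyₗ e).comp F.toLinearMap
  have hker : (indIdeal K R).restrictScalars ℂ ≤ LinearMap.ker g₀ := by
    intro y hy
    rw [Submodule.restrictScalars_mem] at hy
    induction hy using Submodule.span_induction with
    | mem y hy =>
      obtain ⟨r, hr, rfl⟩ := hy
      show F (ι ℂ r.1 - algebraMap ℂ _ r.2) e = 0
      rw [map_sub, hF, AlgHom.commutes, LinearMap.sub_apply, he r hr]
      simp
    | zero => exact zero_mem _
    | add x y _ _ hx hy => exact add_mem hx hy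
    | smul a x _ hx =>
      have hx' : F x e = 0 := hx
      show F (a * x) e = 0
      rw [map_mul, Module.End.mul_apply, hx', map_zero]
  refine ⟨((indIdeal K R).restrictScalars ℂ).liftQ g₀ hker, ?_, fun x y => ?_⟩
  · show F 1 e = e
    rw [map_one]; rfl
  · obtain ⟨y, rfl⟩ := (indIdeal K R).mkQ_surjective y
    show F (ι ℂ x * y) e = f x (F y e)
    rw [map_mul, hF]; rfl

end Quotient

/-! ### Restriction of an induced module along φ : K → L when L = φ K + P. -/

section Frobenius

variable {L : Type*} [LieRing L] [LieAlgebra ℂ L] {φ : K →ₗ⁅ℂ⁆ L} {R : Submodule ℂ (L × ℂ)}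
  (hR : ∀ r ∈ R, ∀ r' ∈ R, (⁅r.1, r'.1⁆, (0 : ℂ)) ∈ R)
  (hsup : ∀ l, ∃ x, ∃ r ∈ R, l = φ x + r.1)

/-- The pairs `(x, s)` with `(φ x, s)` in a given set. -/
def pullPairs (φ : K →ₗ⁅ℂ⁆ L) (R : Submodule ℂ (L × ℂ)) : Set (K × ℂ) := {r | (φ r.1, r.2) ∈ R}

/-- The representation on linear maps out of `L` given by a representation on their values. -/
def homRep {Y : Type*} [AddCommGroup Y] [Module ℂ Y] (φ : K →ₗ⁅ℂ⁆ L)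
    (m : K →ₗ[ℂ] Module.End ℂ Y) : K →ₗ[ℂ] Module.End ℂ (L →ₗ[ℂ] Y) :=
  LinearMap.mk₂ ℂ (fun x F => m x ∘ₗ F - F ∘ₗ (LieAlgebra.ad ℂ L (φ x) : L →ₗ[ℂ] L))
    (fun x y F => by ext l; simp; abel)
    (fun c x F => by ext l; simp [smul_sub])
    (fun x F F' => by ext l; simp; abel)
    (fun c x F => by ext l; simp [smul_sub])

lemma homRep_apply {Y : Type*} [AddCommGroup Y] [Module ℂ Y] (φ : K →ₗ⁅ℂ⁆ L)
    (m : K →ₗ[ℂ] Module.End ℂ Y) (x : K) (F : L →ₗ[ℂ] Y) (l : L) :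
    homRep φ m x F l = m x (F l) - F ⁅φ x, l⁆ := rfl

lemma homRep_lie {Y : Type*} [AddCommGroup Y] [Module ℂ Y] (φ : K →ₗ⁅ℂ⁆ L)
    (m : K →ₗ[ℂ] Module.End ℂ Y) (hm : ∀ x y, m ⁅x, y⁆ = m x * m y - m y * m x) (x y : K) :
    homRep φ m ⁅x, y⁆ = homRep φ m x * homRep φ m y - homRep φ m y * homRep φ m x := by
  ext F l
  simp only [LinearMap.sub_apply, Module.End.mul_apply, homRep_apply, hm, map_sub, LieHom.map_lie,
    lie_lie]
  abel

include hR hsup in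
/-- If `L = φ K + P`, the `K`-module induced from the preimage of `P` carries a compatible action
of `L`. -/
lemma exists_extended_action :
    ∃ a : L →ₗ[ℂ] Module.End ℂ (UniversalEnvelopingAlgebra ℂ K ⧸ indIdeal K (pullPairs φ R)),
      (∀ x y, a ⁅x, y⁆ = a x * a y - a y * a x) ∧ (∀ x y, a (φ x) y = ι ℂ x • y) ∧
      ∀ r ∈ R, a r.1 ((indIdeal K (pullPairs φ R)).mkQ 1) =
        r.2 • (indIdeal K (pullPairs φ R)).mkQ 1 := by
  set 𝔍 := indIdeal K (pullPairs φ R) with h𝔍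
  let Y := UniversalEnvelopingAlgebra ℂ K ⧸ 𝔍
  let m : K →ₗ[ℂ] Module.End ℂ Y :=
    (Algebra.lsmul ℂ ℂ Y).toLinearMap ∘ₗ ιLinear K
  have hm : ∀ x (y : Y), m x y = ι ℂ x • y := fun _ _ => rfl
  have hm_lie : ∀ x y, m ⁅x, y⁆ = m x * m y - m y * m x := fun x y => by
    refine LinearMap.ext fun z => ?_
    simp only [LinearMap.sub_apply, Module.End.mul_apply, hm, ι_lie, sub_smul, mul_smul]
  -- The action is sought as a map F from Y to Hom(L, Y), with F y l playing the role of l y. The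
  -- rule l (x y) = x (l y) - [φ x, l] y says that F is K-equivariant for θ, so F is determined by
  -- its value `F₀` at the generator of Y.
  let θ := homRep φ m
  have hθ : ∀ x F l, θ x F l = m x (F l) - F ⁅φ x, l⁆ := fun _ _ _ => rfl
  have hθ_lie : ∀ x y, θ ⁅x, y⁆ = θ x * θ y - θ y * θ x := homRep_lie φ m hm_lie
  -- the initial functional
  let s : (K × R) →ₗ[ℂ] L := φ.toLinearMap.coprod ((LinearMap.fst ℂ L ℂ).comp R.subtype)
  let t : (K × R) →ₗ[ℂ] Y := (m.flip (𝔍.mkQ 1)).coprod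
    ((LinearMap.toSpanSingleton ℂ Y (𝔍.mkQ 1)).comp ((LinearMap.snd ℂ L ℂ).comp R.subtype))
  have hs : ∀ x r, s (x, r) = φ x + r.1.1 := fun _ _ => rfl
  have ht : ∀ x r, t (x, r) = m x (𝔍.mkQ 1) + r.1.2 • 𝔍.mkQ 1 := fun _ _ => rfl
  have hs_surj : LinearMap.range s = ⊤ := by
    rw [LinearMap.range_eq_top]
    intro l
    obtain ⟨x, r, hr, rfl⟩ := hsup l
    exact ⟨(x, ⟨r, hr⟩), rfl⟩
  obtain ⟨g, hg⟩ := s.exists_rightInverse_of_surjective hs_surj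
  -- This makes `F₀` independent of the decomposition l = φ x + r: when φ x = -r, the pair (x, -r.2)
  -- belongs to `pullPairs`, so x already acts on the generator by -r.2.
  have hker : ∀ v, s v = 0 → t v = 0 := by
    rintro ⟨x, r⟩ h
    rw [hs] at h
    have hx : (φ x, -r.1.2) ∈ R := by
      rw [eq_neg_of_add_eq_zero_left h]
      exact neg_mem r.2
    rw [ht, hm]
    have := ι_smul_mk_one h𝔍 (x, -r.1.2) hx
    simp only at this
    rw [this, neg_smul, neg_add_cancel]
  let F₀ : L →ₗ[ℂ] Y := t ∘ₗ g
  have hF₀ : ∀ v, F₀ (s v) = t v := by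
    intro v
    have : t (g (s v) - v) = 0 := hker _ (by
      rw [map_sub, sub_eq_zero]
      exact congrArg (fun f => f (s v)) hg)
    rw [map_sub, sub_eq_zero] at this
    exact this
  have hF₀φ : ∀ x, F₀ (φ x) = m x (𝔍.mkQ 1) := fun x => by
    have := hF₀ (x, 0)
    rwa [hs, ht, Submodule.coe_zero, Prod.fst_zero, Prod.snd_zero, add_zero, zero_smul,
      add_zero] at this
  have hF₀R : ∀ r ∈ R, F₀ r.1 = r.2 • 𝔍.mkQ 1 := fun r hr => by
    have := hF₀ (0, ⟨r, hr⟩)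
    rwa [hs, ht, map_zero, map_zero, LinearMap.zero_apply, zero_add, zero_add] at this
  -- Checked separately on φ K, where the commutator of the two actions on the generator leaves only
  -- the scalar, and on R, where by `hR` the bracket term contributes zero.
  have hinv : ∀ r ∈ pullPairs φ R, θ r.1 F₀ = r.2 • F₀ := by
    rintro ⟨x, c⟩ hr
    have hx1 : m x (𝔍.mkQ 1) = c • 𝔍.mkQ 1 := ι_smul_mk_one h𝔍 (x, c) hr
    ext l
    obtain ⟨x', r', hr', rfl⟩ := hsup l
    have h0 := hF₀R _ (hR _ hr _ hr')
    simp only [zero_smul] at h0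
    simp only [hθ, LinearMap.smul_apply, map_add, lie_add, hF₀φ, h0, ← LieHom.map_lie, hm_lie,
      hF₀R r' hr', LinearMap.sub_apply, Module.End.mul_apply, hx1, map_smul]
    rw [smul_comm r'.2 c]
    abel
  obtain ⟨F, hF1, hFx⟩ := exists_lift_quotient h𝔍 θ hθ_lie F₀ hinv
  have hFφ : ∀ y x, F y (φ x) = m x y := by
    intro y
    induction y using mkQ_induction with
    | one => intro x; rw [hF1, hF₀φ]
    | add y z hy hz => intro x; rw [map_add, LinearMap.add_apply, hy, hz, map_add]
    | smul c y hy => intro x; rw [map_smul, LinearMap.smul_apply, hy, map_smul]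
    | mul x' y hy =>
      intro x
      rw [hFx, hθ, hy, ← LieHom.map_lie, hy, hm_lie, ← hm]
      simp
  have hcomm : ∀ x y l, F (m x y) l = m x (F y l) - F y ⁅φ x, l⁆ := fun x y l => by
    rw [hm, hFx, hθ]
  have hlieφ : ∀ x l y, F y ⁅φ x, l⁆ = F (F y l) (φ x) - F (F y (φ x)) l := fun x l y => by
    rw [hFφ, hFφ, hcomm]; abel
  -- Induction on y. Passing from y to x y is the Jacobi identity. At the generator both arguments
  -- are split along φ K + R: a bracket with an entry in φ K is `hlieφ`, and for two entries in R
  -- both sides vanish, since the scalars commute and the bracket has scalar zero.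
  have hlie : ∀ y l l', F y ⁅l, l'⁆ = F (F y l') l - F (F y l) l' := by
    intro y
    induction y using mkQ_induction with
    | one =>
      intro l l'
      obtain ⟨x, r, hr, rfl⟩ := hsup l
      obtain ⟨x', r', hr', rfl⟩ := hsup l'
      have h0 : F (𝔍.mkQ 1) ⁅r.1, φ x'⁆ = -(F (F (𝔍.mkQ 1) r.1) (φ x') -
          F (F (𝔍.mkQ 1) (φ x')) r.1) := by
        rw [← lie_skew, map_neg, hlieφ]
      rw [add_lie, map_add, hlieφ, lie_add]
      have h1 : F (𝔍.mkQ 1) ⁅r.1, r'.1⁆ = 0 := by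
        have h0 := hF₀R _ (hR _ hr _ hr')
        rw [hF1, h0, zero_smul]
      have h2 : F (F (𝔍.mkQ 1) r'.1) r.1 = F (F (𝔍.mkQ 1) r.1) r'.1 := by
        rw [hF1, hF₀R r hr, hF₀R r' hr', map_smul, map_smul, LinearMap.smul_apply,
          LinearMap.smul_apply, hF1, hF₀R r hr, hF₀R r' hr', smul_comm]
      simp only [map_add, LinearMap.add_apply, h0, h1, h2]
      abel
    | add y z hy hz => intro l l'; simp only [map_add, LinearMap.add_apply, hy, hz]; abel
    | smul c y hy => intro l l'; simp only [map_smul, LinearMap.smul_apply, hy, smul_sub]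
    | mul x y hy =>
      intro l l'
      have e : ⁅φ x, ⁅l, l'⁆⁆ = ⁅⁅φ x, l⁆, l'⁆ + ⁅l, ⁅φ x, l'⁆⁆ := leibniz_lie _ _ _
      rw [← hm, hcomm, e, map_add, hy l l', hy ⁅φ x, l⁆ l', hy l ⁅φ x, l'⁆]
      simp only [hcomm, map_sub, LinearMap.sub_apply]
      abel
  refine ⟨F.flip, fun x y => ?_, fun x y => hFφ y x, fun r hr => ?_⟩
  · exact LinearMap.ext fun z => hlie z x y
  · rw [LinearMap.flip_apply, hF1, hF₀R r hr]

variable {𝔍 : Submodule (UniversalEnvelopingAlgebra ℂ L) (UniversalEnvelopingAlgebra ℂ L)}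
  (h𝔍 : 𝔍 = indIdeal L R)
variable {W : Type*} [AddCommGroup W] [Module ℂ W] {ψ : K →ₗ[ℂ] Module.End ℂ W}
  (hψ : ∀ x y, ψ ⁅x, y⁆ = ψ x * ψ y - ψ y * ψ x)

/-- The span of the vectors `x · w + s w`, for `(φ x, s)` in `R`. -/
def twistedRelations (φ : K →ₗ⁅ℂ⁆ L) (R : Submodule ℂ (L × ℂ)) (ψ : K →ₗ[ℂ] Module.End ℂ W) :
    Submodule ℂ W :=
  Submodule.span ℂ {y | ∃ x s w, (φ x, s) ∈ R ∧ y = ψ x w + s • w}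

/-- The span of the vectors `x · (v ⊗ w)` in the tensor product of an induced module with `W`. -/
def tensorRelations (𝔍 : Submodule (UniversalEnvelopingAlgebra ℂ L)
    (UniversalEnvelopingAlgebra ℂ L)) (φ : K →ₗ⁅ℂ⁆ L) (ψ : K →ₗ[ℂ] Module.End ℂ W) :
    Submodule ℂ ((UniversalEnvelopingAlgebra ℂ L ⧸ 𝔍) ⊗[ℂ] W) :=
  Submodule.span ℂ {y | ∃ x v w, y = (ι ℂ (φ x) • v) ⊗ₜ[ℂ] w + v ⊗ₜ[ℂ] ψ x w}

include hR hsup h𝔍 hψ in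
-- The universal property is used twice: over L, mapping to the K-induced module with its extended
-- L-action, and over K, mapping from there to Hom(W, Q). The composite is an invariant pairing of
-- the induced module with W, with values in the twisted quotient Q.
lemma exists_equivariant :
    ∃ Φ : ((UniversalEnvelopingAlgebra ℂ L ⧸ 𝔍) ⊗[ℂ] W) →ₗ[ℂ] W ⧸ twistedRelations φ R ψ,
      (∀ w, Φ (𝔍.mkQ 1 ⊗ₜ w) = (twistedRelations φ R ψ).mkQ w) ∧
      tensorRelations 𝔍 φ ψ ≤ LinearMap.ker Φ := by
  obtain ⟨a, ha, haφ, ha1⟩ := exists_extended_action hR hsup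
  obtain ⟨Θ, hΘ1, hΘ⟩ := exists_lift_quotient (R := (R : Set (L × ℂ))) h𝔍 a ha _ ha1
  let Q := W ⧸ twistedRelations φ R ψ
  -- The contragredient action with K trivial on Q: an equivariant map into Hom(W, Q) is a pairing
  -- that kills all x v ⊗ w + v ⊗ x w.
  let c : K →ₗ[ℂ] Module.End ℂ (W →ₗ[ℂ] Q) :=
    { toFun := fun x =>
        { toFun := fun h => -(h ∘ₗ ψ x)
          map_add' := fun h h' => by ext w; simp; abel
          map_smul' := fun r h => by ext w; simp }
      map_add' := fun x y => by ext h w; simp; abel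
      map_smul' := fun r x => by ext h w; simp }
  have hc : ∀ x h w, c x h w = -h (ψ x w) := fun _ _ _ => rfl
  have hc_lie : ∀ x y, c ⁅x, y⁆ = c x * c y - c y * c x := fun x y => by
    refine LinearMap.ext fun h => LinearMap.ext fun w => ?_
    simp only [LinearMap.sub_apply, Module.End.mul_apply, hc, hψ, map_sub]
    abel
  -- The projection to Q has the required eigenvalue because x w + s w is zero in Q, so that x sends
  -- it to w ↦ -[x w] = s [w].
  obtain ⟨Ψ, hΨ1, hΨ⟩ := exists_lift_quotient (R := pullPairs φ R) rfl c hc_lie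
    (twistedRelations φ R ψ).mkQ (by
      rintro ⟨x, s⟩ hr
      refine LinearMap.ext fun w => ?_
      rw [hc, LinearMap.smul_apply, ← map_smul, ← map_neg, ← sub_eq_zero, ← map_sub]
      refine (Submodule.Quotient.mk_eq_zero _).2 ?_
      rw [← neg_mem_iff, neg_sub, sub_neg_eq_add, add_comm]
      exact Submodule.subset_span ⟨x, s, w, hr, rfl⟩)
  refine ⟨TensorProduct.lift (Ψ ∘ₗ Θ), fun w => ?_, ?_⟩
  · rw [TensorProduct.lift.tmul, LinearMap.comp_apply, hΘ1, hΨ1]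
  · rw [tensorRelations, Submodule.span_le]
    rintro _ ⟨x, v, w, rfl⟩
    show TensorProduct.lift (Ψ ∘ₗ Θ) _ = 0
    rw [map_add, TensorProduct.lift.tmul, TensorProduct.lift.tmul, LinearMap.comp_apply,
      LinearMap.comp_apply, hΘ, haφ, hΨ, hc, neg_add_cancel]

include hsup h𝔍 in
-- The generator already generates under φ K alone: its orbit `range p` under the enveloping algebra
-- of K is stable under all of L.
lemma mkQ_mem_span_of_sup (v : UniversalEnvelopingAlgebra ℂ L ⧸ 𝔍)
    (N : Submodule ℂ (UniversalEnvelopingAlgebra ℂ L ⧸ 𝔍)) (h1 : 𝔍.mkQ 1 ∈ N)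
    (hN : ∀ x, ∀ v ∈ N, ι ℂ (φ x) • v ∈ N) : v ∈ N := by
  obtain ⟨F, hF⟩ := exists_algHom (ιLinear L ∘ₗ φ.toLinearMap)
    fun x y => (congrArg (ι ℂ) (φ.map_lie x y)).trans (ι_lie _ _)
  let p : UniversalEnvelopingAlgebra ℂ K →ₗ[ℂ] UniversalEnvelopingAlgebra ℂ L ⧸ 𝔍 :=
    (𝔍.mkQ.restrictScalars ℂ).comp F.toLinearMap
  have hp1 : p 1 = 𝔍.mkQ 1 := by
    show 𝔍.mkQ (F 1) = _
    rw [map_one]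
  have hpx : ∀ x y, p (ι ℂ x * y) = ι ℂ (φ x) • p y := fun x y => by
    show 𝔍.mkQ (F _) = _ • 𝔍.mkQ (F y)
    rw [map_mul, ← map_smul, hF]
    rfl
  have hpN : ∀ y, p y ∈ N := by
    intro y
    induction y using induction_mul with
    | one => rwa [hp1]
    | add y z hy hz => rw [map_add]; exact add_mem hy hz
    | smul c y hy => rw [map_smul]; exact Submodule.smul_mem _ _ hy
    | mul x y hy => rw [hpx]; exact hN x _ hy
  -- An element l is moved to the right past φ x at the cost of [l, φ x]. The claim quantifies over
  -- l, so the induction hypothesis covers this commutator too. At the generator, l splits as φ x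
  -- plus an element acting by a scalar.
  have hstep : ∀ y (l : L), ι ℂ l • p y ∈ LinearMap.range p := by
    intro y
    induction y using induction_mul with
    | one =>
      intro l
      obtain ⟨x, r, hr, rfl⟩ := hsup l
      rw [map_add, add_smul, hp1, ι_smul_mk_one (R := (R : Set (L × ℂ))) h𝔍 r hr, ← hp1, ← hpx]
      exact add_mem ⟨_, rfl⟩ (Submodule.smul_mem _ _ ⟨_, rfl⟩)
    | add y z hy hz => intro l; rw [map_add, smul_add]; exact add_mem (hy l) (hz l)
    | smul c y hy =>
      intro l
      rw [map_smul, ← algebraMap_smul (UniversalEnvelopingAlgebra ℂ L) c (p y), smul_smul,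
        ← Algebra.commutes, ← smul_smul, algebraMap_smul]
      exact Submodule.smul_mem _ _ (hy l)
    | mul x y hy =>
      intro l
      have e : ι ℂ l * ι ℂ (φ x) = ι ℂ (φ x) * ι ℂ l + ι ℂ ⁅l, φ x⁆ := by
        rw [ι_lie]; abel
      rw [hpx, smul_smul, e, add_smul, mul_smul]
      obtain ⟨y', hy'⟩ := hy l
      refine add_mem ?_ (hy _)
      rw [← hy', ← hpx]
      exact ⟨_, rfl⟩
  have hrange : v ∈ LinearMap.range p := by
    induction v using mkQ_induction with
    | one => exact ⟨1, hp1⟩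
    | add y z hy hz => exact add_mem hy hz
    | smul c y hy => exact Submodule.smul_mem _ _ hy
    | mul l y hy => obtain ⟨y, rfl⟩ := hy; exact hstep y l
  obtain ⟨y, rfl⟩ := hrange
  exact hpN y

include hR hsup h𝔍 hψ in
/-- The coinvariants of the tensor product of an induced module with `W`. -/
theorem exists_coinvariants_equiv :
    ∃ e : (((UniversalEnvelopingAlgebra ℂ L ⧸ 𝔍) ⊗[ℂ] W) ⧸ tensorRelations 𝔍 φ ψ) ≃ₗ[ℂ]
      (W ⧸ twistedRelations φ R ψ),
      ∀ w, e (Submodule.Quotient.mk (𝔍.mkQ 1 ⊗ₜ w)) = Submodule.Quotient.mk w := by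
  obtain ⟨Φ, hΦ1, hΦ⟩ := exists_equivariant hR hsup h𝔍 hψ
  let T := tensorRelations 𝔍 φ ψ
  have hT : ∀ x v w, (ι ℂ (φ x) • v) ⊗ₜ[ℂ] w + v ⊗ₜ[ℂ] ψ x w ∈ T := fun x v w =>
    Submodule.subset_span ⟨x, v, w, rfl⟩
  let f : W →ₗ[ℂ] _ ⧸ T := T.mkQ ∘ₗ TensorProduct.mk ℂ _ W (𝔍.mkQ 1)
  have hker : twistedRelations φ R ψ ≤ LinearMap.ker f := by
    rw [twistedRelations, Submodule.span_le]
    rintro _ ⟨x, s, w, hr, rfl⟩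
    refine (Submodule.Quotient.mk_eq_zero _).2 ?_
    have := hT x (𝔍.mkQ 1) w
    have e := ι_smul_mk_one (R := (R : Set (L × ℂ))) h𝔍 _ hr
    simp only at e
    rw [e] at this
    rw [TensorProduct.mk_apply, TensorProduct.tmul_add, TensorProduct.tmul_smul, add_comm,
      TensorProduct.smul_tmul']
    exact this
  -- Modulo the relations a factor φ x on v can be moved, with a sign, to w. Repeating this reduces
  -- v to the generator.
  have hsurj : ∀ v w, T.mkQ (v ⊗ₜ w) ∈ LinearMap.range f := by
    intro v
    let N : Submodule ℂ (UniversalEnvelopingAlgebra ℂ L ⧸ 𝔍) :=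
      { carrier := {v | ∀ w, T.mkQ (v ⊗ₜ w) ∈ LinearMap.range f}
        add_mem' := fun hv hv' w => by
          rw [TensorProduct.add_tmul, map_add]; exact add_mem (hv w) (hv' w)
        zero_mem' := fun w => by rw [TensorProduct.zero_tmul, map_zero]; exact zero_mem _
        smul_mem' := fun c v hv w => by
          rw [← TensorProduct.smul_tmul', map_smul]; exact Submodule.smul_mem _ _ (hv w) }
    refine mkQ_mem_span_of_sup hsup h𝔍 v N (fun w => ⟨w, rfl⟩) fun x v hv w => ?_
    have e : T.mkQ ((ι ℂ (φ x) • v) ⊗ₜ[ℂ] w) = -T.mkQ (v ⊗ₜ[ℂ] ψ x w) := by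
      rw [eq_neg_iff_add_eq_zero, ← map_add]
      exact (Submodule.Quotient.mk_eq_zero _).2 (hT x v w)
    rw [e]
    exact neg_mem (hv _)
  let f' := (twistedRelations φ R ψ).liftQ f hker
  let g' := T.liftQ Φ hΦ
  have hgf : g' ∘ₗ f' = LinearMap.id := by
    refine Submodule.linearMap_qext _ (LinearMap.ext fun w => ?_)
    exact hΦ1 w
  have hf' : Function.Surjective f' := by
    rw [← LinearMap.range_eq_top, eq_top_iff]
    rintro y -
    obtain ⟨y, rfl⟩ := T.mkQ_surjective y
    induction y with
    | zero => rw [map_zero]; exact zero_mem _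
    | add y z hy hz => rw [map_add]; exact add_mem hy hz
    | tmul v w =>
      obtain ⟨w', hw'⟩ := hsurj v w
      exact ⟨Submodule.Quotient.mk w', hw'⟩
  have hinj : Function.Injective f' :=
    Function.LeftInverse.injective (g := g') fun y => congrArg (fun h => h y) hgf
  refine ⟨(LinearEquiv.ofBijective f' ⟨hinj, hf'⟩).symm, fun w => ?_⟩
  rw [LinearEquiv.symm_apply_eq]
  rfl

end Frobenius

end UniversalEnvelopingAlgebra

end

/-! ## Poles of rational functions -/

noncomputable section

namespace VertexLieAlgebra

open DerivationAlgebra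
open scoped RatFunc LaurentSeries

section Poles

/-- The rational function `1 / (t - x) ^ (j + 1)`. -/
def poleRat (x : ℂ) (j : ℕ) : RatFunc ℂ := (1 / (RatFunc.X - RatFunc.C x)) ^ (j + 1)

lemma X_sub_C_ne (x : ℂ) : (RatFunc.X - RatFunc.C x : RatFunc ℂ) ≠ 0 := by
  rw [← RatFunc.algebraMap_X, ← RatFunc.algebraMap_C, ← map_sub]
  exact algebraMap_ne (Polynomial.X_sub_C_ne_zero x)

lemma poleRat_zero_mul_self (x : ℂ) (j : ℕ) : poleRat x 0 * poleRat x j = poleRat x (j + 1) := by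
  simp only [poleRat, zero_add, pow_one]
  rw [← pow_succ']

lemma poleRat_zero_mul_zero {x y : ℂ} (h : x ≠ y) :
    poleRat x 0 * poleRat y 0 = (x - y)⁻¹ • (poleRat x 0 - poleRat y 0) := by
  have h1 := X_sub_C_ne x
  have h2 := X_sub_C_ne y
  have h3 : (RatFunc.C x - RatFunc.C y : RatFunc ℂ) ≠ 0 := by
    exact sub_ne_zero.2 (RatFunc.C.injective.ne h)
  rw [RatFunc.smul_eq_C_mul, map_inv₀, map_sub]
  simp only [poleRat, zero_add, pow_one]
  field_simp
  ring

lemma poleRat_zero_mul_succ {x y : ℂ} (h : x ≠ y) (j : ℕ) :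
    poleRat x 0 * poleRat y (j + 1) =
      (x - y)⁻¹ • (poleRat x 0 * poleRat y j - poleRat y (j + 1)) := by
  rw [← poleRat_zero_mul_self y j, ← mul_assoc, poleRat_zero_mul_zero h, smul_mul_assoc, sub_mul]

lemma poleRat_succ_mul (x : ℂ) (j : ℕ) (f : RatFunc ℂ) :
    poleRat x (j + 1) * f = poleRat x 0 * (poleRat x j * f) := by
  rw [← poleRat_zero_mul_self, mul_assoc]

/-- The span of the functions `1 / (t - x) ^ (j + 1)`, for `x ∈ S`. -/
def poleSpan (S : Set ℂ) : Submodule ℂ (RatFunc ℂ) :=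
  Submodule.span ℂ {f | ∃ x ∈ S, ∃ j, f = poleRat x j}

/-- The span of the functions `1 / (t - x) ^ (j + 2)` and `1 / (t - x) - 1 / (t - y)`,
for `x, y ∈ S`. -/
def regularSpan (S : Set ℂ) : Submodule ℂ (RatFunc ℂ) :=
  Submodule.span ℂ ({f | ∃ x ∈ S, ∃ j, f = poleRat x (j + 1)} ∪
    {f | ∃ x ∈ S, ∃ y ∈ S, f = poleRat x 0 - poleRat y 0})

lemma poleRat_mem_poleSpan {S : Set ℂ} {x : ℂ} (hx : x ∈ S) (j : ℕ) :
    poleRat x j ∈ poleSpan S := Submodule.subset_span ⟨x, hx, j, rfl⟩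

lemma regularSpan_le_poleSpan (S : Set ℂ) : regularSpan S ≤ poleSpan S := by
  rw [regularSpan, Submodule.span_le]
  rintro _ (⟨x, hx, j, rfl⟩ | ⟨x, hx, y, hy, rfl⟩)
  · exact poleRat_mem_poleSpan hx _
  · exact sub_mem (poleRat_mem_poleSpan hx _) (poleRat_mem_poleSpan hy _)

lemma poleRat_zero_mul_poleRat_mem {S : Set ℂ} {x y : ℂ} (hx : x ∈ S) (hy : y ∈ S) (j : ℕ) :
    poleRat x 0 * poleRat y j ∈ regularSpan S := by
  by_cases h : x = y
  · subst h
    rw [poleRat_zero_mul_self]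
    exact Submodule.subset_span (Or.inl ⟨x, hx, j, rfl⟩)
  · induction j with
    | zero =>
      rw [poleRat_zero_mul_zero h]
      exact Submodule.smul_mem _ _ (Submodule.subset_span (Or.inr ⟨x, hx, y, hy, rfl⟩))
    | succ j ih =>
      rw [poleRat_zero_mul_succ h]
      exact Submodule.smul_mem _ _ (sub_mem ih (Submodule.subset_span (Or.inl ⟨y, hy, j, rfl⟩)))

lemma poleRat_zero_mul_mem {S : Set ℂ} {x : ℂ} (hx : x ∈ S) {f : RatFunc ℂ}
    (hf : f ∈ poleSpan S) : poleRat x 0 * f ∈ regularSpan S := by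
  induction hf using Submodule.span_induction with
  | mem f hf =>
    obtain ⟨y, hy, j, rfl⟩ := hf
    exact poleRat_zero_mul_poleRat_mem hx hy j
  | zero => rw [mul_zero]; exact zero_mem _
  | add f g _ _ hf hg => rw [mul_add]; exact add_mem hf hg
  | smul c f _ hf => rw [mul_smul_comm]; exact Submodule.smul_mem _ _ hf

/-- A product of two functions that vanish at infinity is O(t⁻²), so its residues add up to zero.
`regularSpan` consists of the partial fractions with this property. -/
lemma mul_mem_regularSpan {S : Set ℂ} {f g : RatFunc ℂ} (hf : f ∈ poleSpan S)
    (hg : g ∈ poleSpan S) : f * g ∈ regularSpan S := by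
  induction hf using Submodule.span_induction with
  | mem f hf =>
    obtain ⟨x, hx, j, rfl⟩ := hf
    induction j with
    | zero => exact poleRat_zero_mul_mem hx hg
    | succ j ih =>
      rw [poleRat_succ_mul]
      exact poleRat_zero_mul_mem hx (regularSpan_le_poleSpan S ih)
  | zero => rw [zero_mul]; exact zero_mem _
  | add f f' _ _ hf hf' => rw [add_mul]; exact add_mem hf hf'
  | smul c f _ hf => rw [smul_mul_assoc]; exact Submodule.smul_mem _ _ hf

open Polynomial in
-- Induction on the multiset of roots of the denominator. With q the product of the remaining
-- factors and p = c q + r, one has p / ((t - x) q) = c / (t - x) + (1 / (t - x)) (r / q), and r / q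
-- is covered by induction.
lemma div_prod_mem_poleSpan {S : Set ℂ} (s : Multiset ℂ) (hs : ∀ x ∈ s, x ∈ S) (p : ℂ[X])
    (hp : p.degree < s.card) :
    algebraMap ℂ[X] (RatFunc ℂ) p / algebraMap ℂ[X] (RatFunc ℂ)
      (s.map fun a => Polynomial.X - C a).prod ∈ poleSpan S := by
  induction s using Multiset.induction generalizing p with
  | empty =>
    have : p = 0 := by
      rw [← degree_eq_bot, ← Nat.WithBot.lt_zero_iff]
      simpa using hp
    rw [this, map_zero, zero_div]
    exact zero_mem _
  | cons x s ih =>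
    set q := (s.map fun a => Polynomial.X - C a).prod with hq
    have hqm : q.Monic := monic_multisetProd_X_sub_C s
    have hqd : q.natDegree = s.card := natDegree_multiset_prod_X_sub_C_eq_card s
    have hr : (p %ₘ q).degree < s.card := by
      rw [← hqd, ← degree_eq_natDegree hqm.ne_zero]
      exact degree_modByMonic_lt p hqm
    have hpn : p.natDegree ≤ s.card := by
      by_cases h0 : p = 0
      · simp [h0]
      · rw [Multiset.card_cons, degree_eq_natDegree h0] at hp
        exact Nat.lt_succ_iff.1 (by exact_mod_cast hp)
    -- The bound on the degree of p with one more factor gives deg p ≤ deg q, so the quotient is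
    -- constant.
    have hc : p /ₘ q = C ((p /ₘ q).coeff 0) := by
      refine eq_C_of_natDegree_eq_zero ?_
      rw [natDegree_divByMonic p hqm, hqd, Nat.sub_eq_zero_of_le hpn]
    have h1 := X_sub_C_ne x
    have h2 := algebraMap_ne hqm.ne_zero
    have hX := hs x (Multiset.mem_cons_self x s)
    have e : algebraMap ℂ[X] (RatFunc ℂ) p / algebraMap ℂ[X] (RatFunc ℂ)
        ((x ::ₘ s).map fun a => Polynomial.X - C a).prod =
        (p /ₘ q).coeff 0 • poleRat x 0 + poleRat x 0 *
          (algebraMap ℂ[X] (RatFunc ℂ) (p %ₘ q) / algebraMap ℂ[X] (RatFunc ℂ) q) := by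
      rw [Multiset.map_cons, Multiset.prod_cons, ← hq]
      nth_rewrite 1 [← modByMonic_add_div p q]
      rw [hc]
      simp only [map_mul, map_add, map_sub, RatFunc.algebraMap_X, RatFunc.algebraMap_C,
        RatFunc.smul_eq_C_mul, poleRat, coeff_C_zero, zero_add, pow_one]
      generalize RatFunc.X - RatFunc.C x = a at *
      field_simp
      ring
    rw [e]
    exact add_mem (Submodule.smul_mem _ _ (poleRat_mem_poleSpan hX 0))
      (regularSpan_le_poleSpan S (poleRat_zero_mul_mem hX
        (ih (fun y hy => hs y (Multiset.mem_cons_of_mem hy)) _ hr)))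

/-- Partial fraction decomposition. -/
lemma mem_poleSpan {S : Set ℂ} {f : RatFunc ℂ} (hf : f ∈ ratVanishing S) : f ∈ poleSpan S := by
  have hm := RatFunc.monic_denom f
  have e := (IsAlgClosed.splits f.denom).eq_prod_roots_of_monic hm
  rw [← RatFunc.num_div_denom f, e]
  refine div_prod_mem_poleSpan _ (fun x hx => ?_) _ ?_
  · by_contra hxS
    exact hf.1 x hxS (Polynomial.isRoot_of_mem_roots hx)
  · have h := hf.2
    rwa [e, Polynomial.degree_eq_natDegree (Polynomial.monic_multisetProd_X_sub_C _).ne_zero,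
      Polynomial.natDegree_multiset_prod_X_sub_C_eq_card] at h

/-- The function `1 / (t - x) ^ (j + 1)`, for `x ∈ S`. -/
def pole {S : Set ℂ} (x : ℂ) (hx : x ∈ S) (j : ℕ) : ratVanishing S :=
  ⟨poleRat x j, by
    induction j with
    | zero =>
      rw [poleRat, zero_add, pow_one]
      exact (simplePole x hx).2
    | succ j ih =>
      rw [← poleRat_zero_mul_self]
      refine mul_mem ?_ ih
      rw [poleRat, zero_add, pow_one]
      exact (simplePole x hx).2⟩

lemma pole_zero {S : Set ℂ} (x : ℂ) (hx : x ∈ S) : pole x hx 0 = simplePole x hx :=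
  Subtype.ext (pow_one _)

lemma ratVanishing_induction {S : Set ℂ} {p : ratVanishing S → Prop}
    (pole : ∀ x (hx : x ∈ S) j, p (pole x hx j)) (zero : p 0)
    (add : ∀ f g, p f → p g → p (f + g)) (smul : ∀ (c : ℂ) f, p f → p (c • f))
    (f : ratVanishing S) : p f := by
  -- The predicate lives on the subtype while the span lives in the field of rational functions, so
  -- the membership proof is carried along.
  have h : ∀ f ∈ poleSpan S, ∃ hf : f ∈ ratVanishing S, p ⟨f, hf⟩ := by
    intro f hf
    induction hf using Submodule.span_induction with
    | mem f hf =>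
      obtain ⟨x, hx, j, rfl⟩ := hf
      exact ⟨_, pole x hx j⟩
    | zero => exact ⟨_, zero⟩
    | add f g _ _ hf hg =>
      obtain ⟨⟨_, hf⟩, ⟨_, hg⟩⟩ := And.intro hf hg
      exact ⟨_, add _ _ hf hg⟩
    | smul c f _ hf =>
      obtain ⟨_, hf⟩ := hf
      exact ⟨_, smul c _ hf⟩
  exact (h _ (mem_poleSpan f.2)).2

/-- Simple poles enter only through differences. This is how the vanishing of the residue sum of a
product reaches the central terms. -/
lemma mul_induction {S : Set ℂ} {p : ratVanishing S → Prop}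
    (pole : ∀ x (hx : x ∈ S) j, p (pole x hx (j + 1)))
    (sub : ∀ x (hx : x ∈ S) y (hy : y ∈ S), p (simplePole x hx - simplePole y hy)) (zero : p 0)
    (add : ∀ f g, p f → p g → p (f + g)) (smul : ∀ (c : ℂ) f, p f → p (c • f))
    (f g : ratVanishing S) : p (f * g) := by
  have h : ∀ f ∈ regularSpan S, ∃ hf : f ∈ ratVanishing S, p ⟨f, hf⟩ := by
    intro f hf
    induction hf using Submodule.span_induction with
    | mem f hf =>
      obtain (⟨x, hx, j, rfl⟩ | ⟨x, hx, y, hy, rfl⟩) := hf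
      · exact ⟨_, pole x hx j⟩
      · have := sub x hx y hy
        rw [← pole_zero, ← pole_zero] at this
        exact ⟨_, this⟩
    | zero => exact ⟨_, zero⟩
    | add f g _ _ hf hg =>
      obtain ⟨⟨_, hf⟩, ⟨_, hg⟩⟩ := And.intro hf hg
      exact ⟨_, add _ _ hf hg⟩
    | smul c f _ hf =>
      obtain ⟨_, hf⟩ := hf
      exact ⟨_, smul c _ hf⟩
  exact (h _ (mul_mem_regularSpan (mem_poleSpan f.2) (mem_poleSpan g.2))).2

lemma derivRat_poleRat_zero (x : ℂ) : derivRat (poleRat x 0) = -poleRat x 1 := by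
  have h := derivRat_div 1 (Polynomial.X - Polynomial.C x) (Polynomial.X_sub_C_ne_zero x)
  simp only [map_one, Polynomial.derivative_one, map_zero, zero_mul, map_sub,
    Polynomial.derivative_X, Polynomial.derivative_C, sub_zero, one_mul, zero_sub,
    RatFunc.algebraMap_X, RatFunc.algebraMap_C] at h
  simp only [poleRat, zero_add, pow_one]
  rw [h]
  simp [div_eq_mul_inv]

lemma derivRat_poleRat (x : ℂ) (j : ℕ) :
    derivRat (poleRat x j) = -((j + 1 : ℕ) : ℂ) • poleRat x (j + 1) := by
  induction j with
  | zero => rw [derivRat_poleRat_zero]; simp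
  | succ j ih =>
    have h : derivRat (poleRat x 0 * poleRat x j) = _ := derivRatFun_mul _ _
    rw [← poleRat_zero_mul_self, h]
    change derivRat _ * _ + _ * derivRat _ = _
    rw [ih, derivRat_poleRat_zero, mul_smul_comm, poleRat_zero_mul_self, neg_mul,
      poleRat_succ_mul x 0, poleRat_zero_mul_self, poleRat_zero_mul_self]
    rw [show ((j + 1 + 1 : ℕ) : ℂ) = 1 + ((j + 1 : ℕ) : ℂ) by push_cast; ring, neg_add, add_smul,
      neg_one_smul]

lemma δ_pole {S : Set ℂ} (x : ℂ) (hx : x ∈ S) (j : ℕ) :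
    δ (pole x hx j) = -((j + 1 : ℕ) : ℂ) • pole x hx (j + 1) :=
  Subtype.ext (derivRat_poleRat x j)

end Poles

/-! ### Laurent expansions of partial fractions. -/

section Expansion

open HahnSeries

lemma laurentExp_poleRat_self (x : ℂ) (j : ℕ) :
    laurentExp x (poleRat x j) = single (-((j : ℤ) + 1)) 1 := by
  rw [poleRat, map_pow, map_div₀, map_sub, map_one, laurentExp_X, laurentExp_C,
    add_sub_cancel_right, one_div, HahnSeries.inv_single, inv_one, HahnSeries.single_pow, one_pow]
  congr 1
  simp

lemma exists_laurentExp_poleRat {z x : ℂ} (h : z ≠ x) (j : ℕ) :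
    ∃ g : PowerSeries ℂ, laurentExp z (poleRat x j) = ofPowerSeries ℤ ℂ g := by
  refine ⟨(PowerSeries.X + PowerSeries.C (z - x))⁻¹ ^ (j + 1), ?_⟩
  have h0 : PowerSeries.constantCoeff (PowerSeries.X + PowerSeries.C (z - x)) ≠ 0 := by
    simpa [sub_eq_zero] using h
  have h1 := congrArg (HahnSeries.ofPowerSeries ℤ ℂ) (PowerSeries.mul_inv_cancel _ h0)
  rw [map_mul, map_one, map_add, HahnSeries.ofPowerSeries_X, HahnSeries.ofPowerSeries_C] at h1
  rw [poleRat, map_pow, map_pow, map_div₀, map_sub, map_one, laurentExp_X, laurentExp_C,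
    add_sub_assoc, ← map_sub]
  rw [eq_one_div_of_mul_eq_one_right h1]

lemma exists_laurentExp {S : Set ℂ} {z : ℂ} (hz : z ∉ S) (f : ratVanishing S) :
    ∃ g : PowerSeries ℂ, laurentExp z f.1 = ofPowerSeries ℤ ℂ g := by
  induction f using ratVanishing_induction with
  | pole x hx j => exact exists_laurentExp_poleRat (by rintro rfl; exact hz hx) j
  | zero => exact ⟨0, by rw [map_zero]; exact map_zero _⟩
  | add f f' hf hf' =>
    obtain ⟨⟨g, hg⟩, ⟨g', hg'⟩⟩ := And.intro hf hf'
    refine ⟨g + g', ?_⟩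
    rw [map_add, ← hg, ← hg', ← map_add]; rfl
  | smul c f hf =>
    obtain ⟨g, hg⟩ := hf
    refine ⟨PowerSeries.C c * g, ?_⟩
    rw [map_mul, ← hg, ofPowerSeries_C, C_mul_eq_smul, ← laurentExp_smul]; rfl

open Polynomial in
-- At t = z + s the function f(c t) is f(c z + c s), which is the expansion of f at c z with s
-- rescaled. The case of nonzero z serves to compare expansions along one Γ-orbit.
lemma laurentExp_scaleRat_eq (z c : ℂ) (hc : c ≠ 0) (f : RatFunc ℂ) :
    laurentExp z (scaleRat c hc f) = scaleLaurent c (laurentExp (c * z) f) := by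
  have hpoly : ∀ p : ℂ[X], laurentExp z (algebraMap ℂ[X] (RatFunc ℂ)
      (p.comp (C c * Polynomial.X))) =
      scaleLaurent c (laurentExp (c * z) (algebraMap ℂ[X] (RatFunc ℂ) p)) := by
    intro p
    induction p using Polynomial.induction_on with
    | C a =>
      rw [C_comp, RatFunc.algebraMap_C, laurentExp_C, laurentExp_C, HahnSeries.C_apply,
        scaleLaurent_single]
      simp
    | add p q hp hq => simp only [add_comp, map_add, hp, hq]
    | monomial n a ih =>
      rw [pow_succ, ← mul_assoc]
      generalize C a * Polynomial.X ^ n = p at *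
      rw [mul_comp, map_mul, map_mul, ih, map_mul, map_mul, scaleLaurent_mul c hc, X_comp,
        map_mul, map_mul, RatFunc.algebraMap_C, RatFunc.algebraMap_X, laurentExp_C, laurentExp_X,
        laurentExp_X, map_add, scaleLaurent_single, HahnSeries.C_apply, HahnSeries.C_apply,
        HahnSeries.C_apply, scaleLaurent_single, mul_add, HahnSeries.single_mul_single,
        HahnSeries.single_mul_single]
      simp
  obtain ⟨p, q, hq, rfl⟩ := exists_div f
  have h0 : laurentExp (c * z) (algebraMap ℂ[X] (RatFunc ℂ) q) ≠ 0 := by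
    rw [Ne, map_eq_zero]
    exact algebraMap_ne hq
  have hd : q.comp (C c * Polynomial.X) ≠ 0 := fun h => by
    have := scale_comap c hc (mem_nonZeroDivisors_iff_ne_zero.2 hq)
    rw [Submonoid.mem_comap, ← comp_eq_aeval, h] at this
    exact absurd rfl (mem_nonZeroDivisors_iff_ne_zero.1 this)
  have h1 : laurentExp z (algebraMap ℂ[X] (RatFunc ℂ) (q.comp (C c * Polynomial.X))) ≠ 0 := by
    rw [Ne, map_eq_zero]
    exact algebraMap_ne hd
  rw [scaleRat_div, map_div₀, div_eq_iff h1, hpoly, hpoly, ← scaleLaurent_mul c hc, ← map_mul,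
    div_mul_cancel₀ _ (algebraMap_ne hq)]

lemma exists_scaleLaurent_ofPowerSeries (c : ℂ) (f : PowerSeries ℂ) :
    ∃ g : PowerSeries ℂ, scaleLaurent c (ofPowerSeries ℤ ℂ f) = ofPowerSeries ℤ ℂ g := by
  refine ⟨PowerSeries.mk fun n => c ^ n * PowerSeries.coeff n f, ?_⟩
  ext n
  rw [scaleLaurent_coeff, PowerSeries.coeff_coe, PowerSeries.coeff_coe]
  split_ifs with h
  · rw [mul_zero]
  · rw [PowerSeries.coeff_mk]
    congr 1
    obtain ⟨m, rfl⟩ := Int.eq_ofNat_of_zero_le (not_lt.1 h)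
    simp

/-- Induction on the pole order of Laurent series. -/
lemma laurent_induction {p : ℂ⸨X⸩ → Prop} (powerSeries : ∀ g, p (ofPowerSeries ℤ ℂ g))
    (single : ∀ j : ℕ, p (single (-((j : ℤ) + 1)) 1))
    (add : ∀ f g, p f → p g → p (f + g)) (smul : ∀ (c : ℂ) f, p f → p (c • f))
    (f : ℂ⸨X⸩) : p f := by
  -- Here n bounds the order of the pole; the inductive step subtracts the term of lowest degree.
  suffices h : ∀ (n : ℕ) (f : ℂ⸨X⸩), (∀ m : ℤ, m < -(n : ℤ) → f.coeff m = 0) → p f by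
    refine h f.order.natAbs f fun m hm => ?_
    exact coeff_eq_zero_of_lt_order (by omega)
  intro n
  induction n with
  | zero =>
    intro f hf
    have e : f = ofPowerSeries ℤ ℂ (PowerSeries.mk fun n => f.coeff n) := by
      ext m
      rw [PowerSeries.coeff_coe]
      split_ifs with h
      · exact hf m (by simpa using h)
      · rw [PowerSeries.coeff_mk]
        congr 1
        omega
    rw [e]
    exact powerSeries _
  | succ n ih =>
    intro f hf
    have e : f = (f - f.coeff (-((n : ℤ) + 1)) • HahnSeries.single (-((n : ℤ) + 1)) (1 : ℂ)) +
        f.coeff (-((n : ℤ) + 1)) • HahnSeries.single (-((n : ℤ) + 1)) (1 : ℂ) := by simp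
    rw [e]
    refine add _ _ (ih _ fun m hm => ?_) (smul _ _ (single n))
    rw [coeff_sub, HahnSeries.coeff_smul]
    by_cases h : m = -((n : ℤ) + 1)
    · subst h; simp
    · rw [coeff_single_of_ne h, smul_zero, sub_zero]
      exact hf m (by push_cast; omega)

end Expansion

/-! ### Enlarging the set of allowed poles. -/

section Inclusion

/-- Rational functions with poles in `S` have poles in every larger set. -/
def inclusion {S S' : Set ℂ} (h : S ⊆ S') : ratVanishing S →ₗ[ℂ] ratVanishing S' where
  toFun f := ⟨f.1, fun x hx => f.2.1 x fun hx' => hx (h hx'), f.2.2⟩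
  map_add' _ _ := rfl
  map_smul' _ _ := rfl

lemma inclusion_δ {S S' : Set ℂ} (h : S ⊆ S') (f : ratVanishing S) :
    inclusion h (δ f) = δ (inclusion h f) := rfl

/-- Without any pole the denominator is constant, and vanishing at infinity then forces the
numerator to be zero. -/
lemma eq_zero_of_mem_of_mem {S S' : Set ℂ} (h : Disjoint S S') {f : RatFunc ℂ}
    (hf : f ∈ ratVanishing S) (hf' : f ∈ ratVanishing S') : f = 0 := by
  have h0 : f.denom.degree = 0 := by
    by_contra hd
    obtain ⟨x, hx⟩ := IsAlgClosed.exists_root f.denom hd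
    by_cases hxS : x ∈ S
    · exact hf'.1 x (Set.disjoint_left.1 h hxS) hx
    · exact hf.1 x hxS hx
  have h1 := hf.2
  rw [h0, Nat.WithBot.lt_zero_iff, Polynomial.degree_eq_bot, RatFunc.num_eq_zero_iff] at h1
  exact h1

/-- Partial fractions split the functions into those with poles in S and those with poles in S' \ S.
Differentiation preserves both summands, so the projection that forgets the second kind commutes
with it and descends to Lie_A. -/
lemma exists_retraction {S S' : Set ℂ} (h : S ⊆ S') :
    ∃ r : ratVanishing S' →ₗ[ℂ] ratVanishing S,
      (∀ f, r (inclusion h f) = f) ∧ ∀ f, r (δ f) = δ (r f) := by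
  let i := inclusion h
  let i' := inclusion (Set.sdiff_subset : S' \ S ⊆ S')
  have hinj : Function.Injective i := fun f g hfg =>
    Subtype.ext (congrArg (fun k : ratVanishing S' => k.1) hfg :)
  have hc : IsCompl (LinearMap.range i) (LinearMap.range i') := by
    refine ⟨?_, ?_⟩
    · rw [Submodule.disjoint_def]
      rintro f ⟨g, rfl⟩ ⟨g', hg'⟩
      have e : g'.1 = g.1 := congrArg Subtype.val hg'
      have := eq_zero_of_mem_of_mem Set.disjoint_sdiff_right g.2 (e ▸ g'.2)
      exact Subtype.ext this
    · rw [codisjoint_iff, eq_top_iff]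
      rintro f -
      induction f using ratVanishing_induction with
      | pole x hx j =>
        by_cases hxS : x ∈ S
        · exact Submodule.mem_sup_left ⟨pole x hxS j, rfl⟩
        · exact Submodule.mem_sup_right ⟨pole x ⟨hx, hxS⟩ j, rfl⟩
      | zero => exact zero_mem _
      | add f g hf hg => exact add_mem hf hg
      | smul c f hf => exact Submodule.smul_mem _ _ hf
  have hl : ∀ f, ∃ g g', f = i g + i' g' := fun f => by
    have hf : f ∈ LinearMap.range i ⊔ LinearMap.range i' := by
      rw [codisjoint_iff.1 hc.2]; trivial
    obtain ⟨_, ⟨g, rfl⟩, _, ⟨g', rfl⟩, rfl⟩ := Submodule.mem_sup.1 hf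
    exact ⟨g, g', rfl⟩
  let r : ratVanishing S' →ₗ[ℂ] ratVanishing S :=
    (LinearEquiv.ofInjective i hinj).symm.toLinearMap ∘ₗ Submodule.projectionOnto _ _ hc
  have hr : ∀ g, r (i g) = g := fun g => by
    have : Submodule.projectionOnto _ _ hc (i g) = LinearEquiv.ofInjective i hinj g :=
      Submodule.projectionOnto_apply_left hc (LinearEquiv.ofInjective i hinj g)
    show (LinearEquiv.ofInjective i hinj).symm (Submodule.projectionOnto _ _ hc (i g)) = g
    rw [this, LinearEquiv.symm_apply_apply]
  have hr' : ∀ g, r (i' g) = 0 := fun g => by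
    have : Submodule.projectionOnto _ _ hc (i' g) = 0 :=
      Submodule.projectionOnto_apply_right hc ⟨i' g, g, rfl⟩
    show (LinearEquiv.ofInjective i hinj).symm (Submodule.projectionOnto _ _ hc (i' g)) = 0
    rw [this]
    exact (LinearEquiv.ofInjective i hinj).symm.map_zero
  refine ⟨r, hr, fun f => ?_⟩
  obtain ⟨g, g', rfl⟩ := hl f
  rw [map_add, map_add, map_add, ← inclusion_δ, ← inclusion_δ, hr, hr', hr, hr', add_zero, add_zero]

end Inclusion

end VertexLieAlgebra

end

/-! ## Complements of the image of the translation operator -/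

noncomputable section

namespace VertexLieAlgebra

variable {𝓛 : Type*} [AddCommGroup 𝓛] [Module ℂ 𝓛] [VertexLieAlgebra 𝓛]

variable (𝓛) in
/-- The projection to the homogeneous component of degree `n`. -/
def grProj (n : ℕ) : 𝓛 →ₗ[ℂ] 𝓛 :=
  (gr (𝓛 := 𝓛) n).subtype ∘ₗ DirectSum.component ℂ ℕ (fun n => gr (𝓛 := 𝓛) n) n ∘ₗ
    (LinearEquiv.ofBijective (DirectSum.coeLinearMap (gr (𝓛 := 𝓛)))
      gr_internal).symm.toLinearMap

lemma grProj_mem (n : ℕ) (a : 𝓛) : grProj 𝓛 n a ∈ gr (𝓛 := 𝓛) n := Subtype.mem _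

lemma equiv_symm_of_mem {m : ℕ} {a : 𝓛} (ha : a ∈ gr (𝓛 := 𝓛) m) :
    (LinearEquiv.ofBijective (DirectSum.coeLinearMap (gr (𝓛 := 𝓛))) gr_internal).symm a =
      DirectSum.lof ℂ ℕ (fun n => gr (𝓛 := 𝓛) n) m ⟨a, ha⟩ := by
  rw [LinearEquiv.symm_apply_eq]
  exact (DirectSum.coeLinearMap_lof (gr (𝓛 := 𝓛)) m ⟨a, ha⟩).symm

lemma grProj_of_mem {n : ℕ} {a : 𝓛} (ha : a ∈ gr (𝓛 := 𝓛) n) : grProj 𝓛 n a = a := by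
  rw [grProj, LinearMap.comp_apply, LinearMap.comp_apply, LinearEquiv.coe_coe,
    equiv_symm_of_mem ha, DirectSum.component.lof_self]
  rfl

lemma grProj_of_mem_ne {n m : ℕ} (h : m ≠ n) {a : 𝓛} (ha : a ∈ gr (𝓛 := 𝓛) m) :
    grProj 𝓛 n a = 0 := by
  rw [grProj, LinearMap.comp_apply, LinearMap.comp_apply, LinearEquiv.coe_coe,
    equiv_symm_of_mem ha, DirectSum.component.of, dif_neg h, map_zero]

lemma grProj_succ_D (n : ℕ) (a : 𝓛) : grProj 𝓛 (n + 1) (D a) = D (grProj 𝓛 n a) := by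
  induction a using gr_induction with
  | mem m a ha =>
    by_cases h : m = n
    · subst h
      rw [grProj_of_mem ha, grProj_of_mem (D_mem m a ha)]
    · rw [grProj_of_mem_ne h ha, grProj_of_mem_ne (by omega) (D_mem m a ha), map_zero]
  | add a b ha hb => simp only [map_add, ha, hb]

lemma grProj_zero_D (a : 𝓛) : grProj 𝓛 0 (D a) = 0 := by
  induction a using gr_induction with
  | mem m a ha => exact grProj_of_mem_ne (by omega) (D_mem m a ha)
  | add a b ha hb => rw [map_add, map_add, ha, hb, add_zero]

lemma grProj_mem_of_graded {Lo : Submodule ℂ 𝓛} (h : Lo ≤ ⨆ n, Lo ⊓ gr (𝓛 := 𝓛) n) (n : ℕ)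
    {a : 𝓛} (ha : a ∈ Lo) : grProj 𝓛 n a ∈ Lo := by
  refine Submodule.iSup_induction _ (motive := fun a => grProj 𝓛 n a ∈ Lo) (h ha)
    (fun m a ha => ?_) (by rw [map_zero]; exact zero_mem _)
    (fun a b ha hb => by rw [map_add]; exact add_mem ha hb)
  by_cases hm : m = n
  · subst hm
    rw [grProj_of_mem ha.2]
    exact ha.1
  · rw [grProj_of_mem_ne hm ha.2]
    exact zero_mem _

/-- Since D c = 0, the translation axiom at n + 1 gives (n + 1) c_(n) b = 0. Hence the classes of c
⊗ f are central. -/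
lemma nprod_cent_left (n : ℕ) (b : 𝓛) : nprod n (cent : 𝓛) b = 0 := by
  have h := translation (n + 1) (cent : 𝓛) b
  rw [D_cent, map_zero, LinearMap.zero_apply, Nat.add_sub_cancel, eq_comm, neg_eq_zero] at h
  exact (smul_eq_zero.1 h).resolve_left (by exact_mod_cast Nat.succ_ne_zero n)

end VertexLieAlgebra

open VertexLieAlgebra DerivationAlgebra
open scoped LaurentSeries

namespace CyclotomicDatum

variable {𝓛 : Type*} [AddCommGroup 𝓛] [Module ℂ 𝓛] [VertexLieAlgebra 𝓛] {T : ℕ}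
variable {G : CyclotomicDatum 𝓛 T} {Lo : Submodule ℂ 𝓛} (hLo : G.IsAdmissible Lo)

include hLo in
-- Induction on the degree. A homogeneous a = o + r c + D x is replaced by its homogeneous
-- components: Lo is graded, c has degree 0, and the component of D x is D of a component of degree
-- one less, or zero in degree 0.
lemma IsAdmissible.eq_top {N : Submodule ℂ 𝓛} (h : Lo ≤ N) (hc : cent ∈ N)
    (hD : ∀ a ∈ N, D a ∈ N) : N = ⊤ := by
  have hgr : ∀ n, ∀ a ∈ gr (𝓛 := 𝓛) n, a ∈ N := by
    intro n
    induction n with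
    | zero =>
      intro a ha
      have hmem : a ∈ Lo ⊔ (Submodule.span ℂ {(cent : 𝓛)} ⊔ LinearMap.range (D (𝓛 := 𝓛))) := by
        rw [codisjoint_iff.1 hLo.isCompl.2]; trivial
      obtain ⟨o, ho, y, hy, rfl⟩ := Submodule.mem_sup.1 hmem
      obtain ⟨c, hc', _, ⟨x, rfl⟩, rfl⟩ := Submodule.mem_sup.1 hy
      obtain ⟨r, rfl⟩ := Submodule.mem_span_singleton.1 hc'
      rw [← grProj_of_mem ha, map_add, map_add, grProj_zero_D, add_zero, map_smul,
        grProj_of_mem cent_mem]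
      exact add_mem (h (grProj_mem_of_graded hLo.graded 0 ho)) (Submodule.smul_mem _ _ hc)
    | succ n ih =>
      intro a ha
      have hmem : a ∈ Lo ⊔ (Submodule.span ℂ {(cent : 𝓛)} ⊔ LinearMap.range (D (𝓛 := 𝓛))) := by
        rw [codisjoint_iff.1 hLo.isCompl.2]; trivial
      obtain ⟨o, ho, y, hy, rfl⟩ := Submodule.mem_sup.1 hmem
      obtain ⟨c, hc', _, ⟨x, rfl⟩, rfl⟩ := Submodule.mem_sup.1 hy
      obtain ⟨r, rfl⟩ := Submodule.mem_span_singleton.1 hc'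
      rw [← grProj_of_mem ha, map_add, map_add, grProj_succ_D, map_smul,
        grProj_of_mem_ne (Nat.succ_ne_zero n).symm cent_mem, smul_zero, zero_add]
      exact add_mem (h (grProj_mem_of_graded hLo.graded _ ho))
        (hD _ (ih _ (grProj_mem n x)))
  rw [eq_top_iff]
  rintro a -
  induction a using gr_induction with
  | mem n a ha => exact hgr n a ha
  | add a b ha hb => exact add_mem ha hb

/-- The smallest subspace containing `Lo` and stable under the translation operator. -/
def translates (Lo : Submodule ℂ 𝓛) : Submodule ℂ 𝓛 :=
  Submodule.span ℂ {x | ∃ (k : ℕ), ∃ a ∈ Lo, x = (D ^ k : 𝓛 →ₗ[ℂ] 𝓛) a}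

lemma D_pow_mem_translates (k : ℕ) {a : 𝓛} (ha : a ∈ Lo) :
    (D ^ k : 𝓛 →ₗ[ℂ] 𝓛) a ∈ translates Lo := Submodule.subset_span ⟨k, a, ha, rfl⟩

lemma le_translates : Lo ≤ translates Lo := fun _ ha => D_pow_mem_translates 0 ha

lemma D_mem_translates {a : 𝓛} (ha : a ∈ translates Lo) : D a ∈ translates Lo := by
  induction ha using Submodule.span_induction with
  | mem x hx =>
    obtain ⟨k, a, ha, rfl⟩ := hx
    rw [← Module.End.mul_apply, ← pow_succ']
    exact D_pow_mem_translates _ ha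
  | zero => rw [map_zero]; exact zero_mem _
  | add x y _ _ hx hy => rw [map_add]; exact add_mem hx hy
  | smul c x _ hx => rw [map_smul]; exact Submodule.smul_mem _ _ hx

include hLo in
lemma IsAdmissible.exists_translates (a : 𝓛) :
    ∃ e ∈ translates Lo, ∃ r : ℂ, a = e + r • cent := by
  have h : translates Lo ⊔ Submodule.span ℂ {(cent : 𝓛)} = ⊤ := by
    refine hLo.eq_top (le_translates.trans le_sup_left)
      (Submodule.mem_sup_right (Submodule.mem_span_singleton_self _)) fun a ha => ?_
    obtain ⟨e, he, c, hc, rfl⟩ := Submodule.mem_sup.1 ha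
    obtain ⟨r, rfl⟩ := Submodule.mem_span_singleton.1 hc
    rw [map_add, map_smul, D_cent, smul_zero, add_zero]
    exact Submodule.mem_sup_left (D_mem_translates he)
  have ha : a ∈ translates Lo ⊔ Submodule.span ℂ {(cent : 𝓛)} := by rw [h]; trivial
  obtain ⟨e, he, c, hc, rfl⟩ := Submodule.mem_sup.1 ha
  obtain ⟨r, rfl⟩ := Submodule.mem_span_singleton.1 hc
  exact ⟨e, he, r, rfl⟩

include hLo in
-- The multiple of c by which an element can miss `translates Lo` is killed by D, so all of Im D
-- lies in `translates Lo`.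
lemma IsAdmissible.D_mem (a : 𝓛) : D a ∈ translates Lo := by
  obtain ⟨e, he, r, rfl⟩ := hLo.exists_translates a
  rw [map_add, map_smul, D_cent, smul_zero, add_zero]
  exact D_mem_translates he

include hLo in
-- Lo is only assumed stable up to Im D. The error term is absorbed in `translates Lo`, which is
-- therefore genuinely stable and replaces Lo in the sequel.
lemma IsAdmissible.σ_mem {a : 𝓛} (ha : a ∈ translates Lo) : G.σ a ∈ translates Lo := by
  induction ha using Submodule.span_induction with
  | mem x hx =>
    obtain ⟨k, a, ha, rfl⟩ := hx
    induction k with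
    | zero =>
      obtain ⟨o, ho, _, ⟨x, rfl⟩, e⟩ := Submodule.mem_sup.1 (hLo.stable a ha)
      show G.σ a ∈ _
      rw [← e]
      exact add_mem (le_translates ho) (hLo.D_mem x)
    | succ k ih =>
      rw [pow_succ', Module.End.mul_apply, G.isAut.map_D]
      exact D_mem_translates ih
  | zero => rw [map_zero]; exact zero_mem _
  | add x y _ _ hx hy => rw [map_add]; exact add_mem hx hy
  | smul c x _ hx => rw [map_smul]; exact Submodule.smul_mem _ _ hx

include hLo in
lemma IsAdmissible.degPow_mem (α : ℂ) {a : 𝓛} (ha : a ∈ translates Lo) :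
    degPow 𝓛 α a ∈ translates Lo := by
  induction ha using Submodule.span_induction with
  | mem x hx =>
    obtain ⟨k, a, ha, rfl⟩ := hx
    induction k with
    | zero =>
      refine Submodule.iSup_induction _
        (motive := fun a => degPow 𝓛 α ((D ^ 0 : 𝓛 →ₗ[ℂ] 𝓛) a) ∈ translates Lo)
        (hLo.graded ha) (fun m a ha => ?_) (by rw [map_zero, map_zero]; exact zero_mem _)
        (fun a b ha hb => by rw [map_add, map_add]; exact add_mem ha hb)
      show degPow 𝓛 α a ∈ _
      rw [degPow_of_mem α m a ha.2]
      exact Submodule.smul_mem _ _ (le_translates ha.1)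
    | succ k ih =>
      rw [pow_succ', Module.End.mul_apply, degPow_D]
      exact Submodule.smul_mem _ _ (D_mem_translates ih)
  | zero => rw [map_zero]; exact zero_mem _
  | add x y _ _ hx hy => rw [map_add]; exact add_mem hx hy
  | smul c x _ hx => rw [map_smul]; exact Submodule.smul_mem _ _ hx

include hLo in
lemma IsAdmissible.twist_mem (k : ℕ) {a : 𝓛} (ha : a ∈ translates Lo) :
    G.twist k a ∈ translates Lo := by
  refine Submodule.smul_mem _ _ (hLo.degPow_mem _ ?_)
  show (G.σ ^ k) a ∈ _
  induction k with
  | zero => exact ha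
  | succ k ih =>
    rw [pow_succ', LinearEquiv.mul_apply]
    exact hLo.σ_mem ih

lemma twist_of_mem (k n : ℕ) {a : 𝓛} (ha : a ∈ gr (𝓛 := 𝓛) n) :
    G.twist k a = ((G.ω ^ k)⁻¹ * (G.ω ^ k) ^ n) • (G.σ ^ k) a := by
  rw [mul_smul, ← degPow_of_mem _ n _ ((G.isAut.pow k).map_gr n a ha)]
  rfl

lemma twist_twist (j k : ℕ) (a : 𝓛) : G.twist j (G.twist k a) = G.twist (j + k) a := by
  induction a using gr_induction with
  | mem n a ha =>
    rw [twist_of_mem k n ha, map_smul, twist_of_mem j n ((G.isAut.pow k).map_gr n a ha),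
      twist_of_mem (j + k) n ha, smul_smul, pow_add G.σ, LinearEquiv.mul_apply]
    congr 1
    rw [pow_add, mul_inv, mul_pow]
    ring
  | add a b ha hb => simp only [map_add, ha, hb]

lemma twist_add_period (k : ℕ) : G.twist (k + T) = G.twist k := by
  simp only [twist, R, pow_add, G.primitive.pow_eq_one, G.pow_eq_one, mul_one]

lemma twist_zero (a : 𝓛) : G.twist 0 a = a := by
  induction a using gr_induction with
  | mem n a ha => rw [twist_of_mem 0 n ha]; simp
  | add a b ha hb => simp only [map_add, ha, hb]

end CyclotomicDatum

/-! ## The cyclotomic Lie algebra -/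

namespace GammaSet

open CyclotomicDatum

variable {𝓛 : Type*} [AddCommGroup 𝓛] [Module ℂ 𝓛] [VertexLieAlgebra 𝓛] {T : ℕ}
variable {G : CyclotomicDatum 𝓛 T} (S : GammaSet G)

lemma scaleRat_scaleRat (c d : ℂ) (hc : c ≠ 0) (hd : d ≠ 0) (f : RatFunc ℂ) :
    scaleRat c hc (scaleRat d hd f) = scaleRat (d * c) (mul_ne_zero hd hc) f := by
  obtain ⟨p, q, hq, rfl⟩ := exists_div f
  rw [scaleRat_div, scaleRat_div, scaleRat_div, Polynomial.comp_assoc, Polynomial.comp_assoc]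
  simp only [Polynomial.mul_comp, Polynomial.C_comp, Polynomial.X_comp, map_mul, mul_assoc]

lemma scaleRat_congr {c d : ℂ} (h : c = d) (hc : c ≠ 0) (f : RatFunc ℂ) :
    scaleRat c hc f = scaleRat d (h ▸ hc) f := by
  subst h; rfl

lemma scaleRat_one (f : RatFunc ℂ) : scaleRat 1 one_ne_zero f = f := by
  obtain ⟨p, q, hq, rfl⟩ := exists_div f
  rw [scaleRat_div]
  simp

lemma scale_scale (j k : ℕ) (f : ratVanishing S.carrier) :
    S.scale j (S.scale k f) = S.scale (j + k) f := by
  apply Subtype.ext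
  show scaleRat _ _ (scaleRat _ _ f.1) = scaleRat _ _ f.1
  rw [scaleRat_scaleRat]
  exact scaleRat_congr (by rw [pow_add, mul_inv_rev]) _ _

lemma scale_add_period (k : ℕ) (f : ratVanishing S.carrier) :
    S.scale (k + T) f = S.scale k f := by
  apply Subtype.ext
  exact scaleRat_congr (by rw [pow_add, G.primitive.pow_eq_one, mul_one]) _ _

lemma scale_zero (f : ratVanishing S.carrier) : S.scale 0 f = f := by
  apply Subtype.ext
  refine Eq.trans (scaleRat_congr (by simp) _ _) (scaleRat_one f.1)

lemma scale_mul (k : ℕ) (f g : ratVanishing S.carrier) :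
    S.scale k (f * g) = S.scale k f * S.scale k g :=
  Subtype.ext (map_mul (scaleRat _ _) f.1 g.1)

lemma act_rho (k : ℕ) (a : 𝓛) (f : ratVanishing S.carrier) :
    S.act k (rho 𝓛 _ (a ⊗ₜ f)) = rho 𝓛 _ (G.twist k a ⊗ₜ S.scale k f) := rfl

lemma act_act (j k : ℕ) (x : S.GlobalLie) : S.act j (S.act k x) = S.act (j + k) x := by
  induction x using lieOf_induction with
  | tmul a f => rw [act_rho, act_rho, act_rho, twist_twist, scale_scale]
  | add x y hx hy => simp only [map_add, hx, hy]

lemma act_add_period (k : ℕ) (x : S.GlobalLie) : S.act (k + T) x = S.act k x := by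
  induction x using lieOf_induction with
  | tmul a f => rw [act_rho, act_rho, twist_add_period, scale_add_period]
  | add x y hx hy => simp only [map_add, hx, hy]

lemma act_zero (x : S.GlobalLie) : S.act 0 x = x := by
  induction x using lieOf_induction with
  | tmul a f => rw [act_rho, twist_zero, scale_zero]
  | add x y hx hy => simp only [map_add, hx, hy]

lemma act_lie (k : ℕ) (x y : S.GlobalLie) : S.act k ⁅x, y⁆ = ⁅S.act k x, S.act k y⁆ :=
  mapLinear_lie _ _ _ (G.ω_pow_ne_zero k) _ _ (G.twist_nprod k) (S.scale_mul k) x y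

/-- The sum of the translates of an element under the group. -/
def trace : S.GlobalLie →ₗ[ℂ] S.GlobalLie := ∑ k ∈ Finset.range T, S.act k

lemma trace_apply (x : S.GlobalLie) : S.trace x = ∑ k ∈ Finset.range T, S.act k x := by
  rw [trace, LinearMap.sum_apply]

/-- Acting by ω shifts the sum by one, and the term k = T equals the term k = 0 by periodicity.
Invariance under ω gives invariance under its powers. -/
lemma trace_mem_fixed (x : S.GlobalLie) : S.trace x ∈ S.fixed := by
  have h1 : ∀ y ∈ Set.range S.trace, S.act 1 y = y := by
    rintro _ ⟨x, rfl⟩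
    rw [trace_apply, map_sum]
    simp only [act_act]
    have e1 := Finset.sum_range_succ (fun k => S.act k x) T
    rw [Finset.sum_range_succ'] at e1
    have e2 : S.act T x = S.act 0 x := by
      have := S.act_add_period 0 x
      rwa [zero_add] at this
    rw [e2] at e1
    rw [← add_right_cancel e1]
    exact Finset.sum_congr rfl fun k _ => by rw [add_comm]
  intro k
  induction k with
  | zero => exact S.act_zero _
  | succ k ih => rw [add_comm, ← act_act, ih]; exact h1 _ ⟨x, rfl⟩

lemma trace_of_mem_fixed {x : S.GlobalLie} (hx : x ∈ S.fixed) : S.trace x = (T : ℂ) • x := by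
  rw [trace_apply, Finset.sum_congr rfl fun k _ => hx k, Finset.sum_const, Finset.card_range,
    Nat.cast_smul_eq_nsmul]

/-- The span of the differences of the elements `∑_{α ∈ Γ} cent / (t - α x)`. -/
def orbitIdeal : Submodule ℂ S.GlobalLie :=
  Submodule.span ℂ {y | ∃ x₁ h₁ x₂ h₂, y = S.orbitSum x₁ h₁ - S.orbitSum x₂ h₂}

/-- The image of `ρ (Lo ⊗ A)`. -/
def modes (Lo : Submodule ℂ 𝓛) : Submodule ℂ S.GlobalLie :=
  Submodule.span ℂ {x | ∃ a ∈ Lo, ∃ f : ratVanishing S.carrier, x = rho 𝓛 _ (a ⊗ₜ f)}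

/-- The span of the elements `ρ (cent ⊗ f g)`. -/
def centProducts : Submodule ℂ S.GlobalLie :=
  Submodule.span ℂ {x | ∃ f g : ratVanishing S.carrier, x = rho 𝓛 _ (cent ⊗ₜ (f * g))}

/-- A pole of order at least two is a nonzero multiple of a derivative, and D c = 0, so the tensor
lies in the image of ∂. -/
lemma rho_cent_pole_succ (x : ℂ) (hx : x ∈ S.carrier) (j : ℕ) :
    rho 𝓛 _ (cent ⊗ₜ pole x hx (j + 1)) = 0 := by
  have h := rho_del (𝓛 := 𝓛) (cent ⊗ₜ[ℂ] pole x hx j)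
  rw [del_tmul, D_cent, TensorProduct.zero_tmul, zero_add, δ_pole, TensorProduct.tmul_smul,
    map_smul] at h
  exact (smul_eq_zero.1 h).resolve_left
    (neg_ne_zero.2 (by exact_mod_cast Nat.succ_ne_zero j))

lemma trace_centPole (x : ℂ) (hx : x ∈ S.carrier) :
    S.trace (S.centPole x hx) = S.orbitSum x hx := by
  rw [trace_apply]
  exact Finset.sum_congr rfl fun k _ => S.act_centPole k x hx

/-- Higher poles contribute nothing, and a difference of two simple poles averages to a difference
of orbit sums, that is, to a generator of the ideal. -/
lemma trace_mem_orbitIdeal {x : S.GlobalLie} (hx : x ∈ S.centProducts) :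
    S.trace x ∈ S.orbitIdeal := by
  induction hx using Submodule.span_induction with
  | mem x hx =>
    obtain ⟨f, g, rfl⟩ := hx
    refine mul_induction (p := fun h => S.trace (rho 𝓛 _ (cent ⊗ₜ h)) ∈ S.orbitIdeal)
      (fun x hx j => ?_) (fun x hx y hy => ?_) ?_ (fun f g hf hg => ?_) (fun c f hf => ?_) f g
    · rw [rho_cent_pole_succ, map_zero]; exact zero_mem _
    · rw [TensorProduct.tmul_sub, map_sub, map_sub]
      refine Submodule.subset_span ⟨x, hx, y, hy, ?_⟩
      rw [← trace_centPole, ← trace_centPole]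
      rfl
    · rw [TensorProduct.tmul_zero, map_zero, map_zero]; exact zero_mem _
    · rw [TensorProduct.tmul_add, map_add, map_add]; exact add_mem hf hg
    · rw [TensorProduct.tmul_smul, map_smul, map_smul]; exact Submodule.smul_mem _ _ hf
  | zero => rw [map_zero]; exact zero_mem _
  | add x y _ _ hx hy => rw [map_add]; exact add_mem hx hy
  | smul c x _ hx => rw [map_smul]; exact Submodule.smul_mem _ _ hx

variable {Lo : Submodule ℂ 𝓛} (hLo : G.IsAdmissible Lo)

/-- In Lie_A the powers of D can be moved to the function, so translates of Lo produce no new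
classes. -/
lemma rho_mem_modes {a : 𝓛} (ha : a ∈ translates Lo) (f : ratVanishing S.carrier) :
    rho 𝓛 _ (a ⊗ₜ f) ∈ S.modes Lo := by
  induction ha using Submodule.span_induction with
  | mem x hx =>
    obtain ⟨k, a, ha, rfl⟩ := hx
    rw [rho_D_pow]
    exact Submodule.smul_mem _ _ (Submodule.subset_span ⟨a, ha, _, rfl⟩)
  | zero => rw [TensorProduct.zero_tmul, map_zero]; exact zero_mem _
  | add x y _ _ hx hy => rw [TensorProduct.add_tmul, map_add]; exact add_mem hx hy
  | smul c x _ hx =>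
    rw [← TensorProduct.smul_tmul', map_smul]; exact Submodule.smul_mem _ _ hx

include hLo in
lemma act_mem_modes (k : ℕ) {x : S.GlobalLie} (hx : x ∈ S.modes Lo) :
    S.act k x ∈ S.modes Lo := by
  induction hx using Submodule.span_induction with
  | mem x hx =>
    obtain ⟨a, ha, f, rfl⟩ := hx
    rw [act_rho]
    exact S.rho_mem_modes (hLo.twist_mem k (le_translates ha)) _
  | zero => rw [map_zero]; exact zero_mem _
  | add x y _ _ hx hy => rw [map_add]; exact add_mem hx hy
  | smul c x _ hx => rw [map_smul]; exact Submodule.smul_mem _ _ hx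

include hLo in
lemma trace_mem_modes {x : S.GlobalLie} (hx : x ∈ S.modes Lo) : S.trace x ∈ S.modes Lo := by
  rw [trace_apply]
  exact sum_mem fun k _ => S.act_mem_modes hLo k hx

include hLo in
-- Each product a_(n) b is a translate of elements of Lo plus a multiple of c. That multiple is
-- paired with (∂ⁿf / n!) g, a product of two functions vanishing at infinity.
lemma lie_mem_modes_sup {x y : S.GlobalLie} (hx : x ∈ S.modes Lo) (hy : y ∈ S.modes Lo) :
    ⁅x, y⁆ ∈ S.modes Lo ⊔ S.centProducts := by
  induction hx using Submodule.span_induction with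
  | mem x hx =>
    obtain ⟨a, ha, f, rfl⟩ := hx
    induction hy using Submodule.span_induction with
    | mem y hy =>
      obtain ⟨b, hb, g, rfl⟩ := hy
      obtain ⟨N, hN⟩ := locality a b
      rw [lie_rho, preBracket_tmul a b f g N hN, map_sum]
      refine sum_mem fun n _ => ?_
      obtain ⟨e, he, r, h⟩ := hLo.exists_translates (nprod n a b)
      rw [h, TensorProduct.add_tmul, map_add, ← TensorProduct.smul_tmul', map_smul]
      exact add_mem (Submodule.mem_sup_left (S.rho_mem_modes he _))
        (Submodule.mem_sup_right (Submodule.smul_mem _ _ (Submodule.subset_span ⟨_, _, rfl⟩)))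
    | zero => rw [lie_zero]; exact zero_mem _
    | add x y _ _ hx hy => rw [lie_add]; exact add_mem hx hy
    | smul c x _ hx => rw [lie_smul]; exact Submodule.smul_mem _ _ hx
  | zero => rw [zero_lie]; exact zero_mem _
  | add x y _ _ hx hy => rw [add_lie]; exact add_mem hx hy
  | smul c x _ hx => rw [smul_lie]; exact Submodule.smul_mem _ _ hx

lemma centPole_lie (x : ℂ) (hx : x ∈ S.carrier) (y : S.GlobalLie) :
    ⁅S.centPole x hx, y⁆ = 0 := by
  induction y using lieOf_induction with
  | tmul b g =>
    rw [centPole, lie_rho, preBracket_tmul _ _ _ _ 0 (fun n _ => nprod_cent_left n b)]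
    simp
  | add y z hy hz => rw [lie_add, hy, hz, add_zero]

lemma orbitIdeal_lie {x : S.GlobalLie} (hx : x ∈ S.orbitIdeal) (y : S.GlobalLie) :
    ⁅x, y⁆ = 0 := by
  have h : ∀ x hx, ⁅S.orbitSum x hx, y⁆ = 0 := fun x hx => by
    rw [orbitSum, sum_lie]
    exact Finset.sum_eq_zero fun k _ => S.centPole_lie _ _ y
  induction hx using Submodule.span_induction with
  | mem x hx =>
    obtain ⟨x, hx, z, hz, rfl⟩ := hx
    rw [sub_lie, h, h, sub_zero]
  | zero => rw [zero_lie]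
  | add x y _ _ hx hy => rw [add_lie, hx, hy, add_zero]
  | smul c x _ hx => rw [smul_lie, hx, smul_zero]

/-- The Lie algebra of invariant elements of `ρ (Lo ⊗ A) + I`, for `I` the ideal spanned by the
differences of the elements `∑_{α ∈ Γ} cent / (t - α x)`. -/
def invariantLie (hLo : G.IsAdmissible Lo) : LieSubalgebra ℂ S.GlobalLie where
  __ := S.fixed ⊓ (S.modes Lo ⊔ S.orbitIdeal)
  lie_mem' := by
    rintro x y ⟨hx, hx'⟩ ⟨hy, hy'⟩
    have hfix : ⁅x, y⁆ ∈ S.fixed := fun k => by rw [act_lie, hx k, hy k]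
    refine ⟨hfix, ?_⟩
    obtain ⟨k, hk, j, hj, rfl⟩ := Submodule.mem_sup.1 hx'
    obtain ⟨k', hk', j', hj', rfl⟩ := Submodule.mem_sup.1 hy'
    -- The ideal is central, so only the parts in `modes` matter.
    have e : ⁅k + j, k' + j'⁆ = ⁅k, k'⁆ := by
      rw [add_lie, S.orbitIdeal_lie hj, add_zero, lie_add, ← lie_skew k j', S.orbitIdeal_lie hj',
        neg_zero, add_zero]
    rw [e] at hfix ⊢
    obtain ⟨m, hm, c, hc, h⟩ := Submodule.mem_sup.1 (S.lie_mem_modes_sup hLo hk hk')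
    have hT : (T : ℂ) ≠ 0 := by exact_mod_cast G.T_pos.ne'
    -- The summands m and c need not be invariant, but their sum is and equals its own average.
    -- Averaging each summand keeps m in `modes` and moves c into the ideal.
    have h2 : ⁅k, k'⁆ = (T : ℂ)⁻¹ • (S.trace m + S.trace c) := by
      rw [← map_add, h, S.trace_of_mem_fixed hfix, smul_smul, inv_mul_cancel₀ hT, one_smul]
    rw [h2]
    exact Submodule.smul_mem _ _ (add_mem
      (Submodule.mem_sup_left (S.trace_mem_modes hLo hm))
      (Submodule.mem_sup_right (S.trace_mem_orbitIdeal hc)))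

/-- This replaces the quotient by I with a condition on representatives, where the Lie algebra
`invariantLie` is available. -/
lemma mkQ_mem_cyclotomicLie_iff (J : S.CentralIdeal) (hJ : J.I = S.orbitIdeal)
    {x : S.GlobalLie} (hx : x ∈ S.fixed) :
    J.I.mkQ x ∈ J.cyclotomicLie Lo ↔ x ∈ S.modes Lo ⊔ S.orbitIdeal := by
  have hred : J.reduced Lo = (S.modes Lo).map J.I.mkQ := by
    rw [modes, Submodule.map_span, CentralIdeal.reduced]
    refine congrArg (Submodule.span ℂ) (Set.ext fun y => ?_)
    constructor
    · rintro ⟨a, ha, f, rfl⟩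
      exact ⟨_, ⟨a, ha, f, rfl⟩, rfl⟩
    · rintro ⟨_, ⟨a, ha, f, rfl⟩, rfl⟩
      exact ⟨a, ha, f, rfl⟩
  have h : J.I.mkQ x ∈ J.reduced Lo ↔ x ∈ S.modes Lo ⊔ S.orbitIdeal := by
    rw [hred, ← Submodule.mem_comap, Submodule.comap_map_mkQ, hJ, sup_comm]
  rw [← h]
  exact ⟨fun hx => hx.1, fun h => ⟨h, fun k => congrArg J.I.mkQ (hx k)⟩⟩

end GammaSet

end

/-! ## The local Lie algebra and its expansions -/

noncomputable section

open VertexLieAlgebra DerivationAlgebra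
open scoped LaurentSeries

namespace VertexLieAlgebra

section Series

lemma δ_coeff (f : ℂ⸨X⸩) (n : ℤ) : (δ f).coeff n = ((n : ℂ) + 1) * f.coeff (n + 1) := by
  show (LaurentSeries.derivative ℂ f).coeff n = _
  rw [LaurentSeries.derivative_apply, LaurentSeries.hasseDeriv_coeff]
  simp

lemma δ_single_neg (j : ℕ) : δ (HahnSeries.single (-((j : ℤ) + 1)) 1 : ℂ⸨X⸩) =
    -((j + 1 : ℕ) : ℂ) • HahnSeries.single (-((j + 1 : ℕ) + 1 : ℤ)) (1 : ℂ) := by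
  rw [← laurentExp_poleRat_self 0, ← laurentExp_derivRat, derivRat_poleRat, laurentExp_smul,
    laurentExp_poleRat_self]

lemma exists_δ_ofPowerSeries (g : PowerSeries ℂ) :
    ∃ g', δ (HahnSeries.ofPowerSeries ℤ ℂ g) = HahnSeries.ofPowerSeries ℤ ℂ g' := by
  refine ⟨PowerSeries.mk fun n => ((n : ℂ) + 1) * PowerSeries.coeff (n + 1) g, ?_⟩
  ext n
  rw [δ_coeff, PowerSeries.coeff_coe, PowerSeries.coeff_coe]
  rcases lt_trichotomy n (-1) with h | h | h
  · rw [if_pos (by omega), if_pos (by omega), mul_zero]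
  · subst h; simp
  · rw [if_neg (by omega), if_neg (by omega), PowerSeries.coeff_mk]
    obtain ⟨m, rfl⟩ := Int.eq_ofNat_of_zero_le (show 0 ≤ n by omega)
    have e1 : ((m : ℤ) + 1).natAbs = m + 1 := by omega
    have e2 : ((m : ℤ)).natAbs = m := by omega
    rw [e1, e2, Int.cast_natCast]

lemma exists_divPow_ofPowerSeries (n : ℕ) (g : PowerSeries ℂ) :
    ∃ g', divPow n (HahnSeries.ofPowerSeries ℤ ℂ g) = HahnSeries.ofPowerSeries ℤ ℂ g' := by
  have h : ∃ g', (δ ^ n : ℂ⸨X⸩ →ₗ[ℂ] ℂ⸨X⸩) (HahnSeries.ofPowerSeries ℤ ℂ g) =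
      HahnSeries.ofPowerSeries ℤ ℂ g' := by
    induction n with
    | zero => exact ⟨g, rfl⟩
    | succ n ih =>
      obtain ⟨g', hg'⟩ := ih
      rw [pow_succ', Module.End.mul_apply, hg']
      exact exists_δ_ofPowerSeries g'
  obtain ⟨g', hg'⟩ := h
  refine ⟨PowerSeries.C (n.factorial : ℂ)⁻¹ * g', ?_⟩
  rw [divPow, LinearMap.smul_apply, hg', map_mul, HahnSeries.ofPowerSeries_C,
    HahnSeries.C_mul_eq_smul]

end Series

set_option linter.unusedSectionVars false

variable {𝓛 : Type*} [AddCommGroup 𝓛] [Module ℂ 𝓛] [VertexLieAlgebra 𝓛]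

variable (𝓛) in
/-- The image of `𝓛 ⊗ ℂ[[t]]` in `L(𝓛)`. -/
def localPos : Submodule ℂ (LocalLie 𝓛) :=
  Submodule.span ℂ {x | ∃ (a : 𝓛) (g : PowerSeries ℂ),
    x = rho 𝓛 ℂ⸨X⸩ (a ⊗ₜ HahnSeries.ofPowerSeries ℤ ℂ g)}

lemma rho_mem_localPos (a : 𝓛) (g : PowerSeries ℂ) :
    rho 𝓛 ℂ⸨X⸩ (a ⊗ₜ HahnSeries.ofPowerSeries ℤ ℂ g) ∈ localPos 𝓛 :=
  Submodule.subset_span ⟨a, g, rfl⟩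

lemma lie_mem_localPos {x y : LocalLie 𝓛} (hx : x ∈ localPos 𝓛) (hy : y ∈ localPos 𝓛) :
    ⁅x, y⁆ ∈ localPos 𝓛 := by
  induction hx using Submodule.span_induction with
  | mem x hx =>
    obtain ⟨a, f, rfl⟩ := hx
    induction hy using Submodule.span_induction with
    | mem y hy =>
      obtain ⟨b, g, rfl⟩ := hy
      obtain ⟨N, hN⟩ := locality a b
      rw [lie_rho, preBracket_tmul a b _ _ N hN, map_sum]
      refine sum_mem fun n _ => ?_
      obtain ⟨f', hf'⟩ := exists_divPow_ofPowerSeries n f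
      rw [hf', ← map_mul]
      exact rho_mem_localPos _ _
    | zero => rw [lie_zero]; exact zero_mem _
    | add x y _ _ hx hy => rw [lie_add]; exact add_mem hx hy
    | smul c x _ hx => rw [lie_smul]; exact Submodule.smul_mem _ _ hx
  | zero => rw [zero_lie]; exact zero_mem _
  | add x y _ _ hx hy => rw [add_lie]; exact add_mem hx hy
  | smul c x _ hx => rw [smul_lie]; exact Submodule.smul_mem _ _ hx

lemma centMode_lie (y : LocalLie 𝓛) : ⁅centMode 𝓛, y⁆ = 0 := by
  induction y using lieOf_induction with
  | tmul b g =>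
    rw [centMode, lie_rho, preBracket_tmul _ _ _ _ 0 (fun n _ => nprod_cent_left n b)]
    simp
  | add y z hy hz => rw [lie_add, hy, hz, add_zero]

variable (𝓛) in
/-- The pairs `(x, s)` such that `x` acts on the vacuum by the scalar `s`. -/
def vacuumPairs : Submodule ℂ (LocalLie 𝓛 × ℂ) :=
  (localPos 𝓛).comap (LinearMap.fst ℂ _ ℂ -
    (LinearMap.toSpanSingleton ℂ _ (centMode 𝓛)) ∘ₗ LinearMap.snd ℂ (LocalLie 𝓛) ℂ)

lemma mem_vacuumPairs {r : LocalLie 𝓛 × ℂ} :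
    r ∈ vacuumPairs 𝓛 ↔ r.1 - r.2 • centMode 𝓛 ∈ localPos 𝓛 := Iff.rfl

lemma lie_mem_vacuumPairs {r r' : LocalLie 𝓛 × ℂ} (hr : r ∈ vacuumPairs 𝓛)
    (hr' : r' ∈ vacuumPairs 𝓛) : (⁅r.1, r'.1⁆, (0 : ℂ)) ∈ vacuumPairs 𝓛 := by
  rw [mem_vacuumPairs] at hr hr' ⊢
  have h := lie_mem_localPos hr hr'
  rw [sub_lie, smul_lie, centMode_lie, smul_zero, sub_zero, lie_sub, lie_smul,
    ← lie_skew r.1 (centMode 𝓛), centMode_lie, neg_zero, smul_zero, sub_zero] at h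
  rwa [zero_smul, sub_zero]

/-- The scalar pairs are generated by (x, 0) for x in `localPos` and (c(-1), 1), which correspond to
the two families of generators of the vacuum ideal. -/
lemma vacuumIdeal_eq :
    vacuumIdeal 𝓛 = UniversalEnvelopingAlgebra.indIdeal (LocalLie 𝓛) (vacuumPairs 𝓛) := by
  apply le_antisymm
  · rw [vacuumIdeal, Submodule.span_le]
    rintro _ (⟨a, f, rfl⟩ | rfl)
    · refine Submodule.subset_span
        ⟨(rho 𝓛 ℂ⸨X⸩ (a ⊗ₜ HahnSeries.ofPowerSeries ℤ ℂ f), 0), ?_, ?_⟩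
      · rw [SetLike.mem_coe, mem_vacuumPairs, zero_smul, sub_zero]
        exact rho_mem_localPos a f
      · rw [map_zero, sub_zero]
    · refine Submodule.subset_span ⟨(centMode 𝓛, 1), ?_, ?_⟩
      · rw [SetLike.mem_coe, mem_vacuumPairs, one_smul, sub_self]
        exact zero_mem _
      · rw [map_one]
  · rw [UniversalEnvelopingAlgebra.indIdeal, Submodule.span_le]
    rintro _ ⟨⟨x, s⟩, hr, rfl⟩
    have h1 : ∀ y ∈ localPos 𝓛, UniversalEnvelopingAlgebra.ι ℂ y ∈ vacuumIdeal 𝓛 := by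
      intro y hy
      induction hy using Submodule.span_induction with
      | mem y hy =>
        obtain ⟨a, f, rfl⟩ := hy
        exact Submodule.subset_span (Or.inl ⟨a, f, rfl⟩)
      | zero => rw [map_zero]; exact zero_mem _
      | add x y _ _ hx hy => rw [map_add]; exact add_mem hx hy
      | smul c x _ hx => rw [map_smul]; exact Submodule.smul_of_tower_mem _ c hx
    have h2 : UniversalEnvelopingAlgebra.ι ℂ (centMode 𝓛) - 1 ∈ vacuumIdeal 𝓛 :=
      Submodule.subset_span (Or.inr rfl)
    have e : UniversalEnvelopingAlgebra.ι ℂ x -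
        algebraMap ℂ (UniversalEnvelopingAlgebra ℂ (LocalLie 𝓛)) s =
        UniversalEnvelopingAlgebra.ι ℂ (x - s • centMode 𝓛) +
          s • (UniversalEnvelopingAlgebra.ι ℂ (centMode 𝓛) - 1) := by
      rw [map_sub, map_smul, smul_sub, Algebra.algebraMap_eq_smul_one]
      abel
    rw [SetLike.mem_coe, e]
    exact add_mem (h1 _ hr) (Submodule.smul_of_tower_mem _ s h2)

/-- The coefficient of `t ^ (-(k + 1))` of an element of `𝓛 ⊗ ℂ((t))`. -/
def polarCoeff (k : ℕ) : 𝓛 ⊗[ℂ] ℂ⸨X⸩ →ₗ[ℂ] 𝓛 :=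
  TensorProduct.lift (LinearMap.mk₂ ℂ (fun a (f : ℂ⸨X⸩) => f.coeff (-((k : ℤ) + 1)) • a)
    (fun a b f => by rw [smul_add]) (fun c a f => by rw [smul_comm])
    (fun a f g => by rw [HahnSeries.coeff_add, add_smul])
    (fun c a f => by rw [HahnSeries.coeff_smul, smul_eq_mul, mul_smul]))

lemma polarCoeff_tmul (k : ℕ) (a : 𝓛) (f : ℂ⸨X⸩) :
    polarCoeff k (a ⊗ₜ f) = f.coeff (-((k : ℤ) + 1)) • a := rfl

/-- A derivative has no residue, so only the D-part of ∂ survives. -/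
lemma polarCoeff_zero_del (y : 𝓛 ⊗[ℂ] ℂ⸨X⸩) :
    polarCoeff 0 (del 𝓛 ℂ⸨X⸩ y) = D (polarCoeff 0 y) := by
  induction y with
  | zero => simp
  | add x y hx hy => simp only [map_add, hx, hy]
  | tmul a f =>
    rw [del_tmul, map_add, polarCoeff_tmul, polarCoeff_tmul, polarCoeff_tmul, δ_coeff]
    simp

lemma polarCoeff_succ_del (k : ℕ) (y : 𝓛 ⊗[ℂ] ℂ⸨X⸩) :
    polarCoeff (k + 1) (del 𝓛 ℂ⸨X⸩ y) =
      D (polarCoeff (k + 1) y) - ((k + 1 : ℕ) : ℂ) • polarCoeff k y := by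
  induction y with
  | zero => simp
  | add x y hx hy => simp only [map_add, hx, hy, smul_add]; abel
  | tmul a f =>
    rw [del_tmul, map_add, polarCoeff_tmul, polarCoeff_tmul, polarCoeff_tmul, polarCoeff_tmul,
      δ_coeff, map_smul, smul_smul, sub_eq_add_neg, ← neg_smul]
    congr 2
    push_cast
    rw [show -((k : ℤ) + 1 + 1) + 1 = -((k : ℤ) + 1) by ring]
    ring

lemma polarCoeff_ofPowerSeries (k : ℕ) (a : 𝓛) (g : PowerSeries ℂ) :
    polarCoeff k (a ⊗ₜ[ℂ] HahnSeries.ofPowerSeries ℤ ℂ g) = 0 := by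
  rw [polarCoeff_tmul, PowerSeries.coeff_coe, if_pos (by omega), zero_smul]

/-- A class in `localPos` has a representative without negative powers of t, and two representatives
of one class differ by an element of the image of ∂. -/
lemma exists_del_of_rho_mem_localPos {Y : 𝓛 ⊗[ℂ] ℂ⸨X⸩} (h : rho 𝓛 ℂ⸨X⸩ Y ∈ localPos 𝓛) :
    ∃ y, ∀ k, polarCoeff k Y = polarCoeff k (del 𝓛 ℂ⸨X⸩ y) := by
  have h' : ∀ x ∈ localPos 𝓛, ∃ X, rho 𝓛 ℂ⸨X⸩ X = x ∧ ∀ k, polarCoeff k X = 0 := by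
    intro x hx
    induction hx using Submodule.span_induction with
    | mem x hx =>
      obtain ⟨a, g, rfl⟩ := hx
      exact ⟨_, rfl, fun k => polarCoeff_ofPowerSeries k a g⟩
    | zero => exact ⟨0, map_zero _, fun k => map_zero _⟩
    | add x y _ _ hx hy =>
      obtain ⟨⟨X, rfl, hX⟩, ⟨Y, rfl, hY⟩⟩ := And.intro hx hy
      exact ⟨X + Y, map_add _ _ _, fun k => by rw [map_add, hX, hY, add_zero]⟩
    | smul c x _ hx =>
      obtain ⟨X, rfl, hX⟩ := hx
      exact ⟨c • X, map_smul _ _ _, fun k => by rw [map_smul, hX, smul_zero]⟩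
  obtain ⟨X, hX, hXk⟩ := h' _ h
  obtain ⟨y, hy⟩ := (Submodule.Quotient.eq _).1 hX.symm
  exact ⟨y, fun k => by rw [hy, map_sub, hXk, sub_zero]⟩

/-- The element `∑ a_j ⊗ t ^ (-(j + 1))`. -/
def polarTensor : (ℕ →₀ 𝓛) →ₗ[ℂ] 𝓛 ⊗[ℂ] ℂ⸨X⸩ :=
  Finsupp.lsum ℂ fun j => (TensorProduct.mk ℂ 𝓛 ℂ⸨X⸩).flip (HahnSeries.single (-((j : ℤ) + 1)) 1)

lemma polarTensor_single (j : ℕ) (a : 𝓛) : polarTensor (Finsupp.single j a) =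
    a ⊗ₜ[ℂ] (HahnSeries.single (-((j : ℤ) + 1)) 1 : ℂ⸨X⸩) := by
  rw [polarTensor, Finsupp.lsum_single]
  rfl

lemma polarCoeff_polarTensor (k : ℕ) (a : ℕ →₀ 𝓛) : polarCoeff k (polarTensor a) = a k := by
  induction a using Finsupp.induction_linear with
  | zero => simp
  | add a b ha hb => rw [map_add, map_add, ha, hb, Finsupp.add_apply]
  | single j a =>
    rw [polarTensor_single, polarCoeff_tmul]
    by_cases h : j = k
    · subst h; simp
    · rw [HahnSeries.coeff_single_of_ne (by omega), zero_smul, Finsupp.single_eq_of_ne (Ne.symm h)]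

/-- The sum of `ρ (Lo ⊗ t⁻¹ ℂ[t⁻¹])`, `ℂ cent(-1)` and `ρ (𝓛 ⊗ ℂ[[t]])` is direct. -/
lemma eq_zero_of_polarTensor_mem {T : ℕ} {G : CyclotomicDatum 𝓛 T} {Lo : Submodule ℂ 𝓛}
    (hLo : G.IsAdmissible Lo) (a : ℕ →₀ 𝓛) (ha : ∀ k, a k ∈ Lo) (s : ℂ)
    (h : rho 𝓛 ℂ⸨X⸩ (polarTensor a) + s • centMode 𝓛 ∈ localPos 𝓛) : a = 0 ∧ s = 0 := by
  -- The three facts together are directness of Lo ⊕ ℂ c ⊕ Im D. The last, D x = 0, drives the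
  -- recursion below.
  have hdir : ∀ o ∈ Lo, ∀ (r : ℂ) (x : 𝓛), o + r • cent = D x → o = 0 ∧ r = 0 ∧ D x = 0 := by
    intro o ho r x e
    have ho0 : o = 0 := by
      refine Submodule.disjoint_def.1 hLo.isCompl.1 o ho ?_
      rw [eq_sub_of_add_eq e]
      exact sub_mem (Submodule.mem_sup_right ⟨x, rfl⟩) (Submodule.mem_sup_left
        (Submodule.smul_mem _ _ (Submodule.mem_span_singleton_self _)))
    rw [ho0, zero_add] at e
    have hr : r = 0 := by
      by_contra hr
      refine cent_notMem (𝓛 := 𝓛) ⟨r⁻¹ • x, ?_⟩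
      rw [map_smul, ← e, smul_smul, inv_mul_cancel₀ hr, one_smul]
    refine ⟨ho0, hr, ?_⟩
    rw [← e, hr, zero_smul]
  rw [centMode, ← map_smul, ← map_add] at h
  obtain ⟨y, hy⟩ := exists_del_of_rho_mem_localPos h
  have hc : ∀ k, polarCoeff k (polarTensor a + s • (cent ⊗ₜ[ℂ] HahnSeries.single (-1) 1)) =
      a k + if k = 0 then s • cent else 0 := by
    intro k
    rw [map_add, polarCoeff_polarTensor, map_smul, polarCoeff_tmul]
    split_ifs with hk
    · subst hk; simp
    · rw [HahnSeries.coeff_single_of_ne (by omega), zero_smul, smul_zero]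
  have h0 : a 0 = 0 ∧ s = 0 ∧ D (polarCoeff 0 y) = 0 := by
    refine hdir _ (ha 0) _ _ ?_
    rw [← polarCoeff_zero_del, ← hy, hc, if_pos rfl]
  -- If D y_k = 0 then y_k is a multiple of c. The coefficient equation a_{k+1} = D y_{k+1} - (k +
  -- 1) y_k thus has again the shape required by `hdir`.
  have hk : ∀ k, a k = 0 ∧ D (polarCoeff k y) = 0 := by
    intro k
    induction k with
    | zero => exact ⟨h0.1, h0.2.2⟩
    | succ k ih =>
      have hker : polarCoeff k y ∈ LinearMap.ker (D (𝓛 := 𝓛)) := ih.2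
      rw [ker_D] at hker
      obtain ⟨r, hr⟩ := Submodule.mem_span_singleton.1 hker
      have e := hdir _ (ha (k + 1)) (((k + 1 : ℕ) : ℂ) * r) (polarCoeff (k + 1) y) (by
        rw [mul_smul, hr, ← sub_add_cancel (D (polarCoeff (k + 1) y))
          (((k + 1 : ℕ) : ℂ) • polarCoeff k y), ← polarCoeff_succ_del, ← hy, hc,
          if_neg (Nat.succ_ne_zero k), add_zero])
      exact ⟨e.1, e.2.2⟩
  exact ⟨Finsupp.ext fun k => (hk k).1, h0.2.1⟩

end VertexLieAlgebra

/-! ### Expansions of global classes at the points of an orbit. -/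

namespace GammaSet

open CyclotomicDatum

variable {𝓛 : Type*} [AddCommGroup 𝓛] [Module ℂ 𝓛] [VertexLieAlgebra 𝓛] {T : ℕ}
variable {G : CyclotomicDatum 𝓛 T} (S : GammaSet G)

lemma expand_rho (z : ℂ) (a : 𝓛) (f : ratVanishing S.carrier) :
    S.expand z (rho 𝓛 _ (a ⊗ₜ f)) = rho 𝓛 ℂ⸨X⸩ (a ⊗ₜ laurentExp z f.1) := rfl

lemma expand_mem_localPos {z : ℂ} (hz : z ∉ S.carrier) (x : S.GlobalLie) :
    S.expand z x ∈ localPos 𝓛 := by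
  induction x using lieOf_induction with
  | tmul a f =>
    obtain ⟨g, hg⟩ := exists_laurentExp hz f
    rw [expand_rho, hg]
    exact rho_mem_localPos a g
  | add x y hx hy => rw [map_add]; exact add_mem hx hy

lemma expand_pole_mem_localPos {z x : ℂ} (hx : x ∈ S.carrier) (h : z ≠ x) (a : 𝓛) (j : ℕ) :
    S.expand z (rho 𝓛 _ (a ⊗ₜ pole x hx j)) ∈ localPos 𝓛 := by
  obtain ⟨g, hg⟩ := exists_laurentExp_poleRat h j
  rw [expand_rho]
  show rho 𝓛 ℂ⸨X⸩ (a ⊗ₜ laurentExp z (poleRat x j)) ∈ _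
  rw [hg]
  exact rho_mem_localPos a g

lemma expand_pole_self {x : ℂ} (hx : x ∈ S.carrier) (a : 𝓛) (j : ℕ) :
    S.expand x (rho 𝓛 _ (a ⊗ₜ pole x hx j)) =
      rho 𝓛 ℂ⸨X⸩ (a ⊗ₜ HahnSeries.single (-((j : ℤ) + 1)) 1) := by
  rw [expand_rho, ← laurentExp_poleRat_self]
  rfl

/-- For an invariant class this carries whatever is known at one point to its whole Γ-orbit. -/
lemma expand_act (k : ℕ) (z : ℂ) (x : S.GlobalLie) :
    S.expand (G.ω ^ k * z) (S.act k x) = G.localAct k (S.expand z x) := by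
  induction x using lieOf_induction with
  | tmul a f =>
    rw [act_rho, expand_rho, expand_rho, localAct, mapLinear_rho]
    have h := laurentExp_scaleRat_eq (G.ω ^ k * z) (G.ω ^ k)⁻¹
      (inv_ne_zero (G.ω_pow_ne_zero k)) f.1
    rw [inv_mul_cancel_left₀ (G.ω_pow_ne_zero k)] at h
    rw [← h]
    rfl
  | add x y hx hy => simp only [map_add, hx, hy]

lemma localAct_mem_localPos (k : ℕ) {x : LocalLie 𝓛} (hx : x ∈ localPos 𝓛) :
    G.localAct k x ∈ localPos 𝓛 := by
  induction hx using Submodule.span_induction with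
  | mem x hx =>
    obtain ⟨a, g, rfl⟩ := hx
    obtain ⟨g', hg'⟩ := exists_scaleLaurent_ofPowerSeries (G.ω ^ k)⁻¹ g
    rw [localAct, mapLinear_rho, hg']
    exact rho_mem_localPos _ _
  | zero => rw [map_zero]; exact zero_mem _
  | add x y _ _ hx hy => rw [map_add]; exact add_mem hx hy
  | smul c x _ hx => rw [map_smul]; exact Submodule.smul_mem _ _ hx

lemma localAct_mem_vacuumPairs (k : ℕ) {r : LocalLie 𝓛 × ℂ} (hr : r ∈ vacuumPairs 𝓛) :
    (G.localAct k r.1, r.2) ∈ vacuumPairs 𝓛 := by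
  rw [mem_vacuumPairs] at hr ⊢
  have h := localAct_mem_localPos (G := G) k hr
  rwa [map_sub, map_smul, G.centMode_mem k] at h

/-- The class of `∑ a_j / (t - x) ^ (j + 1)`. -/
def polar (x : ℂ) (hx : x ∈ S.carrier) : (ℕ →₀ 𝓛) →ₗ[ℂ] S.GlobalLie :=
  rho 𝓛 _ ∘ₗ Finsupp.lsum ℂ fun j => (TensorProduct.mk ℂ 𝓛 _).flip (pole x hx j)

lemma polar_single (x : ℂ) (hx : x ∈ S.carrier) (j : ℕ) (a : 𝓛) :
    S.polar x hx (Finsupp.single j a) = rho 𝓛 _ (a ⊗ₜ pole x hx j) := by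
  rw [polar, LinearMap.comp_apply, Finsupp.lsum_single]
  rfl

lemma expand_polar_self (x : ℂ) (hx : x ∈ S.carrier) (a : ℕ →₀ 𝓛) :
    S.expand x (S.polar x hx a) = rho 𝓛 ℂ⸨X⸩ (polarTensor a) := by
  induction a using Finsupp.induction_linear with
  | zero => simp
  | add a b ha hb => simp only [map_add, ha, hb]
  | single j a => rw [polar_single, expand_pole_self, polarTensor_single]

lemma expand_polar_mem_localPos {z : ℂ} (x : ℂ) (hx : x ∈ S.carrier) (h : z ≠ x)
    (a : ℕ →₀ 𝓛) : S.expand z (S.polar x hx a) ∈ localPos 𝓛 := by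
  induction a using Finsupp.induction_linear with
  | zero => rw [map_zero, map_zero]; exact zero_mem _
  | add a b ha hb => rw [map_add, map_add]; exact add_mem ha hb
  | single j a => rw [polar_single]; exact S.expand_pole_mem_localPos hx h a j

lemma ω_pow_mul_ne {u : ℂ} (hu : u ≠ 0) {j k : ℕ} (hj : j < T) (hk : k < T) (h : j ≠ k) :
    G.ω ^ j * u ≠ G.ω ^ k * u := fun e =>
  h (G.primitive.pow_inj hj hk (mul_right_cancel₀ hu e))

variable {Lo : Submodule ℂ 𝓛} (hLo : G.IsAdmissible Lo)

include hLo in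
/-- Every class at a pole `u` is, up to classes acting on the vacuum by scalars, the expansion of
an invariant class. -/
lemma exists_expand_add {u : ℂ} (hu0 : u ≠ 0) (hu : u ∈ S.carrier) (l : LocalLie 𝓛) :
    ∃ x ∈ S.invariantLie hLo, ∃ r ∈ vacuumPairs 𝓛, l = S.expand u x + r.1 := by
  let N : Submodule ℂ (LocalLie 𝓛) :=
    (S.invariantLie hLo).toSubmodule.map (S.expand u) ⊔
      (vacuumPairs 𝓛).map (LinearMap.fst ℂ (LocalLie 𝓛) ℂ)
  have hpos : ∀ x ∈ localPos 𝓛, x ∈ N := fun x hx =>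
    Submodule.mem_sup_right ⟨(x, 0), by
      rw [SetLike.mem_coe, mem_vacuumPairs, zero_smul, sub_zero]; exact hx, rfl⟩
  -- All pole orders are required at once so that N' is stable under D. By `IsAdmissible.eq_top` it
  -- then suffices to treat coefficients in Lo and the coefficient c.
  let N' : Submodule ℂ 𝓛 :=
    { carrier := {a | ∀ j : ℕ, rho 𝓛 ℂ⸨X⸩ (a ⊗ₜ HahnSeries.single (-((j : ℤ) + 1)) 1) ∈ N}
      add_mem' := fun ha hb j => by
        rw [TensorProduct.add_tmul, map_add]; exact add_mem (ha j) (hb j)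
      zero_mem' := fun j => by rw [TensorProduct.zero_tmul, map_zero]; exact zero_mem _
      smul_mem' := fun c a ha j => by
        rw [← TensorProduct.smul_tmul', map_smul]; exact Submodule.smul_mem _ _ (ha j) }
  have hN' : N' = ⊤ := by
    refine hLo.eq_top (fun a ha j => ?_) (fun j => ?_) (fun a ha j => ?_)
    · let y := rho 𝓛 _ (a ⊗ₜ[ℂ] pole u hu j)
      have hy : y ∈ S.modes Lo := Submodule.subset_span ⟨a, ha, _, rfl⟩
      -- In the averaged class the term k = 0 has the wanted principal part at u; the other T - 1
      -- terms have their poles elsewhere on the orbit.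
      have e : S.expand u (S.trace y) = S.expand u y +
          ∑ k ∈ Finset.range (T - 1), S.expand u (S.act (k + 1) y) := by
        have hsum : ∀ (g : ℕ → LocalLie 𝓛) (n : ℕ), 0 < n →
            ∑ k ∈ Finset.range n, g k = g 0 + ∑ k ∈ Finset.range (n - 1), g (k + 1) := by
          intro g n hn
          obtain ⟨m, rfl⟩ := Nat.exists_eq_succ_of_ne_zero hn.ne'
          rw [Finset.sum_range_succ', add_comm]
          rfl
        rw [trace_apply, map_sum, hsum _ T G.T_pos, act_zero]
      rw [← S.expand_pole_self hu a j]
      change S.expand u y ∈ N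
      rw [eq_sub_of_add_eq e.symm]
      refine sub_mem (Submodule.mem_sup_left ⟨S.trace y, ⟨S.trace_mem_fixed y,
        Submodule.mem_sup_left (S.trace_mem_modes hLo hy)⟩, rfl⟩)
        (hpos _ (sum_mem fun k hk => ?_))
      have hk' : k + 1 < T := by
        have := Finset.mem_range.1 hk
        omega
      have h0 := G.ω_pow_ne_zero (k + 1)
      have hu' : u = G.ω ^ (k + 1) * ((G.ω ^ (k + 1))⁻¹ * u) := by
        rw [mul_inv_cancel_left₀ h0]
      have hne : (G.ω ^ (k + 1))⁻¹ * u ≠ u := fun h => by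
        rw [h] at hu'
        have := ω_pow_mul_ne (G := G) hu0 hk' G.T_pos (Nat.succ_ne_zero k)
        rw [pow_zero, one_mul] at this
        exact this hu'.symm
      -- The expansion at u of a translate comes from the expansion of y at another point of the
      -- orbit. There y, whose only pole is u, is regular.
      have e2 : S.expand u (S.act (k + 1) y) =
          G.localAct (k + 1) (S.expand ((G.ω ^ (k + 1))⁻¹ * u) y) := by
        rw [← expand_act, ← hu']
      rw [e2]
      exact localAct_mem_localPos _ (S.expand_pole_mem_localPos hu hne a j)
    -- For the coefficient c, the power t⁻¹ gives c(-1) with scalar 1, and every lower power is a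
    -- derivative, hence gives the zero class.
    · cases j with
      | zero =>
        refine Submodule.mem_sup_right ⟨(centMode 𝓛, 1), ?_, ?_⟩
        · rw [SetLike.mem_coe, mem_vacuumPairs, one_smul, sub_self]
          exact zero_mem _
        · rw [centMode]; simp
      | succ j =>
        have h := rho_del (𝓛 := 𝓛) (cent ⊗ₜ[ℂ] (HahnSeries.single (-((j : ℤ) + 1)) 1 : ℂ⸨X⸩))
        rw [del_tmul, D_cent, TensorProduct.zero_tmul, zero_add, δ_single_neg,
          TensorProduct.tmul_smul, map_smul] at h
        rw [(smul_eq_zero.1 h).resolve_left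
          (neg_ne_zero.2 (by exact_mod_cast Nat.succ_ne_zero j))]
        exact zero_mem _
    -- Moving D to the function raises the order of the pole by one, hence the use of the hypothesis
    -- at j + 1.
    · have h := rho_del (𝓛 := 𝓛) (a ⊗ₜ[ℂ] (HahnSeries.single (-((j : ℤ) + 1)) 1 : ℂ⸨X⸩))
      rw [del_tmul, δ_single_neg, TensorProduct.tmul_smul, map_add, map_smul] at h
      rw [eq_neg_of_add_eq_zero_left h]
      exact neg_mem (Submodule.smul_mem _ _ (ha (j + 1)))
  have hN : ∀ l, l ∈ N := by
    intro l
    induction l using lieOf_induction with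
    | add x y hx hy => exact add_mem hx hy
    | tmul a f =>
      have ha : a ∈ N' := by rw [hN']; trivial
      induction f using laurent_induction with
      | powerSeries g => exact hpos _ (rho_mem_localPos a g)
      | single j => exact ha j
      | add f g hf hg => rw [TensorProduct.tmul_add, map_add]; exact add_mem hf hg
      | smul c f hf =>
        rw [TensorProduct.tmul_smul, map_smul]; exact Submodule.smul_mem _ _ hf
  obtain ⟨_, ⟨x, hx, rfl⟩, _, ⟨r, hr, rfl⟩, e⟩ := Submodule.mem_sup.1 (hN l)
  exact ⟨x, hx, r, hr, e.symm⟩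

end GammaSet

end

/-! ## Removing a vacuum module -/

noncomputable section

open VertexLieAlgebra DerivationAlgebra CyclotomicDatum
open scoped LaurentSeries

namespace GammaSet

variable {𝓛 : Type*} [AddCommGroup 𝓛] [Module ℂ 𝓛] [VertexLieAlgebra 𝓛] {T : ℕ}
variable {G : CyclotomicDatum 𝓛 T}

/-! ### Orbit sums of simple poles with coefficient c. -/

section OrbitSum

variable (S : GammaSet G)

lemma trace_act (k : ℕ) (x : S.GlobalLie) : S.trace (S.act k x) = S.trace x := by
  rw [← S.trace_mem_fixed x k, trace_apply, trace_apply, map_sum]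
  exact Finset.sum_congr rfl fun j _ => by rw [act_act, act_act, add_comm]

/-- An orbit sum is the trace of a simple pole, and the trace is constant along orbits. -/
lemma orbitSum_smul (k : ℕ) {x y : ℂ} (hx : x ∈ S.carrier) (hy : y ∈ S.carrier)
    (h : y = G.ω ^ k * x) : S.orbitSum y hy = S.orbitSum x hx := by
  subst h
  rw [← trace_centPole, ← trace_centPole, ← S.act_centPole k x hx, trace_act]

lemma expand_orbitSum_of_ne {z x : ℂ} (hx : x ∈ S.carrier) (h : ∀ k : ℕ, z ≠ G.ω ^ k * x) :
    S.expand z (S.orbitSum x hx) = 0 := by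
  rw [orbitSum, map_sum]
  exact Finset.sum_eq_zero fun k _ => S.expand_centPole_ne _ _ _ (h k)

/-- For x ≠ 0 the T points of the orbit are distinct and only k = 0 has its pole at x. At the origin
they coincide and give a factor T, which the level 1 / T compensates. -/
lemma expand_orbitSum_self {x : ℂ} (hx0 : x ≠ 0) (hx : x ∈ S.carrier) :
    S.expand x (S.orbitSum x hx) = centMode 𝓛 := by
  rw [orbitSum, map_sum, Finset.sum_eq_single_of_mem 0 (Finset.mem_range.2 G.T_pos)]
  · rw [S.centPole_congr (show G.ω ^ 0 * x = x by simp), expand_centPole_self]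
  · intro k hk hk0
    refine S.expand_centPole_ne _ _ _ fun h => ?_
    refine ω_pow_mul_ne (G := G) hx0 (Finset.mem_range.1 hk) G.T_pos hk0 ?_
    rw [← h, pow_zero, one_mul]

lemma expand_zero_orbitSum_zero (h0 : (0 : ℂ) ∈ S.carrier) :
    S.expand 0 (S.orbitSum 0 h0) = (T : ℂ) • centMode 𝓛 := by
  have h : ∀ k ∈ Finset.range T, S.expand 0 (S.centPole (G.ω ^ k * 0) (S.smul_mem k 0 h0)) =
      centMode 𝓛 := fun k _ => by
    rw [S.centPole_congr (show G.ω ^ k * 0 = 0 by simp), expand_centPole_self]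
  rw [orbitSum, map_sum, Finset.sum_congr rfl h, Finset.sum_const, Finset.card_range,
    Nat.cast_smul_eq_nsmul]

/-- The invariant element `∑_{α ∈ Γ} cent / (t - α x)`. -/
def fixedOrbitSum (x : ℂ) (hx : x ∈ S.carrier) : S.fixed :=
  ⟨S.orbitSum x hx, fun k => S.act_orbitSum k x hx⟩

end OrbitSum

/-! ### Global classes regarded as classes with more allowed poles. -/

section Enlarge

variable {S S' : GammaSet G} (h : S.carrier ⊆ S'.carrier)

/-- The map of global Lie algebras for an enlarged set of poles. -/
def enlarge : S.GlobalLie →ₗ[ℂ] S'.GlobalLie :=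
  mapLinear LinearMap.id (inclusion h) 1 (fun _ => (one_smul ℂ _).symm)
    (fun f => by rw [one_smul, inclusion_δ])

lemma enlarge_rho (a : 𝓛) (f : ratVanishing S.carrier) :
    enlarge h (rho 𝓛 _ (a ⊗ₜ f)) = rho 𝓛 _ (a ⊗ₜ inclusion h f) := rfl

lemma expand_enlarge (z : ℂ) (x : S.GlobalLie) :
    S'.expand z (enlarge h x) = S.expand z x := by
  induction x using lieOf_induction with
  | tmul a f => rfl
  | add x y hx hy => simp only [map_add, hx, hy]

lemma enlarge_act (k : ℕ) (x : S.GlobalLie) :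
    enlarge h (S.act k x) = S'.act k (enlarge h x) := by
  induction x using lieOf_induction with
  | tmul a f => rfl
  | add x y hx hy => simp only [map_add, hx, hy]

/-- A retraction of functions commuting with the derivative induces a left inverse on Lie_A.
Injectivity allows invariance to be tested after enlarging. -/
lemma enlarge_injective : Function.Injective (enlarge (𝓛 := 𝓛) h) := by
  obtain ⟨r, hr, hrδ⟩ := exists_retraction h
  let R : S'.GlobalLie →ₗ[ℂ] S.GlobalLie :=
    mapLinear LinearMap.id r 1 (fun _ => (one_smul ℂ _).symm) (fun f => by rw [one_smul, hrδ])
  refine Function.LeftInverse.injective (g := R) fun x => ?_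
  induction x using lieOf_induction with
  | tmul a f =>
    rw [enlarge_rho]
    show rho 𝓛 _ (a ⊗ₜ r (inclusion h f)) = _
    rw [hr]
  | add x y hx hy => simp only [map_add, hx, hy]

lemma enlarge_mem_fixed {x : S.GlobalLie} : enlarge h x ∈ S'.fixed ↔ x ∈ S.fixed := by
  refine forall_congr' fun k => ?_
  rw [← enlarge_act, (enlarge_injective h).eq_iff]

/-- The map of invariants for an enlarged set of poles. -/
def enlargeFixed : S.fixed →ₗ[ℂ] S'.fixed :=
  (enlarge h).restrict fun _ hx => (enlarge_mem_fixed h).2 hx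

lemma coe_enlargeFixed (x : S.fixed) : (enlargeFixed h x : S'.GlobalLie) = enlarge h x := rfl

lemma enlarge_orbitSum (x : ℂ) (hx : x ∈ S.carrier) :
    enlarge h (S.orbitSum x hx) = S'.orbitSum x (h hx) := by
  rw [orbitSum, map_sum]
  rfl

lemma enlarge_mem_modes {Lo : Submodule ℂ 𝓛} {x : S.GlobalLie} (hx : x ∈ S.modes Lo) :
    enlarge h x ∈ S'.modes Lo := by
  have hle : S.modes Lo ≤ (S'.modes Lo).comap (enlarge h) := by
    rw [modes, Submodule.span_le]
    rintro _ ⟨a, ha, f, rfl⟩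
    exact Submodule.subset_span ⟨a, ha, _, enlarge_rho h a f⟩
  exact hle hx

lemma enlarge_mem_orbitIdeal {x : S.GlobalLie} (hx : x ∈ S.orbitIdeal) :
    enlarge h x ∈ S'.orbitIdeal := by
  have hle : S.orbitIdeal ≤ S'.orbitIdeal.comap (enlarge h) := by
    rw [orbitIdeal, Submodule.span_le]
    rintro _ ⟨x, hx, y, hy, rfl⟩
    refine Submodule.subset_span ⟨x, h hx, y, h hy, ?_⟩
    rw [map_sub, enlarge_orbitSum, enlarge_orbitSum]
  exact hle hx

lemma enlarge_mem_invariantLie {Lo : Submodule ℂ 𝓛} (hLo : G.IsAdmissible Lo) {x : S.GlobalLie}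
    (hx : x ∈ S.fixed) (hx' : x ∈ S.modes Lo ⊔ S.orbitIdeal) :
    enlarge h x ∈ S'.invariantLie hLo := by
  refine ⟨(enlarge_mem_fixed h).2 hx, ?_⟩
  obtain ⟨k, hk, j, hj, rfl⟩ := Submodule.mem_sup.1 hx'
  rw [map_add]
  exact add_mem (Submodule.mem_sup_left (enlarge_mem_modes h hk))
    (Submodule.mem_sup_right (enlarge_mem_orbitIdeal h hj))

end Enlarge

/-! ### Principal parts on the orbit of u. -/

section Decomposition

variable {S S' : GammaSet G} (h : S.carrier ⊆ S'.carrier) {u : ℂ} (huS' : u ∈ S'.carrier)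
  (hS' : ∀ x ∈ S'.carrier, x ∉ S.carrier → ∃ k : ℕ, x = G.ω ^ k * u)
  {Lo : Submodule ℂ 𝓛} (hLo : G.IsAdmissible Lo)

lemma ω_pow_mod (k : ℕ) : G.ω ^ (k % T) = G.ω ^ k := by
  conv_rhs => rw [← Nat.mod_add_div k T, pow_add, pow_mul, G.primitive.pow_eq_one, one_pow, mul_one]

lemma ω_pow_mul_notMem (hu : u ∉ S.carrier) (k : ℕ) : G.ω ^ k * u ∉ S.carrier := by
  rw [← ω_pow_mod]
  intro hk
  have hlt := Nat.mod_lt k G.T_pos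
  have := S.smul_mem (T - k % T) _ hk
  rw [← mul_assoc, ← pow_add, Nat.sub_add_cancel hlt.le, G.primitive.pow_eq_one, one_mul] at this
  exact hu this

lemma polar_congr {S : GammaSet G} {x y : ℂ} (e : x = y) (hx : x ∈ S.carrier) :
    S.polar x hx = S.polar y (e ▸ hx) := by
  subst e; rfl

include hS' in
/-- Separating the poles in the orbit of `u` from the others. -/
lemma exists_enlarge_add_polar {x : S'.GlobalLie} (hx : x ∈ S'.modes Lo) :
    ∃ y ∈ S.modes Lo, ∃ a : ℕ → ℕ →₀ 𝓛, (∀ k j, a k j ∈ Lo) ∧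
      x = enlarge h y + ∑ k ∈ Finset.range T,
        S'.polar (G.ω ^ k * u) (S'.smul_mem k u huS') (a k) := by
  let Φ : (ℕ → ℕ →₀ 𝓛) →ₗ[ℂ] S'.GlobalLie := ∑ k ∈ Finset.range T,
    S'.polar (G.ω ^ k * u) (S'.smul_mem k u huS') ∘ₗ LinearMap.proj k
  have hΦ : ∀ a, Φ a = ∑ k ∈ Finset.range T,
      S'.polar (G.ω ^ k * u) (S'.smul_mem k u huS') (a k) := fun a => by
    rw [LinearMap.sum_apply]; rfl
  let A : Submodule ℂ (ℕ → ℕ →₀ 𝓛) :=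
    { carrier := {a | ∀ k j, a k j ∈ Lo}
      add_mem' := fun ha hb k j => add_mem (ha k j) (hb k j)
      zero_mem' := fun _ _ => zero_mem _
      smul_mem' := fun c _ ha k j => Submodule.smul_mem _ c (ha k j) }
  have hle : S'.modes Lo ≤ (S.modes Lo).map (enlarge h) ⊔ A.map Φ := by
    rw [modes, Submodule.span_le]
    rintro _ ⟨a, ha, f, rfl⟩
    rw [SetLike.mem_coe]
    induction f using ratVanishing_induction with
    | pole x hx j =>
      by_cases hxS : x ∈ S.carrier
      · exact Submodule.mem_sup_left ⟨rho 𝓛 _ (a ⊗ₜ pole x hxS j),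
          Submodule.subset_span ⟨a, ha, _, rfl⟩, rfl⟩
      · obtain ⟨k, rfl⟩ := hS' x hx hxS
        -- The points of Γu are indexed by exponents below T, so the exponent is reduced modulo T.
        refine Submodule.mem_sup_right ⟨Pi.single (k % T) (Finsupp.single j a), ?_, ?_⟩
        · intro i j'
          by_cases hi : i = k % T
          · subst hi
            rw [Pi.single_eq_same, Finsupp.single_apply]
            split_ifs
            · exact ha
            · exact zero_mem _
          · rw [Pi.single_eq_of_ne hi]
            exact zero_mem _
        · rw [hΦ, Finset.sum_eq_single_of_mem (k % T)
            (Finset.mem_range.2 (Nat.mod_lt k G.T_pos)), Pi.single_eq_same,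
            polar_congr (show G.ω ^ (k % T) * u = G.ω ^ k * u by rw [ω_pow_mod]), polar_single]
          intro i _ hi
          rw [Pi.single_eq_of_ne hi, map_zero]
    | zero => rw [TensorProduct.tmul_zero, map_zero]; exact zero_mem _
    | add f g hf hg => rw [TensorProduct.tmul_add, map_add]; exact add_mem hf hg
    | smul c f hf => rw [TensorProduct.tmul_smul, map_smul]; exact Submodule.smul_mem _ _ hf
  obtain ⟨_, ⟨y, hy, rfl⟩, _, ⟨a, ha, rfl⟩, e⟩ := Submodule.mem_sup.1 (hle hx)
  exact ⟨y, hy, a, ha, by rw [← e, hΦ]⟩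

include huS' hS' hLo in
/-- An invariant class acting by a scalar on the vacuum at `u` has no poles in the orbit
of `u`. -/
lemma exists_enlarge_eq (hu0 : u ≠ 0) (hu : u ∉ S.carrier) {x : S'.GlobalLie} (hx : x ∈ S'.fixed)
    (hxm : x ∈ S'.modes Lo) {s : ℂ} (hs : (S'.expand u x, s) ∈ vacuumPairs 𝓛) :
    s = 0 ∧ ∃ y ∈ S.fixed, y ∈ S.modes Lo ∧ enlarge h y = x := by
  obtain ⟨y, hy, a, ha, e⟩ := exists_enlarge_add_polar h huS' hS' hxm
  -- By invariance the expansion at each ω^k u also acts on the vacuum by s. At this point y and the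
  -- principal parts at the other orbit points are regular, so the part a_k minus s c(-1) lies in
  -- `localPos`, and directness applies.
  have key : ∀ k, k < T → a k = 0 ∧ -s = 0 := by
    intro k hk
    have h1 : (S'.expand (G.ω ^ k * u) x, s) ∈ vacuumPairs 𝓛 := by
      have := localAct_mem_vacuumPairs (G := G) k hs
      rwa [← expand_act, hx k] at this
    have h2 : S'.expand (G.ω ^ k * u) (enlarge h y) ∈ localPos 𝓛 := by
      rw [expand_enlarge]
      exact S.expand_mem_localPos (ω_pow_mul_notMem hu k) y
    have h3 : S'.expand (G.ω ^ k * u) (∑ i ∈ (Finset.range T).erase k,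
        S'.polar (G.ω ^ i * u) (S'.smul_mem i u huS') (a i)) ∈ localPos 𝓛 := by
      rw [map_sum]
      refine sum_mem fun i hi => S'.expand_polar_mem_localPos _ _ ?_ _
      rw [Finset.mem_erase, Finset.mem_range] at hi
      exact ω_pow_mul_ne hu0 hk hi.2 (Ne.symm hi.1)
    refine eq_zero_of_polarTensor_mem hLo (a k) (ha k) (-s) ?_
    rw [mem_vacuumPairs] at h1
    simp only at h1
    rw [e, ← Finset.add_sum_erase _ _ (Finset.mem_range.2 hk), map_add, map_add,
      expand_polar_self] at h1
    have h4 := sub_mem (sub_mem h1 h2) h3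
    rw [neg_smul, ← sub_eq_add_neg]
    convert h4 using 1
    abel
  refine ⟨neg_eq_zero.1 (key 0 G.T_pos).2, y, ?_, hy, ?_⟩
  · rw [← enlarge_mem_fixed h]
    rw [e, Finset.sum_eq_zero, add_zero] at hx
    · exact hx
    · intro k hk
      rw [(key k (Finset.mem_range.1 hk)).1, map_zero]
  · rw [e, Finset.sum_eq_zero, add_zero]
    intro k hk
    rw [(key k (Finset.mem_range.1 hk)).1, map_zero]

end Decomposition

/-! ### Comparison of the two spaces of relations. -/

section Main

variable {S S' : GammaSet G} (h : S.carrier ⊆ S'.carrier) {u : ℂ} (huS' : u ∈ S'.carrier)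
  (hS' : ∀ x ∈ S'.carrier, x ∉ S.carrier → ∃ k : ℕ, x = G.ω ^ k * u)
  (hu0 : u ≠ 0) (hu : u ∉ S.carrier)
  {Lo : Submodule ℂ 𝓛} (hLo : G.IsAdmissible Lo)
  {J : S.CentralIdeal} (hJ : J.I = S.orbitIdeal) {J' : S'.CentralIdeal}
  (hJ' : J'.I = S'.orbitIdeal) {W : Type*} [AddCommGroup W] [Module ℂ W]
  {a : S.fixed →ₗ[ℂ] Module.End ℂ W} {a' : S'.fixed →ₗ[ℂ] Module.End ℂ W}
  (haa' : ∀ x, a' (enlargeFixed h x) = a x)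
  (ha' : ∀ x y z : S'.fixed, (z : S'.GlobalLie) = ⁅(x : S'.GlobalLie), (y : S'.GlobalLie)⁆ →
    a' z = a' x * a' y - a' y * a' x)
  (ha'u : a' (S'.fixedOrbitSum u huS') = 0)
  (ha'S : ∀ x hx, x ∈ S.carrier → a' (S'.fixedOrbitSum x hx) = 1)

include hS' hu0 hu ha'u ha'S in
/-- The differences of orbit sums act on the vacuum at `u` and on `W` by opposite scalars. -/
lemma exists_scalar {j : S'.GlobalLie} (hj : j ∈ S'.orbitIdeal) :
    ∃ (hj' : j ∈ S'.fixed) (s : ℂ), S'.expand u j = s • centMode 𝓛 ∧ a' ⟨j, hj'⟩ = -s • 1 := by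
  -- The scalars on the vacuum and on W are 0 and 1 for a point of S, and 1 and 0 for a point of Γu.
  -- They always add up to one, which cancels in differences.
  have hsum : ∀ x hx, ∃ s : ℂ, S'.expand u (S'.orbitSum x hx) = s • centMode 𝓛 ∧
      a' (S'.fixedOrbitSum x hx) = (1 - s) • 1 := by
    intro x hx
    by_cases hxS : x ∈ S.carrier
    · refine ⟨0, ?_, ?_⟩
      · rw [zero_smul, expand_orbitSum_of_ne]
        intro k hk
        exact hu (hk ▸ S.smul_mem k x hxS)
      · rw [ha'S x hx hxS, sub_zero, one_smul]
    · obtain ⟨k, e⟩ := hS' x hx hxS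
      have e' := S'.orbitSum_smul k huS' hx e
      have e'' : S'.fixedOrbitSum x hx = S'.fixedOrbitSum u huS' := Subtype.ext e'
      refine ⟨1, ?_, ?_⟩
      · rw [e', expand_orbitSum_self _ hu0, one_smul]
      · rw [e'', ha'u, sub_self, zero_smul]
  induction hj using Submodule.span_induction with
  | mem j hj =>
    obtain ⟨x, hx, y, hy, rfl⟩ := hj
    obtain ⟨s, hs, hs'⟩ := hsum x hx
    obtain ⟨t, ht, ht'⟩ := hsum y hy
    refine ⟨sub_mem (S'.fixedOrbitSum x hx).2 (S'.fixedOrbitSum y hy).2, s - t, ?_, ?_⟩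
    · rw [map_sub, hs, ht, sub_smul]
    · have e := map_sub a' (S'.fixedOrbitSum x hx) (S'.fixedOrbitSum y hy)
      rw [hs', ht', ← sub_smul] at e
      refine Eq.trans e ?_
      congr 1
      ring
  | zero =>
    refine ⟨zero_mem _, 0, ?_, ?_⟩
    · rw [map_zero, zero_smul]
    · rw [neg_zero, zero_smul]
      exact map_zero a'
  | add x y _ _ hx hy =>
    obtain ⟨hx, s, hs, hs'⟩ := hx
    obtain ⟨hy, t, ht, ht'⟩ := hy
    refine ⟨add_mem hx hy, s + t, ?_, ?_⟩
    · rw [map_add, hs, ht, add_smul]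
    · have e := map_add a' ⟨x, hx⟩ ⟨y, hy⟩
      rw [hs', ht', ← add_smul, ← neg_add] at e
      exact e
  | smul c x _ hx =>
    obtain ⟨hx, s, hs, hs'⟩ := hx
    refine ⟨Submodule.smul_mem _ c hx, c * s, ?_, ?_⟩
    · rw [map_smul, hs, mul_smul]
    · have e := map_smul a' c ⟨x, hx⟩
      rw [hs', smul_smul, mul_neg] at e
      exact e

/-- Expansion at `u`, as a morphism of Lie algebras. -/
def expandHom (S : GammaSet G) (hLo : G.IsAdmissible Lo) (u : ℂ) :
    S.invariantLie hLo →ₗ⁅ℂ⁆ LocalLie 𝓛 :=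
  { S.expand u ∘ₗ (S.invariantLie hLo).toSubmodule.subtype with
    map_lie' := fun {x y} => S.expand_lie u x y }

lemma expandHom_apply (S : GammaSet G) (hLo : G.IsAdmissible Lo) (u : ℂ)
    (x : S.invariantLie hLo) : expandHom S hLo u x = S.expand u x := rfl

/-- The action of the Lie algebra of invariants. -/
def restrictAct (S : GammaSet G) (hLo : G.IsAdmissible Lo) (a : S.fixed →ₗ[ℂ] Module.End ℂ W) :
    S.invariantLie hLo →ₗ[ℂ] Module.End ℂ W :=
  a ∘ₗ Submodule.inclusion (inf_le_left : (S.invariantLie hLo).toSubmodule ≤ S.fixed)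

include hS' hu0 hu ha'u ha'S haa' hJ in
-- A class acting on the vacuum by s is the sum of a class without poles on Γu and an element of the
-- ideal acting on W by -s. The twist removes the second part.
lemma twistedRelations_eq :
    UniversalEnvelopingAlgebra.twistedRelations (expandHom S' hLo u) (vacuumPairs 𝓛)
      (restrictAct S' hLo a') = relations (J.cyclotomicLie Lo) a := by
  apply le_antisymm
  · rw [UniversalEnvelopingAlgebra.twistedRelations, Submodule.span_le]
    rintro _ ⟨⟨x, hx, hx'⟩, s, w, hr, rfl⟩
    -- The ideal part j accounts for t of the scalar s. The part k in `modes` acts on the vacuum by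
    -- s - t, which `exists_enlarge_eq` forces to be zero while it removes the poles of k on Γu.
    obtain ⟨k, hk, j, hj, e⟩ := Submodule.mem_sup.1 hx'
    obtain ⟨hjf, t, ht, hat⟩ := exists_scalar huS' hS' hu0 hu ha'u ha'S hj
    have hkf : k ∈ S'.fixed := by
      rw [eq_sub_of_add_eq e]
      exact sub_mem hx hjf
    have hr' : (S'.expand u k, s - t) ∈ vacuumPairs 𝓛 := by
      have h1 : S'.expand u x - s • centMode 𝓛 ∈ localPos 𝓛 := hr
      rw [← e, map_add, ht] at h1
      rw [mem_vacuumPairs]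
      simp only
      rw [sub_smul]
      convert h1 using 1
      abel
    obtain ⟨hst, y, hyf, hym, rfl⟩ := exists_enlarge_eq h huS' hS' hLo hu0 hu hkf hk hr'
    have e2 : restrictAct S' hLo a' ⟨x, hx, hx'⟩ = a ⟨y, hyf⟩ + -t • 1 := by
      rw [← hat, ← haa', ← map_add]
      exact congrArg a' (Subtype.ext e.symm)
    rw [SetLike.mem_coe, e2, sub_eq_zero.1 hst, LinearMap.add_apply, LinearMap.smul_apply,
      Module.End.one_apply, neg_smul, neg_add_cancel_right]
    refine Submodule.subset_span ⟨⟨y, hyf⟩, w, ?_, rfl⟩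
    rw [S.mkQ_mem_cyclotomicLie_iff J hJ hyf]
    exact Submodule.mem_sup_left hym
  -- Conversely, a class with poles in S is regular at u, so it kills the vacuum and gives an
  -- untwisted relation.
  · rw [relations, Submodule.span_le]
    rintro _ ⟨x, w, hx, rfl⟩
    rw [S.mkQ_mem_cyclotomicLie_iff J hJ x.2] at hx
    refine Submodule.subset_span ⟨⟨enlarge h x, enlarge_mem_invariantLie h hLo x.2 hx⟩, 0, w,
      ?_, ?_⟩
    · rw [expandHom_apply, expand_enlarge, mem_vacuumPairs, zero_smul, sub_zero]
      exact S.expand_mem_localPos hu _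
    · rw [zero_smul, add_zero, ← haa']
      rfl

/-- The vacuum module as a quotient of the universal enveloping algebra. -/
def vacuumEquiv : (UniversalEnvelopingAlgebra ℂ (LocalLie 𝓛) ⧸ vacuumIdeal 𝓛) ≃ₗ[ℂ]
    VacuumModule 𝓛 :=
  LinearEquiv.refl ℂ (VacuumModule 𝓛)

include hJ' in
-- Both sides use the same invariant representatives. They differ in that the left side is spanned
-- by images of pure tensors, and its Lie algebra is not divided by I.
lemma tensorRelations_map :
    (UniversalEnvelopingAlgebra.tensorRelations (vacuumIdeal 𝓛) (expandHom S' hLo u)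
      (restrictAct S' hLo a')).map (TensorProduct.congr (vacuumEquiv (𝓛 := 𝓛))
        (LinearEquiv.refl ℂ W)).toLinearMap =
    relations (J'.cyclotomicLie Lo) (actTensor S' (actAt S' u (VacuumModule 𝓛)) a') := by
  rw [UniversalEnvelopingAlgebra.tensorRelations, Submodule.map_span]
  apply le_antisymm
  · refine Submodule.span_le.2 ?_
    rintro _ ⟨_, ⟨⟨x, hx, hx'⟩, v, w, rfl⟩, rfl⟩
    refine Submodule.subset_span ⟨⟨x, hx⟩, vacuumEquiv v ⊗ₜ w, ?_, ?_⟩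
    · rwa [S'.mkQ_mem_cyclotomicLie_iff J' hJ' hx]
    · exact map_add (TensorProduct.congr (vacuumEquiv (𝓛 := 𝓛)) (LinearEquiv.refl ℂ W)) _ _
  · rw [relations, Submodule.span_le]
    rintro _ ⟨x, m, hx, rfl⟩
    rw [S'.mkQ_mem_cyclotomicLie_iff J' hJ' x.2] at hx
    rw [SetLike.mem_coe]
    induction m with
    | zero => rw [map_zero]; exact zero_mem _
    | add m m' hm hm' => rw [map_add]; exact add_mem hm hm'
    | tmul v w =>
      refine Submodule.subset_span ⟨_, ⟨⟨x.1, x.2, hx⟩, vacuumEquiv.symm v, w, rfl⟩, ?_⟩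
      exact map_add (TensorProduct.congr (vacuumEquiv (𝓛 := 𝓛)) (LinearEquiv.refl ℂ W)) _ _

include hS' hu0 hu hLo hJ hJ' ha'u ha'S haa' ha' in
/-- A vacuum module at a new point can be removed without changing the coinvariants. -/
theorem exists_coinvariants_equiv :
    ∃ e : ((VacuumModule 𝓛 ⊗[ℂ] W) ⧸
        relations (J'.cyclotomicLie Lo) (actTensor S' (actAt S' u (VacuumModule 𝓛)) a')) ≃ₗ[ℂ]
      (W ⧸ relations (J.cyclotomicLie Lo) a),
      ∀ m : W, e (Submodule.Quotient.mk (vacuum 𝓛 ⊗ₜ[ℂ] m)) = Submodule.Quotient.mk m := by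
  obtain ⟨e, he⟩ := UniversalEnvelopingAlgebra.exists_coinvariants_equiv
    (φ := expandHom S' hLo u) (R := vacuumPairs 𝓛)
    (fun r hr r' hr' => lie_mem_vacuumPairs hr hr')
    (fun l => by
      obtain ⟨x, hx, r, hr, e⟩ := S'.exists_expand_add hLo hu0 huS' l
      exact ⟨⟨x, hx⟩, r, hr, e⟩)
    vacuumIdeal_eq (ψ := restrictAct S' hLo a') (fun x y => ha' _ _ _ rfl)
  refine ⟨(Submodule.Quotient.equiv _ _ _ (tensorRelations_map hLo hJ')).symm ≪≫ₗ e ≪≫ₗ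
    Submodule.quotEquivOfEq _ _
      (twistedRelations_eq h huS' hS' hu0 hu hLo hJ haa' ha'u ha'S), fun m => ?_⟩
  exact congrArg (Submodule.quotEquivOfEq _ _
    (twistedRelations_eq h huS' hS' hu0 hu hLo hJ haa' ha'u ha'S)) (he m)

end Main

end GammaSet

end

/-! ## Modules at several points -/

noncomputable section

open VertexLieAlgebra DerivationAlgebra CyclotomicDatum
open scoped LaurentSeries

/-! ### Operators acting on one factor of a tensor product. -/

namespace PiTensorProduct

variable {ι : Type*} [DecidableEq ι] (M : ι → Type*) [∀ i, AddCommGroup (M i)] [∀ i, Module ℂ (M i)]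

/-- The endomorphism of `⨂ i, M i` acting by `f` on the factor `M i`. -/
def factorEnd [Fintype ι] (i : ι) : Module.End ℂ (M i) →ₗ[ℂ] Module.End ℂ (⨂[ℂ] i, M i) :=
  (PiTensorProduct.mapMultilinear ℂ M M).toLinearMap (fun _ => LinearMap.id) i

variable [Fintype ι]

lemma factorEnd_tprod (i : ι) (f : Module.End ℂ (M i)) (m : ∀ i, M i) :
    factorEnd M i f (tprod ℂ m) = tprod ℂ (Function.update m i (f (m i))) := by
  show PiTensorProduct.map _ _ = _
  rw [PiTensorProduct.map_tprod]
  congr 1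
  funext j
  by_cases h : j = i
  · subst h
    rw [Function.update_self, Function.update_self]
  · rw [Function.update_of_ne h, Function.update_of_ne h]
    rfl

lemma factorEnd_one (i : ι) : factorEnd M i 1 = 1 := by
  refine PiTensorProduct.ext (MultilinearMap.ext fun m => ?_)
  show factorEnd M i 1 (tprod ℂ m) = tprod ℂ m
  rw [factorEnd_tprod, Module.End.one_apply, Function.update_eq_self]

lemma factorEnd_mul (i : ι) (f g : Module.End ℂ (M i)) :
    factorEnd M i (f * g) = factorEnd M i f * factorEnd M i g := by
  refine PiTensorProduct.ext (MultilinearMap.ext fun m => ?_)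
  show factorEnd M i (f * g) (tprod ℂ m) = factorEnd M i f (factorEnd M i g (tprod ℂ m))
  rw [factorEnd_tprod, factorEnd_tprod, factorEnd_tprod, Function.update_self,
    Function.update_idem, Module.End.mul_apply]

lemma factorEnd_comm {i j : ι} (h : i ≠ j) (f : Module.End ℂ (M i)) (g : Module.End ℂ (M j)) :
    factorEnd M i f * factorEnd M j g = factorEnd M j g * factorEnd M i f := by
  refine PiTensorProduct.ext (MultilinearMap.ext fun m => ?_)
  show factorEnd M i f (factorEnd M j g (tprod ℂ m)) = factorEnd M j g (factorEnd M i f (tprod ℂ m))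
  rw [factorEnd_tprod, factorEnd_tprod, factorEnd_tprod, factorEnd_tprod,
    Function.update_of_ne h, Function.update_of_ne h.symm, Function.update_comm h]

end PiTensorProduct

namespace GammaSet

variable {𝓛 : Type*} [AddCommGroup 𝓛] [Module ℂ 𝓛] [VertexLieAlgebra 𝓛] {T : ℕ}
variable {G : CyclotomicDatum 𝓛 T} {S S' : GammaSet G}

/-- The compatibility of an action with brackets. -/
def IsLieAction {W : Type*} [AddCommGroup W] [Module ℂ W] (a : S.fixed →ₗ[ℂ] Module.End ℂ W) :
    Prop :=
  ∀ x y z : S.fixed, (z : S.GlobalLie) = ⁅(x : S.GlobalLie), (y : S.GlobalLie)⁆ →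
    a z = a x * a y - a y * a x

section Local

variable (M : Type*) [AddCommGroup M] [Module ℂ M] [LieRingModule (LocalLie 𝓛) M]
  [LieModule ℂ (LocalLie 𝓛) M]

lemma actAt_apply (z : ℂ) (x : S.fixed) (m : M) :
    S.actAt z M x m = ⁅S.expand z x, m⁆ := rfl

lemma isLieAction_actAt (z : ℂ) : IsLieAction (S.actAt z M) := by
  intro x y w e
  refine LinearMap.ext fun m => ?_
  rw [LinearMap.sub_apply, Module.End.mul_apply, Module.End.mul_apply, actAt_apply, e,
    expand_lie, lie_lie]
  rfl

lemma actAt_enlargeFixed (h : S.carrier ⊆ S'.carrier) (z : ℂ) (x : S.fixed) :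
    S'.actAt z M (enlargeFixed h x) = S.actAt z M x := by
  refine LinearMap.ext fun m => ?_
  rw [actAt_apply, actAt_apply, coe_enlargeFixed, expand_enlarge]

end Local

section Zero

variable (M : Type*) [AddCommGroup M] [Module ℂ M] [LieRingModule G.localInvariants M]
  [LieModule ℂ G.localInvariants M]

lemma actAtZero_apply (x : S.fixed) (m : M) :
    S.actAtZero M x m = ⁅S.expandZero x, m⁆ := rfl

lemma coe_expandZero (x : S.fixed) : (S.expandZero x : LocalLie 𝓛) = S.expand 0 x := rfl

lemma isLieAction_actAtZero : IsLieAction (S.actAtZero M) := by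
  intro x y w e
  have e' : S.expandZero w = ⁅S.expandZero x, S.expandZero y⁆ := by
    refine Subtype.ext ?_
    rw [coe_expandZero, e, expand_lie]
    rfl
  refine LinearMap.ext fun m => ?_
  rw [LinearMap.sub_apply, Module.End.mul_apply, Module.End.mul_apply, actAtZero_apply, e',
    lie_lie]
  rfl

lemma actAtZero_enlargeFixed (h : S.carrier ⊆ S'.carrier) (x : S.fixed) :
    S'.actAtZero M (enlargeFixed h x) = S.actAtZero M x := by
  have e : S'.expandZero (enlargeFixed h x) = S.expandZero x := by
    refine Subtype.ext ?_
    rw [coe_expandZero, coe_expandZero, coe_enlargeFixed, expand_enlarge]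
  refine LinearMap.ext fun m => ?_
  rw [actAtZero_apply, actAtZero_apply, e]

lemma actAtZero_eq_smul (hM : ∀ m : M,
      ⁅(⟨centMode 𝓛, G.centMode_mem⟩ : G.localInvariants), m⁆ = (1 / (T : ℂ)) • m)
    {x : S.fixed} {c : ℂ} (h : S.expand 0 x = c • centMode 𝓛) :
    S.actAtZero M x = (c * (1 / (T : ℂ))) • (1 : Module.End ℂ M) := by
  have e : S.expandZero x = c • (⟨centMode 𝓛, G.centMode_mem⟩ : G.localInvariants) :=
    Subtype.ext h
  refine LinearMap.ext fun m => ?_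
  rw [actAtZero_apply, e, smul_lie, hM, smul_smul]
  rfl

end Zero

section Tensor

variable {P Q : Type*} [AddCommGroup P] [Module ℂ P] [AddCommGroup Q] [Module ℂ Q]

lemma isLieAction_actTensor {a : S.fixed →ₗ[ℂ] Module.End ℂ P} {b : S.fixed →ₗ[ℂ] Module.End ℂ Q}
    (ha : IsLieAction a) (hb : IsLieAction b) : IsLieAction (S.actTensor a b) := by
  intro x y z e
  refine TensorProduct.ext' fun p q => ?_
  have h : ∀ x p q, S.actTensor a b x (p ⊗ₜ q) = a x p ⊗ₜ q + p ⊗ₜ b x q := fun _ _ _ => rfl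
  simp only [LinearMap.sub_apply, Module.End.mul_apply, h, map_add, ha x y z e, hb x y z e,
    TensorProduct.sub_tmul, TensorProduct.tmul_sub]
  abel

lemma actTensor_enlargeFixed (h : S.carrier ⊆ S'.carrier) {a : S.fixed →ₗ[ℂ] Module.End ℂ P}
    {b : S.fixed →ₗ[ℂ] Module.End ℂ Q} {a' : S'.fixed →ₗ[ℂ] Module.End ℂ P}
    {b' : S'.fixed →ₗ[ℂ] Module.End ℂ Q} (ha : ∀ x, a' (enlargeFixed h x) = a x)
    (hb : ∀ x, b' (enlargeFixed h x) = b x) (x : S.fixed) :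
    S'.actTensor a' b' (enlargeFixed h x) = S.actTensor a b x := by
  refine TensorProduct.ext' fun p q => ?_
  show a' (enlargeFixed h x) p ⊗ₜ q + p ⊗ₜ b' (enlargeFixed h x) q = a x p ⊗ₜ q + p ⊗ₜ b x q
  rw [ha, hb]

lemma actTensor_eq_smul {a : S.fixed →ₗ[ℂ] Module.End ℂ P} {b : S.fixed →ₗ[ℂ] Module.End ℂ Q}
    {x : S.fixed} {c d : ℂ} (ha : a x = c • 1) (hb : b x = d • 1) :
    S.actTensor a b x = (c + d) • (1 : Module.End ℂ (P ⊗[ℂ] Q)) := by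
  refine TensorProduct.ext' fun p q => ?_
  show a x p ⊗ₜ q + p ⊗ₜ b x q = (c + d) • p ⊗ₜ[ℂ] q
  rw [ha, hb, add_smul, LinearMap.smul_apply, LinearMap.smul_apply, TensorProduct.tmul_smul]
  rfl

end Tensor

section Pi

variable {N : ℕ} (z : Fin N → ℂ) (M : Fin N → Type*) [∀ i, AddCommGroup (M i)]
  [∀ i, Module ℂ (M i)] [∀ i, LieRingModule (LocalLie 𝓛) (M i)]
  [∀ i, LieModule ℂ (LocalLie 𝓛) (M i)]

lemma actPi_apply (x : S.fixed) :
    S.actPi z M x = ∑ i, PiTensorProduct.factorEnd M i (S.actAt (z i) (M i) x) := by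
  rw [actPi, LinearMap.sum_apply]
  rfl

/-- Operators on different factors commute, so only the diagonal terms of the commutator remain. -/
lemma isLieAction_actPi : IsLieAction (S.actPi z M) := by
  intro x y w e
  simp only [actPi_apply, Finset.sum_mul_sum]
  rw [Finset.sum_comm (f := fun i j => PiTensorProduct.factorEnd M i (S.actAt (z i) (M i) y) *
    PiTensorProduct.factorEnd M j (S.actAt (z j) (M j) x)), ← Finset.sum_sub_distrib]
  refine Finset.sum_congr rfl fun i _ => ?_
  rw [← Finset.sum_sub_distrib, Finset.sum_eq_single_of_mem i (Finset.mem_univ i),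
    isLieAction_actAt (M i) (z i) x y w e, map_sub, PiTensorProduct.factorEnd_mul,
    PiTensorProduct.factorEnd_mul]
  intro j _ hj
  rw [PiTensorProduct.factorEnd_comm M hj.symm, sub_self]

lemma actPi_enlargeFixed (h : S.carrier ⊆ S'.carrier) (x : S.fixed) :
    S'.actPi z M (enlargeFixed h x) = S.actPi z M x := by
  simp only [actPi_apply, actAt_enlargeFixed]

variable {z M}

lemma actPi_eq_smul (hM : ∀ i, ∀ m : M i, ⁅centMode 𝓛, m⁆ = m) {x : S.fixed} {c : Fin N → ℂ}
    (h : ∀ i, S.expand (z i) x = c i • centMode 𝓛) :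
    S.actPi z M x = (∑ i, c i) • (1 : Module.End ℂ (⨂[ℂ] i, M i)) := by
  rw [actPi_apply, Finset.sum_smul]
  refine Finset.sum_congr rfl fun i _ => ?_
  have e : S.actAt (z i) (M i) x = c i • 1 := by
    refine LinearMap.ext fun m => ?_
    rw [actAt_apply, h, smul_lie, hM]
    rfl
  rw [e, map_smul, PiTensorProduct.factorEnd_one]

lemma actPi_fixedOrbitSum_of_ne (hM : ∀ i, ∀ m : M i, ⁅centMode 𝓛, m⁆ = m) {x : ℂ}
    (hx : x ∈ S.carrier) (h : ∀ i, ∀ k : ℕ, z i ≠ G.ω ^ k * x) :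
    S.actPi z M (S.fixedOrbitSum x hx) = (0 : ℂ) • 1 := by
  rw [actPi_eq_smul (c := 0) hM, Finset.sum_eq_zero fun i _ => Pi.zero_apply i]
  intro i
  rw [Pi.zero_apply, zero_smul]
  exact S.expand_orbitSum_of_ne hx (h i)

/-- The orbit of z i contains no other z j, so only the i-th factor contributes, through c(-1) at
level 1. -/
lemma actPi_fixedOrbitSum (hM : ∀ i, ∀ m : M i, ⁅centMode 𝓛, m⁆ = m) (hz0 : ∀ i, z i ≠ 0)
    (hz : ∀ i j, i ≠ j → ∀ k : ℕ, z i ≠ G.ω ^ k * z j) {i : Fin N} {k : ℕ}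
    (hi : z i ∈ S.carrier) (hx : G.ω ^ k * z i ∈ S.carrier) :
    S.actPi z M (S.fixedOrbitSum (G.ω ^ k * z i) hx) = (1 : ℂ) • 1 := by
  rw [show S.fixedOrbitSum (G.ω ^ k * z i) hx = S.fixedOrbitSum (z i) hi from
      Subtype.ext (S.orbitSum_smul k hi hx rfl),
    actPi_eq_smul (c := Pi.single i 1) hM, Finset.sum_pi_single', if_pos (Finset.mem_univ i)]
  intro j
  by_cases h : j = i
  · subst h
    rw [Pi.single_eq_same, one_smul]
    exact S.expand_orbitSum_self (hz0 j) hi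
  · rw [Pi.single_eq_of_ne h, zero_smul]
    exact S.expand_orbitSum_of_ne hi (hz j i h)

end Pi

end GammaSet

/-! ### Orbits of marked points and their ideals. -/

namespace CyclotomicDatum

variable {𝓛 : Type*} [AddCommGroup 𝓛] [Module ℂ 𝓛] [VertexLieAlgebra 𝓛] {T : ℕ}
variable (G : CyclotomicDatum 𝓛 T) {n : ℕ} (p : Fin n → ℂ)

/-- The generators attached to arbitrary points of the orbits reduce to those at the marked points,
since orbit sums depend only on the orbit. -/
lemma ideal_I : (G.ideal p).I = (G.orbit p).orbitIdeal := by
  apply le_antisymm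
  · rw [ideal, GammaSet.orbitIdeal]
    refine Submodule.span_mono ?_
    rintro _ ⟨i, j, rfl⟩
    exact ⟨_, _, _, _, rfl⟩
  · rw [GammaSet.orbitIdeal, Submodule.span_le]
    rintro _ ⟨_, h, _, h', rfl⟩
    obtain ⟨i, k, rfl⟩ := id h
    obtain ⟨j, l, rfl⟩ := id h'
    rw [GammaSet.orbitSum_smul _ k (mem_orbit p i) h rfl,
      GammaSet.orbitSum_smul _ l (mem_orbit p j) h' rfl]
    exact Submodule.subset_span ⟨i, j, rfl⟩

lemma orbitSum_zero {S : GammaSet G} (h : (0 : ℂ) ∈ S.carrier) :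
    S.orbitSum 0 h = (T : ℂ) • S.centPole 0 h := by
  have e : ∀ k ∈ Finset.range T, S.centPole (G.ω ^ k * 0) (S.smul_mem k 0 h) = S.centPole 0 h :=
    fun k _ => S.centPole_congr (by simp) _
  rw [GammaSet.orbitSum, Finset.sum_congr rfl e, Finset.sum_const, Finset.card_range,
    Nat.cast_smul_eq_nsmul]

/-- T c / t is itself the orbit sum at the origin. A general difference of orbit sums is a
difference of two comparisons with it. -/
lemma idealZero_I : (G.idealZero p).I = (G.orbitZero p).orbitIdeal := by
  apply le_antisymm
  · rw [idealZero, GammaSet.orbitIdeal]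
    refine Submodule.span_mono ?_
    rintro _ ⟨i, rfl⟩
    rw [← orbitSum_zero]
    exact ⟨_, _, _, _, rfl⟩
  · have key : ∀ x h, (G.orbitZero p).orbitSum x h -
        (T : ℂ) • (G.orbitZero p).centPole 0 (zero_mem_orbitZero p) ∈ (G.idealZero p).I := by
      intro x h
      rcases id h with ⟨i, k, rfl⟩ | rfl
      · rw [GammaSet.orbitSum_smul _ k (mem_orbitZero p i) h rfl]
        exact Submodule.subset_span ⟨i, rfl⟩
      · rw [orbitSum_zero, sub_self]
        exact zero_mem _
    rw [GammaSet.orbitIdeal, Submodule.span_le]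
    rintro _ ⟨x, h, y, h', rfl⟩
    rw [← sub_sub_sub_cancel_right _ _
      ((T : ℂ) • (G.orbitZero p).centPole 0 (zero_mem_orbitZero p))]
    exact sub_mem (key x h) (key y h')

variable {G p} {u : ℂ}

lemma ne_ω_pow_mul {y : ℂ} (h : ∀ k : ℕ, u ≠ G.ω ^ k * y) (k : ℕ) : y ≠ G.ω ^ k * u := by
  rintro rfl
  have hlt := Nat.mod_lt k G.T_pos
  refine h (T - k % T) ?_
  rw [← GammaSet.ω_pow_mod (G := G) k, ← mul_assoc, ← pow_add, Nat.sub_add_cancel hlt.le,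
    G.primitive.pow_eq_one, one_mul]

lemma orbit_subset_cons : (G.orbit p).carrier ⊆ (G.orbit (Fin.cons u p)).carrier := by
  rintro _ ⟨i, k, rfl⟩
  exact ⟨i.succ, k, by rw [Fin.cons_succ]⟩

lemma orbitZero_subset_cons : (G.orbitZero p).carrier ⊆ (G.orbitZero (Fin.cons u p)).carrier := by
  rintro _ (⟨i, k, rfl⟩ | h)
  · exact Or.inl ⟨i.succ, k, by rw [Fin.cons_succ]⟩
  · exact Or.inr h

lemma exists_of_mem_orbit_cons {x : ℂ} (hx : x ∈ (G.orbit (Fin.cons u p)).carrier)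
    (hx' : x ∉ (G.orbit p).carrier) : ∃ k : ℕ, x = G.ω ^ k * u := by
  obtain ⟨i, k, rfl⟩ := hx
  induction i using Fin.cases with
  | zero => exact ⟨k, rfl⟩
  | succ i => exact absurd ⟨i, k, by rw [Fin.cons_succ]⟩ hx'

lemma exists_of_mem_orbitZero_cons {x : ℂ} (hx : x ∈ (G.orbitZero (Fin.cons u p)).carrier)
    (hx' : x ∉ (G.orbitZero p).carrier) : ∃ k : ℕ, x = G.ω ^ k * u := by
  rcases hx with hx | hx
  · exact exists_of_mem_orbit_cons hx fun h => hx' (Or.inl h)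
  · exact absurd (Or.inr hx) hx'

end CyclotomicDatum

open GammaSet

/-- Vacuum modules can be added without changing the spaces of coinvariants. -/
theorem proposition3p2 {𝓛 : Type u} [AddCommGroup 𝓛] [Module ℂ 𝓛]
    [VertexLieAlgebra 𝓛] {T : ℕ} (G : CyclotomicDatum 𝓛 T)
    (Lo : Submodule ℂ 𝓛) (hLo : G.IsAdmissible Lo)
    {N : ℕ} (z : Fin N → ℂ) (hz0 : ∀ i, z i ≠ 0)
    (hz : ∀ i j, i ≠ j → ∀ k : ℕ, z i ≠ G.ω ^ k * z j)
    (M : Fin N → Type v) [∀ i, AddCommGroup (M i)] [∀ i, Module ℂ (M i)]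
    [∀ i, LieRingModule (LocalLie 𝓛) (M i)] [∀ i, LieModule ℂ (LocalLie 𝓛) (M i)]
    (hM : ∀ i, ∀ m : M i, ⁅centMode 𝓛, m⁆ = m)
    (u : ℂ) (hu0 : u ≠ 0) (hu : ∀ i, ∀ k : ℕ, u ≠ G.ω ^ k * z i) :
    (∃ e : ((VacuumModule 𝓛 ⊗[ℂ] (⨂[ℂ] i, M i)) ⧸
          GammaSet.relations (G.globalLie Lo (Fin.cons u z))
            (GammaSet.actTensor _ (GammaSet.actAt _ u (VacuumModule 𝓛)) (GammaSet.actPi _ z M)))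
        ≃ₗ[ℂ]
        ((⨂[ℂ] i, M i) ⧸ GammaSet.relations (G.globalLie Lo z) (GammaSet.actPi _ z M)),
      ∀ m : ⨂[ℂ] i, M i,
        e (Submodule.Quotient.mk (vacuum 𝓛 ⊗ₜ[ℂ] m)) = Submodule.Quotient.mk m) ∧
    ∀ (M₀ : Type w) [AddCommGroup M₀] [Module ℂ M₀] [LieRingModule G.localInvariants M₀]
      [LieModule ℂ G.localInvariants M₀]
      (_ : ∀ m : M₀, ⁅(⟨centMode 𝓛, G.centMode_mem⟩ : G.localInvariants), m⁆ =
        (1 / (T : ℂ)) • m),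
      ∃ e : ((VacuumModule 𝓛 ⊗[ℂ] ((⨂[ℂ] i, M i) ⊗[ℂ] M₀)) ⧸
          GammaSet.relations (G.globalLieZero Lo (Fin.cons u z))
            (GammaSet.actTensor _ (GammaSet.actAt _ u (VacuumModule 𝓛))
              (GammaSet.actTensor _ (GammaSet.actPi _ z M) (GammaSet.actAtZero _ M₀))))
        ≃ₗ[ℂ]
        (((⨂[ℂ] i, M i) ⊗[ℂ] M₀) ⧸ GammaSet.relations (G.globalLieZero Lo z)
            (GammaSet.actTensor _ (GammaSet.actPi _ z M) (GammaSet.actAtZero _ M₀))),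
      ∀ m : (⨂[ℂ] i, M i) ⊗[ℂ] M₀,
        e (Submodule.Quotient.mk (vacuum 𝓛 ⊗ₜ[ℂ] m)) = Submodule.Quotient.mk m := by
  have hun : u ∉ (G.orbit z).carrier := by
    rintro ⟨i, k, e⟩
    exact hu i k e
  have hun' : u ∉ (G.orbitZero z).carrier := by
    rintro (⟨i, k, e⟩ | e)
    · exact hu i k e
    · exact hu0 e
  have huz : ∀ i, ∀ k : ℕ, z i ≠ G.ω ^ k * u := fun i => ne_ω_pow_mul (hu i)
  constructor
  · have huS : u ∈ (G.orbit (Fin.cons u z)).carrier := mem_orbit (Fin.cons u z) 0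
    refine GammaSet.exists_coinvariants_equiv (S := G.orbit z) (S' := G.orbit (Fin.cons u z))
      (J := G.ideal z) (J' := G.ideal (Fin.cons u z)) orbit_subset_cons huS
      (fun x hx hx' => exists_of_mem_orbit_cons hx hx') hu0 hun hLo (ideal_I G z) (ideal_I G _)
      (actPi_enlargeFixed z M _) (isLieAction_actPi z M) ?_ ?_
    · rw [actPi_fixedOrbitSum_of_ne hM _ huz, zero_smul]
    · rintro x hx ⟨i, k, rfl⟩
      rw [actPi_fixedOrbitSum hM hz0 hz (orbit_subset_cons (mem_orbit z i)), one_smul]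
  · intro M₀ _ _ _ _ hM₀
    have hT : (T : ℂ) ≠ 0 := Nat.cast_ne_zero.2 G.T_pos.ne'
    have huS : u ∈ (G.orbitZero (Fin.cons u z)).carrier := mem_orbitZero (Fin.cons u z) 0
    refine GammaSet.exists_coinvariants_equiv (S := G.orbitZero z)
      (S' := G.orbitZero (Fin.cons u z))
      (J := G.idealZero z) (J' := G.idealZero (Fin.cons u z)) orbitZero_subset_cons
      huS
      (fun x hx hx' => exists_of_mem_orbitZero_cons hx hx') hu0 hun' hLo (idealZero_I G z)
      (idealZero_I G _)
      (actTensor_enlargeFixed _ (actPi_enlargeFixed z M _) (actAtZero_enlargeFixed M₀ _))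
      (isLieAction_actTensor (isLieAction_actPi z M) (isLieAction_actAtZero M₀)) ?_ ?_
    · rw [actTensor_eq_smul (actPi_fixedOrbitSum_of_ne hM _ huz)
        (actAtZero_eq_smul M₀ hM₀ (c := 0) ?_), zero_mul, add_zero, zero_smul]
      rw [zero_smul]
      exact expand_orbitSum_of_ne _ huS fun k => (mul_ne_zero (G.ω_pow_ne_zero k) hu0).symm
    · rintro x hx (⟨i, k, rfl⟩ | rfl)
      · rw [actTensor_eq_smul (actPi_fixedOrbitSum hM hz0 hz
            (orbitZero_subset_cons (mem_orbitZero z i)) hx)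
          (actAtZero_eq_smul M₀ hM₀ (c := 0) ?_), zero_mul, add_zero, one_smul]
        rw [zero_smul]
        exact expand_orbitSum_of_ne _ hx fun l =>
          (mul_ne_zero (G.ω_pow_ne_zero l) (mul_ne_zero (G.ω_pow_ne_zero k) (hz0 i))).symm
      -- At the origin the factors at the points z i contribute 0. On M₀ the orbit sum acts as T
      -- c(-1), that is by T · (1 / T) = 1.
      · rw [actTensor_eq_smul
          (actPi_fixedOrbitSum_of_ne hM hx fun i k => by rw [mul_zero]; exact hz0 i)
          (actAtZero_eq_smul M₀ hM₀ (expand_zero_orbitSum_zero _ hx)), zero_add,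
          mul_one_div_cancel hT, one_smul]


end
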